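/- **Theorem 1.1.** Let $k$ be a field of arbitrary characteristic and let $X$ be a smooth superscheme over $k$: its structure sheaf $\mathcal O_X$ is a sheaf of supercommutative $\mathbb Z/2$-graded $k$-algebras (odd elements anticommute and have square zero) on a topological space $|X|$, the even part of $\mathcal O_X$ makes $|X|$ a scheme, the odd part is a quasi-coherent module over the even part, and every point has an affine open neighbourhood $U$ with $\mathcal O_X(U)\simeq\bigwedge_B^\bullet(B^n)$ as $\mathbb Z/2$-graded $k$-algebras, for some smooth commutative $k$-algebra $B$ and some $n\ge 0$. Let $\mathcal N\subset\mathcal O_X$ be the ideal generated by the odd functions and let $X_0=(|X|,\mathcal O_X/\mathcal N)$ be the bosonization of $X$. Let $\Omega_X^\bullet$ and $\Omega_{X_0}^\bullet$ be the algebraic de Rham complexes over $k$ (in the graded sense, with $d$ of even parity, so that differentials of odd functions commute with each other and the complex $\Omega_X^\bullet$ may be unbounded above), viewed as complexes of Zariski sheaves of $k$-vector spaces on $|X|$, and let $H^n_{dR}$ denote their hypercohomology. Then the natural map of complexes $$\Omega_X^\bullet\to\Omega_{X_0}^\bullet$$ is surjective, and its kernel $K$ is acyclic (exact in every degree). Hence,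 for every $n$, the induced natural map $$H^n_{dR}(X)\to H^n_{dR}(X_0)$$ is an isomorphism. -/

import Mathlib

open CategoryTheory TopologicalSpace AlgebraicGeometry Opposite

universe u

noncomputable section

/-! ### Supercommutative algebras -/

/-- A supercommutative superalgebra over `k`: a `ℤ/2`-graded associative unital algebra
in which even elements are central, odd elements anticommute, and odd elements have square zero
(the last condition is implied by the second one unless `2` is a zero divisor; it is part of
the usual definition of supercommutativity in characteristic two). -/
structure SuperAlg (k : Type u) [Field k] where
  carrier : Type u
  [ring : Ring carrier]
  [algebra : Algebra k carrier]
  /-- `grading 0` is the even part, `grading 1` is the odd part -/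
  grading : ZMod 2 → Submodule k carrier
  [graded : GradedAlgebra grading]
  even_comm : ∀ a ∈ grading 0, ∀ b, a * b = b * a
  odd_anticomm : ∀ a ∈ grading 1, ∀ b ∈ grading 1, a * b = -(b * a)
  odd_sq : ∀ a ∈ grading 1, a * a = 0

namespace SuperAlg

variable {k : Type u} [Field k]

instance : CoeSort (SuperAlg k) (Type u) := ⟨carrier⟩

attribute [instance] ring algebra graded

/-- Morphisms of superalgebras: algebra homomorphisms preserving parity. -/
@[ext]
structure Hom (A B : SuperAlg k) where
  toAlgHom : A →ₐ[k] B
  map_mem : ∀ i, ∀ a ∈ A.grading i, toAlgHom a ∈ B.grading i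

instance : Category (SuperAlg k) where
  Hom A B := Hom A B
  id A := ⟨AlgHom.id k A, fun _ _ h => h⟩
  comp f g := ⟨g.toAlgHom.comp f.toAlgHom, fun i a h => g.map_mem i _ (f.map_mem i a h)⟩

@[ext]
lemma hom_ext {A B : SuperAlg k} {f g : A ⟶ B} (h : f.toAlgHom = g.toAlgHom) : f = g :=
  Hom.ext h

@[simp] lemma id_toAlgHom (A : SuperAlg k) : Hom.toAlgHom (𝟙 A) = AlgHom.id k A := rfl

@[simp] lemma comp_toAlgHom {A B C : SuperAlg k} (f : A ⟶ B) (g : B ⟶ C) :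
    Hom.toAlgHom (f ≫ g) = g.toAlgHom.comp f.toAlgHom := rfl

/-- The underlying vector space of a superalgebra. -/
def toModule (k : Type u) [Field k] : SuperAlg k ⥤ ModuleCat.{u} k where
  obj A := ModuleCat.of k A
  map f := ModuleCat.ofHom f.toAlgHom.toLinearMap

/-- The grading of a purely even superalgebra. -/
def trivialGrading (k B : Type u) [Field k] [CommRing B] [Algebra k B] (i : ZMod 2) :
    Submodule k B :=
  if i = 0 then ⊤ else ⊥

instance (B : Type u) [CommRing B] [Algebra k B] : GradedAlgebra (trivialGrading k B) where
  one_mem := by simp [trivialGrading]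
  mul_mem := by
    intro i j a b ha hb
    by_cases hi : i = 0
    · by_cases hj : j = 0
      · simp [hi, hj, trivialGrading]
      · rw [trivialGrading, if_neg hj, Submodule.mem_bot] at hb
        simp [hb]
    · rw [trivialGrading, if_neg hi, Submodule.mem_bot] at ha
      simp [ha]
  decompose' := fun b => DirectSum.of (fun i => ↥(trivialGrading k B i)) 0
    ⟨b, by simp [trivialGrading]⟩
  left_inv := fun b => DirectSum.coeAddMonoidHom_of _ _ _
  right_inv := fun x => by
    induction x using DirectSum.induction_on with
    | zero => rw [map_zero]; exact map_zero (DirectSum.of _ _)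
    | of i x =>
      rw [DirectSum.coeAddMonoidHom_of]
      by_cases hi : i = 0
      · subst hi; rfl
      · obtain ⟨x, hx⟩ := x
        have hx' := hx
        rw [trivialGrading, if_neg hi, Submodule.mem_bot] at hx'
        subst hx'
        exact (map_zero (DirectSum.of _ _)).trans (map_zero (DirectSum.of _ _)).symm
    | add x y hx hy =>
      rw [map_add]
      exact (map_add (DirectSum.of (fun i => ↥(trivialGrading k B i)) 0)
        ⟨_, by simp [trivialGrading]⟩ ⟨_, by simp [trivialGrading]⟩).trans
        (congrArg₂ (· + ·) hx hy)

/-- A commutative algebra, viewed as a purely even superalgebra. -/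
def ofComm (k B : Type u) [Field k] [CommRing B] [Algebra k B] : SuperAlg k where
  carrier := B
  grading := trivialGrading k B
  even_comm := fun a _ b => mul_comm a b
  odd_anticomm := fun a ha b _ => by
    have : a = 0 := by simpa [trivialGrading] using ha
    simp [this]
  odd_sq := fun a ha => by
    have : a = 0 := by simpa [trivialGrading] using ha
    simp [this]

lemma eq_zero_of_mem_trivialGrading {B : Type u} [CommRing B] [Algebra k B] {b : B}
    (hb : b ∈ trivialGrading k B 1) : b = 0 := by
  simpa [trivialGrading] using hb

/-- A homomorphism to a commutative algebra killing odd elements is a morphism of superalgebras. -/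
def homOfComm {A : SuperAlg k} {B : Type u} [CommRing B] [Algebra k B] (f : A →ₐ[k] B)
    (hf : ∀ a ∈ A.grading 1, f a = 0) : A ⟶ ofComm k B where
  toAlgHom := f
  map_mem i a ha := by
    by_cases hi : i = 0
    · subst hi
      exact Submodule.mem_top (R := k) (M := B)
    · obtain rfl : i = 1 := by
        clear ha; revert hi; revert i; decide
      change f a ∈ trivialGrading k B 1
      rw [hf a ha]
      exact Submodule.zero_mem _

/-- A homomorphism of commutative algebras, as a morphism of purely even superalgebras. -/
def ofCommMap {B C : Type u} [CommRing B] [CommRing C] [Algebra k B] [Algebra k C]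
    (f : B →ₐ[k] C) : ofComm k B ⟶ ofComm k C :=
  homOfComm (A := ofComm k B) f fun b hb => by
    exact (congrArg f (eq_zero_of_mem_trivialGrading (B := B) hb)).trans (map_zero f)

section

variable (A : SuperAlg k)

lemma exists_add (a : A) : ∃ x ∈ A.grading 0, ∃ y ∈ A.grading 1, a = x + y := by
  classical
  refine ⟨_, (DirectSum.decompose A.grading a 0).2, _, (DirectSum.decompose A.grading a 1).2, ?_⟩
  have h := DirectSum.sum_support_decompose A.grading a
  conv_lhs => rw [← h]
  rw [Finset.sum_subset (Finset.subset_univ _)]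
  · exact Fin.sum_univ_two (fun i : Fin 2 => ((DirectSum.decompose A.grading a) i : A))
  · intro i _ hi
    simpa using hi

/-- The even part of a superalgebra, as a commutative `k`-subalgebra. -/
def evenSubalgebra : Subalgebra k A where
  carrier := A.grading 0
  mul_mem' ha hb := by simpa using SetLike.GradedMul.mul_mem ha hb
  add_mem' ha hb := (A.grading 0).add_mem ha hb
  algebraMap_mem' c := SetLike.algebraMap_mem_graded A.grading c

instance : CommRing A.evenSubalgebra :=
  { (inferInstance : Ring A.evenSubalgebra) with
    mul_comm := fun a b => Subtype.ext (A.even_comm a a.2 b) }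

/-- The ideal generated by the odd elements. -/
def oddIdeal : Ideal A := Ideal.span (A.grading 1 : Set A)

instance : A.oddIdeal.IsTwoSided where
  mul_mem_of_left := by
    intro a b ha
    obtain ⟨x, hx, y, hy, rfl⟩ := A.exists_add b
    refine Submodule.span_induction (p := fun a _ => a * (x + y) ∈ A.oddIdeal) ?_ ?_ ?_ ?_ ha
    · intro c hc
      have h : c * (x + y) = (x - y) * c := by
        rw [mul_add, sub_mul, ← A.even_comm x hx c, A.odd_anticomm c hc y hy]
        abel
      rw [h]
      exact A.oddIdeal.mul_mem_left _ (Ideal.subset_span hc)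
    · simp
    · intro c d _ _ hc hd
      rw [add_mul]
      exact A.oddIdeal.add_mem hc hd
    · intro r c _ hc
      rw [smul_eq_mul, mul_assoc]
      exact A.oddIdeal.mul_mem_left _ hc

instance : CommRing (A ⧸ A.oddIdeal) :=
  { (inferInstance : Ring (A ⧸ A.oddIdeal)) with
    mul_comm := by
      intro a b
      obtain ⟨a, rfl⟩ := Ideal.Quotient.mk_surjective a
      obtain ⟨b, rfl⟩ := Ideal.Quotient.mk_surjective b
      obtain ⟨x, hx, y, hy, rfl⟩ := A.exists_add a
      have h : Ideal.Quotient.mk A.oddIdeal y = 0 :=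
        Ideal.Quotient.eq_zero_iff_mem.2 (Ideal.subset_span hy)
      change Ideal.Quotient.mk _ _ * Ideal.Quotient.mk _ _ =
        Ideal.Quotient.mk _ _ * Ideal.Quotient.mk _ _
      rw [map_add, h, add_zero, ← map_mul, ← map_mul, A.even_comm x hx b] }

end

lemma oddIdeal_le_comap {A B : SuperAlg k} (f : A ⟶ B) :
    A.oddIdeal ≤ B.oddIdeal.comap f.toAlgHom.toRingHom :=
  Ideal.span_le.2 fun a ha => Ideal.subset_span (f.map_mem 1 a ha)

/-- The even part, as a functor to commutative rings. -/
def evenPart (k : Type u) [Field k] : SuperAlg k ⥤ CommRingCat.{u} where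
  obj A := CommRingCat.of A.evenSubalgebra
  map {A B} f := CommRingCat.ofHom
    ((f.toAlgHom.toRingHom.comp A.evenSubalgebra.val.toRingHom).codRestrict
      B.evenSubalgebra.toSubring fun a => f.map_mem 0 a a.2)

/-- The quotient of a superalgebra by the ideal generated by the odd elements, as a functor to
commutative rings. -/
def modOdd (k : Type u) [Field k] : SuperAlg k ⥤ CommRingCat.{u} where
  obj A := CommRingCat.of (A ⧸ A.oddIdeal)
  map {A B} f := CommRingCat.ofHom
    (Ideal.quotientMap B.oddIdeal f.toAlgHom.toRingHom (oddIdeal_le_comap f))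
  map_id A := by
    ext a
    rfl
  map_comp f g := by
    ext a
    rfl

/-- The projection from a superalgebra to its quotient by the ideal generated by odd elements. -/
def toModOdd (A : SuperAlg k) : A →+* (modOdd k).obj A := Ideal.Quotient.mk A.oddIdeal

lemma toModOdd_eq_zero {A : SuperAlg k} {a : A} (ha : a ∈ A.grading 1) : toModOdd A a = 0 :=
  Ideal.Quotient.eq_zero_iff_mem.2 (Ideal.subset_span ha)

/-! ### The de Rham complex of a superalgebra -/

section

variable (A : SuperAlg k)

/-- The function `a` in the free algebra on symbols `a` and `d a`, for `a` in `A`. -/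
abbrev freeFun (a : A) : FreeAlgebra k (A ⊕ A) := FreeAlgebra.ι k (Sum.inl a)

/-- The differential `d a` in the free algebra on symbols `a` and `d a`, for `a` in `A`. -/
abbrev freeDiff (a : A) : FreeAlgebra k (A ⊕ A) := FreeAlgebra.ι k (Sum.inr a)

/-- The relations of the algebra of differential forms. The first three make `A` a subalgebra, the
next three say that `d` is a `k`-linear derivation (with `d` even), and the last three are the sign
rule `ω η = (-1) ^ (p q + |ω| |η|) η ω` for forms of degrees `p`, `q` and parities `|ω|`, `|η|`,
together with `(d a)² = 0` for even `a`. Nothing is imposed on `(d a)²` for odd `a`. -/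
inductive FormRel : FreeAlgebra k (A ⊕ A) → FreeAlgebra k (A ⊕ A) → Prop
  | fun_add (a b : A) : FormRel (freeFun A (a + b)) (freeFun A a + freeFun A b)
  | fun_mul (a b : A) : FormRel (freeFun A (a * b)) (freeFun A a * freeFun A b)
  | fun_const (c : k) : FormRel (freeFun A (algebraMap k A c)) (algebraMap k _ c)
  | diff_add (a b : A) : FormRel (freeDiff A (a + b)) (freeDiff A a + freeDiff A b)
  | diff_const (c : k) : FormRel (freeDiff A (algebraMap k A c)) 0
  | diff_mul (a b : A) :
      FormRel (freeDiff A (a * b)) (freeDiff A a * freeFun A b + freeFun A a * freeDiff A b)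
  | diff_comm_fun (i j : ZMod 2) (a b : A) (ha : a ∈ A.grading i) (hb : b ∈ A.grading j) :
      FormRel (freeDiff A a * freeFun A b)
        ((-1) ^ (i.val * j.val) * (freeFun A b * freeDiff A a))
  | diff_comm_diff (i j : ZMod 2) (a b : A) (ha : a ∈ A.grading i) (hb : b ∈ A.grading j) :
      FormRel (freeDiff A a * freeDiff A b)
        ((-1) ^ (1 + i.val * j.val) * (freeDiff A b * freeDiff A a))
  | diff_sq (a : A) (ha : a ∈ A.grading 0) : FormRel (freeDiff A a * freeDiff A a) 0

/-- The algebra `Ω_A = ⨁ₚ Ωᵖ_A` of Kähler differential forms of `A` over `k`: the exterior algebra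
(in the graded sense) of the module of Kähler differentials of the superalgebra `A`. -/
def Forms : Type u := RingQuot A.FormRel

instance : Ring A.Forms := inferInstanceAs (Ring (RingQuot A.FormRel))

instance : Algebra k A.Forms := inferInstanceAs (Algebra k (RingQuot A.FormRel))

/-- The projection from the free algebra. -/
def Forms.mk : FreeAlgebra k (A ⊕ A) →ₐ[k] A.Forms := RingQuot.mkAlgHom k A.FormRel

variable {A} in
lemma Forms.mk_rel {x y : FreeAlgebra k (A ⊕ A)} (h : A.FormRel x y) :
    Forms.mk A x = Forms.mk A y :=
  RingQuot.mkAlgHom_rel k h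

variable {A} in
/-- The universal property of the quotient. -/
def Forms.lift {R : Type*} [Ring R] [Algebra k R] (f : FreeAlgebra k (A ⊕ A) →ₐ[k] R)
    (hf : ∀ x y, A.FormRel x y → f x = f y) : A.Forms →ₐ[k] R :=
  RingQuot.liftAlgHom k ⟨f, hf⟩

variable {A} in
@[simp]
lemma Forms.lift_mk {R : Type*} [Ring R] [Algebra k R] (f : FreeAlgebra k (A ⊕ A) →ₐ[k] R)
    (hf : ∀ x y, A.FormRel x y → f x = f y) (x : FreeAlgebra k (A ⊕ A)) :
    Forms.lift f hf (Forms.mk A x) = f x :=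
  RingQuot.liftAlgHom_mkAlgHom_apply _ _ hf x

variable {A} in
lemma Forms.algHom_ext {R : Type*} [Ring R] [Algebra k R] {f g : A.Forms →ₐ[k] R}
    (hf : ∀ a, f (Forms.mk A (freeFun A a)) = g (Forms.mk A (freeFun A a)))
    (hd : ∀ a, f (Forms.mk A (freeDiff A a)) = g (Forms.mk A (freeDiff A a))) : f = g := by
  refine RingQuot.ringQuot_ext' k f g (FreeAlgebra.hom_ext ?_)
  funext x
  rcases x with a | a
  · exact hf a
  · exact hd a

lemma Forms.mk_surjective : Function.Surjective (Forms.mk A) :=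
  RingQuot.mkAlgHom_surjective k A.FormRel

/-- Functions as forms of degree zero. -/
def Forms.ofFun : A →ₐ[k] A.Forms where
  toFun a := Forms.mk A (freeFun A a)
  map_one' := by
    have h := Forms.mk_rel (FormRel.fun_const (A := A) 1)
    rwa [map_one, map_one, map_one] at h
  map_mul' a b := (Forms.mk_rel (FormRel.fun_mul a b)).trans (map_mul _ _ _)
  map_zero' := by
    have h := Forms.mk_rel (FormRel.fun_const (A := A) 0)
    rwa [map_zero, map_zero, map_zero] at h
  map_add' a b := (Forms.mk_rel (FormRel.fun_add a b)).trans (map_add _ _ _)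
  commutes' c := (Forms.mk_rel (FormRel.fun_const c)).trans (AlgHom.commutes _ c)

/-- The universal derivation `a ↦ d a` from functions to one-forms. -/
def Forms.ofDiff : A →ₗ[k] A.Forms where
  toFun a := Forms.mk A (freeDiff A a)
  map_add' a b := (Forms.mk_rel (FormRel.diff_add a b)).trans (map_add _ _ _)
  map_smul' c a := by
    have h := Forms.mk_rel (FormRel.diff_mul (algebraMap k A c) a)
    rw [map_add, map_mul, map_mul, Forms.mk_rel (FormRel.diff_const c), map_zero,
      Forms.mk_rel (FormRel.fun_const c), zero_mul, zero_add, AlgHom.commutes,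
      ← Algebra.smul_def, ← Algebra.smul_def] at h
    exact h

lemma Forms.ofFun_apply (a : A) : Forms.ofFun A a = Forms.mk A (freeFun A a) := rfl

lemma Forms.ofDiff_apply (a : A) : Forms.ofDiff A a = Forms.mk A (freeDiff A a) := rfl

lemma Forms.ofDiff_mul (a b : A) : Forms.ofDiff A (a * b) =
    Forms.ofDiff A a * Forms.ofFun A b + Forms.ofFun A a * Forms.ofDiff A b := by
  simpa [Forms.ofFun_apply, Forms.ofDiff_apply] using Forms.mk_rel (FormRel.diff_mul a b)

lemma Forms.ofDiff_algebraMap (c : k) : Forms.ofDiff A (algebraMap k A c) = 0 := by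
  simpa [Forms.ofFun_apply, Forms.ofDiff_apply] using Forms.mk_rel (FormRel.diff_const (A := A) c)

lemma Forms.ofDiff_mul_ofFun {i j : ZMod 2} {a b : A} (ha : a ∈ A.grading i)
    (hb : b ∈ A.grading j) : Forms.ofDiff A a * Forms.ofFun A b =
      (-1) ^ (i.val * j.val) * (Forms.ofFun A b * Forms.ofDiff A a) := by
  simpa [Forms.ofFun_apply, Forms.ofDiff_apply] using Forms.mk_rel (FormRel.diff_comm_fun i j a b ha hb)

lemma Forms.ofDiff_mul_ofDiff {i j : ZMod 2} {a b : A} (ha : a ∈ A.grading i)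
    (hb : b ∈ A.grading j) : Forms.ofDiff A a * Forms.ofDiff A b =
      (-1) ^ (1 + i.val * j.val) * (Forms.ofDiff A b * Forms.ofDiff A a) := by
  simpa [Forms.ofFun_apply, Forms.ofDiff_apply] using Forms.mk_rel (FormRel.diff_comm_diff i j a b ha hb)

lemma Forms.ofDiff_sq {a : A} (ha : a ∈ A.grading 0) :
    Forms.ofDiff A a * Forms.ofDiff A a = 0 := by
  simpa [Forms.ofFun_apply, Forms.ofDiff_apply] using Forms.mk_rel (FormRel.diff_sq a ha)

/-- The algebra homomorphism `ω ↦ !![(-1) ^ p * ω, d ω; 0, ω]` for `ω` of degree `p`. -/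
def Forms.dMatrix : A.Forms →ₐ[k] Matrix (Fin 2) (Fin 2) A.Forms :=
  Forms.lift (FreeAlgebra.lift k (Sum.elim
    (fun a => !![Forms.ofFun A a, Forms.ofDiff A a; 0, Forms.ofFun A a])
    (fun a => !![-Forms.ofDiff A a, 0; 0, Forms.ofDiff A a]))) (by
    have neg_pow_mul : ∀ (n : ℕ) (M : Matrix (Fin 2) (Fin 2) A.Forms) (i j : Fin 2),
        ((-1) ^ n * M) i j = (-1) ^ n * M i j := by
      intro n M i j
      rcases Nat.even_or_odd n with h | h <;> simp [h.neg_one_pow]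
    intro x y h
    induction h with
    | fun_add a b =>
      ext i j; fin_cases i <;> fin_cases j <;> simp
    | fun_mul a b =>
      ext i j; fin_cases i <;> fin_cases j <;> simp [Forms.ofDiff_mul, add_comm]
    | fun_const c =>
      ext i j
      fin_cases i <;> fin_cases j <;>
        simp [Forms.ofDiff_algebraMap, Matrix.algebraMap_matrix_apply]
    | diff_add a b =>
      ext i j; fin_cases i <;> fin_cases j <;> simp [add_comm]
    | diff_const c =>
      ext i j; fin_cases i <;> fin_cases j <;> simp [Forms.ofDiff_algebraMap]
    | diff_mul a b =>
      ext i j; fin_cases i <;> fin_cases j <;> simp [Forms.ofDiff_mul, add_comm]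
    | diff_comm_fun p q a b ha hb =>
      have h1 := Forms.ofDiff_mul_ofFun A ha hb
      have h2 := Forms.ofDiff_mul_ofDiff A ha hb
      rw [pow_add, pow_one, neg_one_mul, neg_mul] at h2
      ext i j
      simp only [map_mul, map_pow, map_neg, map_one, FreeAlgebra.lift_ι_apply, Sum.elim_inl,
        Sum.elim_inr, neg_pow_mul]
      fin_cases i <;> fin_cases j <;> simp [h1, h2]
    | diff_comm_diff p q a b ha hb =>
      have h2 := Forms.ofDiff_mul_ofDiff A ha hb
      ext i j
      simp only [map_mul, map_pow, map_neg, map_one, FreeAlgebra.lift_ι_apply, Sum.elim_inr, neg_pow_mul]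
      fin_cases i <;> fin_cases j <;> simp [h2]
    | diff_sq a ha =>
      ext i j; fin_cases i <;> fin_cases j <;> simp [Forms.ofDiff_sq A ha])

/-- The de Rham differential on the algebra of forms: the `k`-linear map with
`d (a) = d a`, `d (d a) = 0` and `d (ω η) = d ω η + (-1) ^ p ω d η` for `ω` of degree `p`. -/
def Forms.d : A.Forms →ₗ[k] A.Forms where
  toFun ω := Forms.dMatrix A ω 0 1
  map_add' ω η := by simp
  map_smul' c ω := by simp

lemma Forms.dMatrix_ofFun (a : A) : Forms.dMatrix A (Forms.ofFun A a) =
    !![Forms.ofFun A a, Forms.ofDiff A a; 0, Forms.ofFun A a] := by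
  simp [Forms.dMatrix, Forms.ofFun_apply]

lemma Forms.dMatrix_ofDiff (a : A) : Forms.dMatrix A (Forms.ofDiff A a) =
    !![-Forms.ofDiff A a, 0; 0, Forms.ofDiff A a] := by
  simp [Forms.dMatrix, Forms.ofDiff_apply]

lemma Forms.dMatrix_one_one (ω : A.Forms) : Forms.dMatrix A ω 1 1 = ω ∧
    Forms.dMatrix A ω 1 0 = 0 := by
  obtain ⟨x, rfl⟩ := Forms.mk_surjective A ω
  induction x using FreeAlgebra.induction with
  | grade0 c => rw [AlgHom.commutes, AlgHom.commutes]; simp [Matrix.algebraMap_matrix_apply]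
  | grade1 x =>
    rcases x with a | a
    · have h := Forms.dMatrix_ofFun A a
      rw [Forms.ofFun_apply] at h
      rw [h]; simp
    · have h := Forms.dMatrix_ofDiff A a
      rw [Forms.ofDiff_apply] at h
      rw [h]; simp
  | mul x y hx hy => simp [Matrix.mul_apply, hx.1, hx.2, hy.1, hy.2]
  | add x y hx hy => simp [hx.1, hx.2, hy.1, hy.2]

@[simp]
lemma Forms.d_ofFun (a : A) : Forms.d A (Forms.ofFun A a) = Forms.ofDiff A a := by
  simp [Forms.d, Forms.dMatrix_ofFun]

@[simp]
lemma Forms.d_ofDiff (a : A) : Forms.d A (Forms.ofDiff A a) = 0 := by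
  simp [Forms.d, Forms.dMatrix_ofDiff]

lemma Forms.d_ofFun_mul (a : A) (ω : A.Forms) : Forms.d A (Forms.ofFun A a * ω) =
    Forms.ofDiff A a * ω + Forms.ofFun A a * Forms.d A ω := by
  simp [Forms.d, Forms.dMatrix_ofFun, Matrix.mul_apply, (Forms.dMatrix_one_one A ω).1, add_comm]

lemma Forms.d_ofDiff_mul (a : A) (ω : A.Forms) : Forms.d A (Forms.ofDiff A a * ω) =
    -(Forms.ofDiff A a * Forms.d A ω) := by
  simp [Forms.d, Forms.dMatrix_ofDiff, Matrix.mul_apply]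

/-- The space `Ωᵖ_A` of `p`-forms, spanned by the forms `a₀ d a₁ ⋯ d aₚ`. -/
def formsDeg (p : ℕ) : Submodule k A.Forms :=
  LinearMap.range (Forms.ofFun A).toLinearMap * LinearMap.range (Forms.ofDiff A) ^ p

lemma Forms.d_eq_zero_of_mem {p : ℕ} {ω : A.Forms}
    (h : ω ∈ LinearMap.range (Forms.ofDiff A) ^ p) : Forms.d A ω = 0 := by
  induction p generalizing ω with
  | zero =>
    rw [pow_zero, Submodule.mem_one] at h
    obtain ⟨c, rfl⟩ := h
    rw [← AlgHom.commutes (Forms.ofFun A) c, Forms.d_ofFun, Forms.ofDiff_algebraMap]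
  | succ p ih =>
    rw [pow_succ'] at h
    induction h using Submodule.mul_induction_on' with
    | mem_mul_mem x hx y hy =>
      obtain ⟨a, rfl⟩ := hx
      rw [Forms.d_ofDiff_mul, ih hy, mul_zero, neg_zero]
    | add x _ y _ hx hy => rw [map_add, hx, hy, add_zero]

lemma Forms.d_mem {p : ℕ} {ω : A.Forms} (h : ω ∈ A.formsDeg p) :
    Forms.d A ω ∈ LinearMap.range (Forms.ofDiff A) ^ (p + 1) := by
  induction h using Submodule.mul_induction_on' with
  | mem_mul_mem x hx y hy =>
    obtain ⟨a, rfl⟩ := hx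
    rw [AlgHom.toLinearMap_apply, Forms.d_ofFun_mul, Forms.d_eq_zero_of_mem A hy, mul_zero,
      add_zero, pow_succ']
    exact Submodule.mul_mem_mul ⟨a, rfl⟩ hy
  | add x _ y _ hx hy => rw [map_add]; exact add_mem hx hy

lemma Forms.range_pow_le (p : ℕ) : LinearMap.range (Forms.ofDiff A) ^ p ≤ A.formsDeg p := by
  intro ω h
  rw [← one_mul ω]
  exact Submodule.mul_mem_mul ⟨1, (Forms.ofFun A).map_one⟩ h

/-- The de Rham differential from `p`-forms to `(p + 1)`-forms. -/
def dDeg (p : ℕ) : A.formsDeg p →ₗ[k] A.formsDeg (p + 1) :=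
  (Forms.d A).restrict fun _ h => Forms.range_pow_le A (p + 1) (Forms.d_mem A h)

end

/-- The map on forms induced by a morphism of superalgebras. -/
def Forms.map {A B : SuperAlg k} (f : A ⟶ B) : A.Forms →ₐ[k] B.Forms :=
  Forms.lift (FreeAlgebra.lift k (Sum.elim
    (fun a => Forms.ofFun B (f.toAlgHom a)) (fun a => Forms.ofDiff B (f.toAlgHom a)))) (by
    intro x y h
    induction h with
    | fun_add a b => simp
    | fun_mul a b => simp
    | fun_const c => simp
    | diff_add a b => simp
    | diff_const c => simp [Forms.ofDiff_algebraMap]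
    | diff_mul a b => simp [Forms.ofDiff_mul]
    | diff_comm_fun i j a b ha hb =>
      simpa using Forms.ofDiff_mul_ofFun B (f.map_mem i a ha) (f.map_mem j b hb)
    | diff_comm_diff i j a b ha hb =>
      simpa using Forms.ofDiff_mul_ofDiff B (f.map_mem i a ha) (f.map_mem j b hb)
    | diff_sq a ha => simpa using Forms.ofDiff_sq B (f.map_mem 0 a ha))

section

variable {A B C : SuperAlg k} (f : A ⟶ B) (g : B ⟶ C)

@[simp]
lemma Forms.map_ofFun (a : A) :
    Forms.map f (Forms.ofFun A a) = Forms.ofFun B (f.toAlgHom a) := by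
  simp [Forms.map, Forms.ofFun_apply A]

@[simp]
lemma Forms.map_ofDiff (a : A) :
    Forms.map f (Forms.ofDiff A a) = Forms.ofDiff B (f.toAlgHom a) := by
  simp [Forms.map, Forms.ofDiff_apply A]

lemma Forms.map_id (A : SuperAlg k) : Forms.map (𝟙 A) = AlgHom.id k A.Forms :=
  Forms.algHom_ext (fun a => Forms.map_ofFun (𝟙 A) a) (fun a => Forms.map_ofDiff (𝟙 A) a)

lemma Forms.map_comp : Forms.map (f ≫ g) = (Forms.map g).comp (Forms.map f) := by
  refine Forms.algHom_ext (fun a => ?_) (fun a => ?_)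
  · rw [← Forms.ofFun_apply]; simp
  · rw [← Forms.ofDiff_apply]; simp

lemma Forms.map_mem_pow {p : ℕ} {ω : A.Forms} (h : ω ∈ LinearMap.range (Forms.ofDiff A) ^ p) :
    Forms.map f ω ∈ LinearMap.range (Forms.ofDiff B) ^ p := by
  have h1 : (LinearMap.range (Forms.ofDiff A) ^ p).map (Forms.map f).toLinearMap ≤
      LinearMap.range (Forms.ofDiff B) ^ p := by
    rw [Submodule.map_pow]
    have h2 : (LinearMap.range (Forms.ofDiff A)).map (Forms.map f).toLinearMap ≤
        LinearMap.range (Forms.ofDiff B) := by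
      rintro _ ⟨_, ⟨a, rfl⟩, rfl⟩
      exact ⟨f.toAlgHom a, (Forms.map_ofDiff f a).symm⟩
    gcongr
  exact h1 ⟨ω, h, rfl⟩

lemma Forms.map_mem {p : ℕ} {ω : A.Forms} (h : ω ∈ A.formsDeg p) :
    Forms.map f ω ∈ B.formsDeg p := by
  induction h using Submodule.mul_induction_on' with
  | mem_mul_mem x hx y hy =>
    obtain ⟨a, rfl⟩ := hx
    rw [AlgHom.toLinearMap_apply, map_mul, Forms.map_ofFun]
    exact Submodule.mul_mem_mul ⟨_, rfl⟩ (Forms.map_mem_pow f hy)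
  | add x _ y _ hx hy => rw [map_add]; exact add_mem hx hy

lemma Forms.map_d {p : ℕ} {ω : A.Forms} (h : ω ∈ A.formsDeg p) :
    Forms.map f (Forms.d A ω) = Forms.d B (Forms.map f ω) := by
  induction h using Submodule.mul_induction_on' with
  | mem_mul_mem x hx y hy =>
    obtain ⟨a, rfl⟩ := hx
    rw [AlgHom.toLinearMap_apply, Forms.d_ofFun_mul, Forms.d_eq_zero_of_mem A hy, map_mul,
      Forms.map_ofFun, Forms.d_ofFun_mul, Forms.d_eq_zero_of_mem B (Forms.map_mem_pow f hy)]
    simp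
  | add x _ y _ hx hy => simp only [map_add, hx, hy]

/-- The map on `p`-forms induced by a morphism of superalgebras. -/
def mapDeg (p : ℕ) : A.formsDeg p →ₗ[k] B.formsDeg p :=
  (Forms.map f).toLinearMap.restrict fun _ h => Forms.map_mem f h

end

/-- The de Rham complex `Ω⁰ → Ω¹ → Ω² → ⋯` of a superalgebra over `k`. -/
def deRhamObj (A : SuperAlg k) : CochainComplex (ModuleCat.{u} k) ℕ :=
  CochainComplex.of (fun p => ModuleCat.of k (A.formsDeg p))
    (fun p => ModuleCat.ofHom (A.dDeg p)) (fun p => by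
      rw [← ModuleCat.ofHom_comp, ← ModuleCat.ofHom_zero]
      congr 1
      ext ω
      exact Forms.d_eq_zero_of_mem A (Forms.d_mem A ω.2))

lemma deRhamObj_d (A : SuperAlg k) (p : ℕ) :
    A.deRhamObj.d p (p + 1) = ModuleCat.ofHom (A.dDeg p) :=
  CochainComplex.of_d (fun p => ModuleCat.of k (A.formsDeg p))
    (fun p => ModuleCat.ofHom (A.dDeg p)) p

/-- The de Rham complex of superalgebras over `k`, as a functor. -/
def deRham (k : Type u) [Field k] : SuperAlg k ⥤ CochainComplex (ModuleCat.{u} k) ℕ where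
  obj A := A.deRhamObj
  map {A B} f := CochainComplex.ofHom (X := A.deRhamObj) (Y := B.deRhamObj)
    (fun p => ModuleCat.ofHom (mapDeg f p)) (fun p => by
      rw [deRhamObj_d, deRhamObj_d]
      refine (ModuleCat.ofHom_comp (mapDeg f p) (B.dDeg p)).symm.trans
        (Eq.trans (congrArg _ ?_) (ModuleCat.ofHom_comp (A.dDeg p) (mapDeg f (p + 1))))
      ext ω
      exact (Forms.map_d f ω.2).symm)
  map_id A := by
    refine HomologicalComplex.hom_ext _ _ fun p => ?_
    refine Eq.trans (congrArg ModuleCat.ofHom (?_ : mapDeg (𝟙 A) p = LinearMap.id)) rfl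
    ext ω
    exact DFunLike.congr_fun (Forms.map_id A) ω.1
  map_comp f g := by
    refine HomologicalComplex.hom_ext _ _ fun p => ?_
    refine Eq.trans (congrArg ModuleCat.ofHom
      (?_ : mapDeg (f ≫ g) p = (mapDeg g p).comp (mapDeg f p))) rfl
    ext ω
    exact DFunLike.congr_fun (Forms.map_comp f g) ω.1

end SuperAlg

/-! ### Sheaves of superalgebras and superschemes -/

/-- A sheaf of supercommutative `k`-algebras on a topological space. -/
structure SuperSheaf (k : Type u) [Field k] (X : TopCat.{u}) where
  presheaf : (Opens X)ᵒᵖ ⥤ SuperAlg k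
  isSheaf : Presheaf.IsSheaf (Opens.grothendieckTopology X) (presheaf ⋙ SuperAlg.toModule k)

namespace SuperSheaf

variable {k : Type u} [Field k] {X : TopCat.{u}} (O : SuperSheaf k X)

/-- Sections over an open subset. -/
abbrev sections (U : Opens X) : SuperAlg k := O.presheaf.obj (op U)

/-- Restriction of sections. -/
abbrev res {U V : Opens X} (h : V ≤ U) : O.sections U →ₐ[k] O.sections V :=
  (O.presheaf.map (homOfLE h).op).toAlgHom

/-- The quotient sheaf `O / N` of commutative rings, where `N` is the ideal generated by odd
functions: the sheafification of `U ↦ O(U) / (O(U)₋)`. -/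
def bosonRing : Sheaf (Opens.grothendieckTopology X) CommRingCat.{u} :=
  (presheafToSheaf (Opens.grothendieckTopology X) CommRingCat.{u}).obj
    (O.presheaf ⋙ SuperAlg.modOdd k)

/-- The sheafification map. -/
def toBosonSheaf : O.presheaf ⋙ SuperAlg.modOdd k ⟶ O.bosonRing.obj :=
  toSheafify (Opens.grothendieckTopology X) (O.presheaf ⋙ SuperAlg.modOdd k)

/-- The canonical map `O(U) → (O / N)(U)`. -/
def toBosonRing (U : (Opens X)ᵒᵖ) : O.presheaf.obj U →+* O.bosonRing.obj.obj U :=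
  (O.toBosonSheaf.app U).hom.comp (SuperAlg.toModOdd (O.presheaf.obj U))

lemma toBosonRing_eq_zero {U : (Opens X)ᵒᵖ} {a : O.presheaf.obj U}
    (ha : a ∈ (O.presheaf.obj U).grading 1) : O.toBosonRing U a = 0 :=
  (congrArg (O.toBosonSheaf.app U).hom (SuperAlg.toModOdd_eq_zero ha)).trans (map_zero _)

lemma toBosonRing_naturality {U V : (Opens X)ᵒᵖ} (i : U ⟶ V) (a : O.presheaf.obj U) :
    O.toBosonRing V ((O.presheaf.map i).toAlgHom a) =
      (O.bosonRing.obj.map i).hom (O.toBosonRing U a) :=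
  congrArg (fun g => g.hom (SuperAlg.toModOdd (O.presheaf.obj U) a)) (O.toBosonSheaf.naturality i)

instance (U : (Opens X)ᵒᵖ) : Algebra k (O.bosonRing.obj.obj U) :=
  ((O.toBosonRing U).comp (algebraMap k (O.presheaf.obj U))).toAlgebra

/-- The canonical map `O(U) → (O / N)(U)`, as a homomorphism of algebras. -/
def toBosonAlg (U : (Opens X)ᵒᵖ) : O.presheaf.obj U →ₐ[k] O.bosonRing.obj.obj U :=
  { O.toBosonRing U with commutes' := fun _ => rfl }

/-- Restriction of sections of `O / N`, as a homomorphism of algebras. -/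
def bosonRes {U V : (Opens X)ᵒᵖ} (i : U ⟶ V) :
    O.bosonRing.obj.obj U →ₐ[k] O.bosonRing.obj.obj V :=
  { (O.bosonRing.obj.map i).hom with
    commutes' := fun c => by
      refine (O.toBosonRing_naturality i (algebraMap k (O.presheaf.obj U) c)).symm.trans ?_
      exact congrArg _ (AlgHom.commutes _ c) }

/-- The bosonization: the quotient sheaf `O / N`, viewed as a sheaf of purely even
superalgebras on the same topological space. -/
def boson : SuperSheaf k X where
  presheaf :=
    { obj := fun U => SuperAlg.ofComm k (O.bosonRing.obj.obj U)
      map := fun i => SuperAlg.ofCommMap (O.bosonRes i)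
      map_id := fun U => by
        ext a
        exact congrArg (fun g => g.hom a) (O.bosonRing.obj.map_id U)
      map_comp := fun i j => by
        ext a
        exact congrArg (fun g => g.hom a) (O.bosonRing.obj.map_comp i j) }
  isSheaf := by
    rw [Presheaf.isSheaf_iff_isSheaf_forget _ _ (forget (ModuleCat.{u} k))]
    exact (Presheaf.isSheaf_iff_isSheaf_forget _ _ (forget CommRingCat.{u})).1 O.bosonRing.property

/-- The canonical surjection from `O` to its bosonization. -/
def toBoson : O.presheaf ⟶ O.boson.presheaf where
  app U := SuperAlg.homOfComm (O.toBosonAlg U) fun _ ha => O.toBosonRing_eq_zero ha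
  naturality U V i := by
    ext a
    exact O.toBosonRing_naturality i a

end SuperSheaf

/-- A superscheme over `k`: a topological space with a sheaf `O` of supercommutative `k`-algebras
whose even part is the structure sheaf of a scheme and whose odd part is a quasi-coherent
module over it. Quasi-coherence is expressed by the condition that, for
`U` affine and `f` an even function on `U`, the restriction from `U` to `D(f)` identifies the
odd functions on `D(f)` with the localization at `f` of the odd functions on `U`. -/
structure Superscheme (k : Type u) [Field k] where
  evenScheme : Scheme.{u}
  sheaf : SuperSheaf k evenScheme.carrier
  evenIso : sheaf.presheaf ⋙ SuperAlg.evenPart k ≅ evenScheme.presheaf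
  odd_surj : ∀ (U : evenScheme.Opens), IsAffineOpen U →
    ∀ (f : (sheaf.sections U).evenSubalgebra),
    ∀ s ∈ (sheaf.sections (evenScheme.basicOpen ((evenIso.hom.app (op U)).hom f))).grading 1,
    ∃ (n : ℕ), ∃ t ∈ (sheaf.sections U).grading 1,
      sheaf.res (evenScheme.basicOpen_le _) t = sheaf.res (evenScheme.basicOpen_le _) f ^ n * s
  odd_inj : ∀ (U : evenScheme.Opens), IsAffineOpen U →
    ∀ (f : (sheaf.sections U).evenSubalgebra), ∀ t ∈ (sheaf.sections U).grading 1,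
    sheaf.res (evenScheme.basicOpen_le ((evenIso.hom.app (op U)).hom f)) t = 0 →
    ∃ n : ℕ, (f : sheaf.sections U) ^ n * t = 0

/-- A superscheme over `k` is smooth if locally it is the spectrum of an exterior algebra
`⋀_B (Bⁿ)` with its `ℤ/2`-grading, where `B` is a smooth commutative `k`-algebra. -/
def Superscheme.IsSmooth {k : Type u} [Field k] (X : Superscheme k) : Prop :=
  ∀ x : X.evenScheme, ∃ U : X.evenScheme.Opens, x ∈ U ∧ IsAffineOpen U ∧
    ∃ (B : Type u) (_ : CommRing B) (_ : Algebra k B) (n : ℕ)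
      (e : X.sheaf.sections U ≃ₐ[k] ExteriorAlgebra B (Fin n → B)),
      Algebra.Smooth k B ∧
      ∀ (i : ZMod 2) (a : X.sheaf.sections U), a ∈ (X.sheaf.sections U).grading i ↔
        e a ∈ CliffordAlgebra.evenOdd (0 : QuadraticForm B (Fin n → B)) i

/-! ### Hypercohomology and de Rham cohomology -/

section

variable {T V : Type*} [Category* T] [Category* V] [Limits.HasZeroMorphisms V]

/-- A functor to complexes, viewed as a complex of functors. -/
def complexOfFunctor {ι : Type*} (c : ComplexShape ι) :
    (T ⥤ HomologicalComplex V c) ⥤ HomologicalComplex (T ⥤ V) c where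
  obj F :=
    { X := fun i => F ⋙ HomologicalComplex.eval V c i
      d := fun i j => Functor.whiskerLeft F (HomologicalComplex.dNatTrans V c i j)
      shape := fun i j h => by ext t; exact (F.obj t).shape i j h
      d_comp_d' := fun i j l _ _ => by ext t; exact (F.obj t).d_comp_d i j l }
  map φ :=
    { f := fun i => Functor.whiskerRight φ (HomologicalComplex.eval V c i)
      comm' := fun i j _ => by ext t; exact (φ.app t).comm i j }

end

variable (k : Type u) [Field k] (X : TopCat.{u})

/-- The abelian category of sheaves of `k`-vector spaces. -/
abbrev VectSheaf := Sheaf (Opens.grothendieckTopology X) (ModuleCat.{u} k)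

/-- The functor of global sections. -/
abbrev globalSections : VectSheaf k X ⥤ ModuleCat.{u} k :=
  (sheafSections (Opens.grothendieckTopology X) (ModuleCat.{u} k)).obj (op ⊤)

instance : (globalSections k X).Additive where

attribute [local instance] HasDerivedCategory.standard

/-- Hypercohomology `Hⁿ(X, K) = Hⁿ(RΓ(X, K))` of complexes `K⁰ → K¹ → ⋯` of sheaves of `k`-vector
spaces, as a functor to `k`-vector spaces. -/
def hypercohomology (n : ℤ) : CochainComplex (VectSheaf k X) ℕ ⥤ ModuleCat.{u} k :=
  (CochainComplex.plus (VectSheaf k X)).lift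
    (ComplexShape.embeddingUpNat.extendFunctor (VectSheaf k X)) (fun K => ⟨0, by
      refine CochainComplex.isStrictlyGE_iff _ _ |>.2 fun i hi => ?_
      exact K.isZero_extend_X _ _ fun j hj => by
        simp only [ComplexShape.embeddingUpNat_f] at hj
        lia⟩) ⋙
  HomotopyCategory.Plus.quotient _ ⋙ DerivedCategory.Plus.Qh ⋙
  (globalSections k X).rightDerivedFunctorPlus ⋙
  DerivedCategory.Plus.homologyFunctor _ n

variable {k X}

/-- The de Rham complex `Ω^•` of a sheaf of superalgebras: the complex of sheaves of `k`-vector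
spaces associated with `U ↦ Ω^•_{O(U)}`. It is functorial in the presheaf of superalgebras. -/
def deRhamSheaf : ((Opens X)ᵒᵖ ⥤ SuperAlg k) ⥤ CochainComplex (VectSheaf k X) ℕ :=
  (Functor.whiskeringRight _ _ _).obj (SuperAlg.deRham k) ⋙ complexOfFunctor _ ⋙
    (presheafToSheaf (Opens.grothendieckTopology X) (ModuleCat.{u} k)).mapHomologicalComplex _

namespace Superscheme

variable (X : Superscheme k)

/-- The de Rham complex of a superscheme over `k`. -/
abbrev deRham : CochainComplex (VectSheaf k X.evenScheme.carrier) ℕ :=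
  deRhamSheaf.obj X.sheaf.presheaf

/-- The de Rham complex of the bosonization. -/
abbrev bosonDeRham : CochainComplex (VectSheaf k X.evenScheme.carrier) ℕ :=
  deRhamSheaf.obj X.sheaf.boson.presheaf

/-- The restriction of forms `Ω^•_X → Ω^•_{X₀}`. -/
abbrev deRhamToBoson : X.deRham ⟶ X.bosonDeRham := deRhamSheaf.map X.sheaf.toBoson

/-- De Rham cohomology of a superscheme. -/
abbrev deRhamCohomology (n : ℤ) : ModuleCat.{u} k :=
  (hypercohomology k X.evenScheme.carrier n).obj X.deRham

/-- De Rham cohomology of the bosonization. -/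
abbrev bosonDeRhamCohomology (n : ℤ) : ModuleCat.{u} k :=
  (hypercohomology k X.evenScheme.carrier n).obj X.bosonDeRham

/-- The map `Hⁿ_dR(X) → Hⁿ_dR(X₀)` induced by the restriction of forms. -/
abbrev deRhamCohomologyToBoson (n : ℤ) : X.deRhamCohomology n ⟶ X.bosonDeRhamCohomology n :=
  (hypercohomology k X.evenScheme.carrier n).map X.deRhamToBoson

end Superscheme

end

/-!
# De Rham cohomology of a smooth superscheme and of its bosonization

Locally a smooth superscheme is given by an exterior algebra, so its functions arise from a
commutative algebra by adjoining finitely many odd variables. The heart of the matter is a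
Poincaré lemma for one odd variable `θ`. Forms on `A'[θ]` are uniquely sums of terms `α (dθ)ᵐ` and
`β θ (dθ)ᵐ` with `α` and `β` forms on `A'` (`SuperAlg.OddExtension.toModel_ofModel`,
`SuperAlg.OddExtension.ofModel_toModel`). Differentials of odd functions commute with each other, so
the powers of `dθ` do not vanish, and `d (θ (dθ)ᵐ) = (dθ)ᵐ⁺¹` holds without any numerical factor.
Hence replacing `(dθ)ᵐ⁺¹` by `θ (dθ)ᵐ` is, up to signs, a homotopy contracting the forms on `A'[θ]` to those on `A'`
(`SuperAlg.OddExtension.d_homotopy`), in every characteristic; this is a Koszul complex rather than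
an integration of power series. To establish uniqueness of coefficients, the algebra of forms
on `A'[θ]` is made to act on the space of all such expressions, by its universal property
(`SuperAlg.OddExtension.desc`). By induction on the number of odd variables, for an exterior
algebra every closed form which vanishes modulo odd functions is the differential of such
a form (`SuperAlg.isPoincare_exterior`).

The property used globally is `SuperAlg.IsPoincare`. The quasi-coherence of the odd functions
shows that the functions on a basic open subset `D(f)` of an affine chart form a localization of
those on the chart, hence again an exterior algebra; so the property holds on arbitrarily small
neighbourhoods of every point (`Superscheme.IsSmooth.exists_isPoincare`). The functions on the
bosonization are sections of the sheafification of `U ↦ O(U) / (O(U)₋)`. By comparing germs, a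
form vanishing on the bosonization vanishes locally modulo odd functions
(`SuperSheaf.exists_map_toQuot_eq_zero`), and every form on the bosonization lifts locally
(`SuperSheaf.exists_map_toBoson_eq`).

It follows that the restriction of forms to the bosonization is locally surjective and that closed
forms in its kernel are locally differentials of forms in the kernel. As sheafification is exact,
`Ω_X → Ω_{X₀}` is an epimorphism with acyclic kernel, hence a quasi-isomorphism, and
hypercohomology inverts quasi-isomorphisms.
-/

noncomputable section

namespace SuperAlg

variable {k : Type u} [Field k]

/-! ### Calculus of differential forms -/

section

variable (A : SuperAlg k)

variable {A} in
/-- Forms are generated from `1` by left multiplication by functions and by exact one-forms. -/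
lemma Forms.induction_left {P : A.Forms → Prop} (one : P 1)
    (add : ∀ x y, P x → P y → P (x + y)) (smul : ∀ (c : k) x, P x → P (c • x))
    (ofFun_mul : ∀ a x, P x → P (Forms.ofFun A a * x))
    (ofDiff_mul : ∀ a x, P x → P (Forms.ofDiff A a * x)) (ω : A.Forms) : P ω := by
  suffices h : ∀ (x : FreeAlgebra k (A ⊕ A)) (y : A.Forms), P y → P (Forms.mk A x * y) by
    obtain ⟨x, rfl⟩ := Forms.mk_surjective A ω
    simpa using h x 1 one
  intro x
  induction x using FreeAlgebra.induction with
  | grade0 c =>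
    intro y hy
    rw [AlgHom.commutes, ← Algebra.smul_def]
    exact smul c y hy
  | grade1 x =>
    intro y hy
    rcases x with a | a
    · exact ofFun_mul a y hy
    · exact ofDiff_mul a y hy
  | mul x z hx hz =>
    intro y hy
    rw [map_mul, mul_assoc]
    exact hx _ (hz _ hy)
  | add x z hx hz =>
    intro y hy
    rw [map_add, add_mul]
    exact add _ _ (hx _ hy) (hz _ hy)

variable {A} in
lemma Forms.hom_ext {R : Type*} [Ring R] [Algebra k R] {f g : A.Forms →ₐ[k] R}
    (hf : ∀ a, f (Forms.ofFun A a) = g (Forms.ofFun A a))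
    (hd : ∀ a, f (Forms.ofDiff A a) = g (Forms.ofDiff A a)) : f = g :=
  Forms.algHom_ext hf hd

/-- The universal property of the algebra of forms: a homomorphism out of it is a homomorphism
out of the algebra of functions together with a derivation satisfying the sign rules. -/
def Forms.desc {R : Type*} [Ring R] [Algebra k R] (f : A →ₐ[k] R) (g : A →ₗ[k] R)
    (g_one : g 1 = 0) (g_mul : ∀ a b, g (a * b) = g a * f b + f a * g b)
    (comm_fun : ∀ (i j : ZMod 2) (a b : A), a ∈ A.grading i → b ∈ A.grading j →
      g a * f b = (-1) ^ (i.val * j.val) * (f b * g a))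
    (comm_diff : ∀ (i j : ZMod 2) (a b : A), a ∈ A.grading i → b ∈ A.grading j →
      g a * g b = (-1) ^ (1 + i.val * j.val) * (g b * g a))
    (g_sq : ∀ a ∈ A.grading 0, g a * g a = 0) : A.Forms →ₐ[k] R :=
  Forms.lift (FreeAlgebra.lift k (Sum.elim f g)) (by
    intro x y h
    induction h with
    | fun_add a b => simp
    | fun_mul a b => simp
    | fun_const c => simp
    | diff_add a b => simp
    | diff_const c => simp [Algebra.algebraMap_eq_smul_one, g_one]
    | diff_mul a b => simp [g_mul]
    | diff_comm_fun i j a b ha hb => simpa using comm_fun i j a b ha hb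
    | diff_comm_diff i j a b ha hb => simpa using comm_diff i j a b ha hb
    | diff_sq a ha => simpa using g_sq a ha)

section

variable {A} {R : Type*} [Ring R] [Algebra k R] {f : A →ₐ[k] R} {g : A →ₗ[k] R}
  {g_one : g 1 = 0} {g_mul : ∀ a b, g (a * b) = g a * f b + f a * g b}
  {comm_fun : ∀ (i j : ZMod 2) (a b : A), a ∈ A.grading i → b ∈ A.grading j →
    g a * f b = (-1) ^ (i.val * j.val) * (f b * g a)}
  {comm_diff : ∀ (i j : ZMod 2) (a b : A), a ∈ A.grading i → b ∈ A.grading j →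
    g a * g b = (-1) ^ (1 + i.val * j.val) * (g b * g a)}
  {g_sq : ∀ a ∈ A.grading 0, g a * g a = 0}

@[simp]
lemma Forms.desc_ofFun (a : A) :
    Forms.desc A f g g_one g_mul comm_fun comm_diff g_sq (Forms.ofFun A a) = f a := by
  simp [Forms.desc, Forms.ofFun_apply]

@[simp]
lemma Forms.desc_ofDiff (a : A) :
    Forms.desc A f g g_one g_mul comm_fun comm_diff g_sq (Forms.ofDiff A a) = g a := by
  simp [Forms.desc, Forms.ofDiff_apply]

end

lemma Forms.ofDiff_one : Forms.ofDiff A 1 = 0 := by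
  simpa using Forms.ofDiff_algebraMap A 1

/-- The sign automorphism `ω ↦ (-1) ^ p ω` for `ω` of degree `p`. -/
def Forms.degSign : A.Forms →ₐ[k] A.Forms :=
  Forms.desc A (Forms.ofFun A) (-Forms.ofDiff A) (by simp [Forms.ofDiff_one])
    (fun a b => by simp [Forms.ofDiff_mul, add_comm])
    (fun i j a b ha hb => by simp [Forms.ofDiff_mul_ofFun A ha hb])
    (fun i j a b ha hb => by simp [Forms.ofDiff_mul_ofDiff A ha hb])
    (fun a ha => by simp [Forms.ofDiff_sq A ha])

@[simp]
lemma Forms.degSign_ofFun (a : A) : Forms.degSign A (Forms.ofFun A a) = Forms.ofFun A a := by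
  simp [Forms.degSign]

@[simp]
lemma Forms.degSign_ofDiff (a : A) :
    Forms.degSign A (Forms.ofDiff A a) = -Forms.ofDiff A a := by
  simp [Forms.degSign]

@[simp]
lemma Forms.degSign_degSign (ω : A.Forms) : Forms.degSign A (Forms.degSign A ω) = ω := by
  have h : (Forms.degSign A).comp (Forms.degSign A) = AlgHom.id k A.Forms :=
    Forms.hom_ext (by simp) (by simp)
  exact DFunLike.congr_fun h ω

@[simp]
lemma Forms.d_one : Forms.d A 1 = 0 := by
  rw [← map_one (Forms.ofFun A), Forms.d_ofFun, Forms.ofDiff_one]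

/-- The graded Leibniz rule. -/
lemma Forms.d_mul (x y : A.Forms) :
    Forms.d A (x * y) = Forms.d A x * y + Forms.degSign A x * Forms.d A y := by
  induction x using Forms.induction_left with
  | one => simp
  | add x z hx hz => simp only [add_mul, map_add, hx, hz]; abel
  | smul c x hx => simp only [smul_mul_assoc, map_smul, hx, smul_add]
  | ofFun_mul a x hx =>
    simp only [mul_assoc, Forms.d_ofFun_mul, hx, map_mul, Forms.degSign_ofFun, mul_add, add_mul]
    abel
  | ofDiff_mul a x hx =>
    simp only [mul_assoc, Forms.d_ofDiff_mul, hx, map_mul, Forms.degSign_ofDiff, mul_add, neg_mul]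
    abel

lemma Forms.d_degSign (ω : A.Forms) :
    Forms.d A (Forms.degSign A ω) = -Forms.degSign A (Forms.d A ω) := by
  induction ω using Forms.induction_left with
  | one => simp
  | add x z hx hz => simp only [map_add, hx, hz]; abel
  | smul c x hx => simp only [map_smul, hx, smul_neg]
  | ofFun_mul a x hx =>
    simp only [map_mul, map_add, Forms.degSign_ofFun, Forms.degSign_ofDiff, Forms.d_ofFun_mul, hx]
    simp only [mul_neg, neg_mul]
    abel
  | ofDiff_mul a x hx =>
    simp only [map_mul, map_neg, Forms.degSign_ofDiff, Forms.d_ofDiff_mul, hx, neg_mul]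
    simp only [mul_neg, neg_neg]

variable {A} in
lemma Forms.map_d_apply {B : SuperAlg k} (f : A ⟶ B) (ω : A.Forms) :
    Forms.map f (Forms.d A ω) = Forms.d B (Forms.map f ω) := by
  induction ω using Forms.induction_left with
  | one => simp
  | add x z hx hz => simp only [map_add, hx, hz]
  | smul c x hx => simp only [map_smul, hx]
  | ofFun_mul a x hx => simp [Forms.d_ofFun_mul, hx]
  | ofDiff_mul a x hx => simp [Forms.d_ofDiff_mul, hx]

variable {A} in
lemma Forms.map_degSign {B : SuperAlg k} (f : A ⟶ B) (ω : A.Forms) :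
    Forms.map f (Forms.degSign A ω) = Forms.degSign B (Forms.map f ω) := by
  have h : (Forms.map f).comp (Forms.degSign A) = (Forms.degSign B).comp (Forms.map f) :=
    Forms.hom_ext (by simp) (by simp)
  exact DFunLike.congr_fun h ω

variable {A} in
lemma Forms.map_map {B C : SuperAlg k} (f : A ⟶ B) (g : B ⟶ C) (ω : A.Forms) :
    Forms.map g (Forms.map f ω) = Forms.map (f ≫ g) ω := by
  rw [Forms.map_comp]; rfl

/-- The homomorphism `ω ↦ ω tᵖ` for `ω` of degree `p`, which separates forms by degree. -/
def Forms.weight : A.Forms →ₐ[k] Polynomial A.Forms :=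
  Forms.desc A ((Polynomial.CAlgHom (R := k)).comp (Forms.ofFun A))
    (((Polynomial.monomial 1).restrictScalars k).comp (Forms.ofDiff A))
    (by simp [Forms.ofDiff_one])
    (fun a b => by
      simp [Forms.ofDiff_mul, Polynomial.CAlgHom, Polynomial.C_mul_monomial,
        Polynomial.monomial_mul_C])
    (fun i j a b ha hb => by
      have h := Forms.ofDiff_mul_ofFun A ha hb
      rcases Nat.even_or_odd (i.val * j.val) with hs | hs <;>
        simp_all [hs.neg_one_pow, Polynomial.CAlgHom, Polynomial.C_mul_monomial,
          Polynomial.monomial_mul_C])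
    (fun i j a b ha hb => by
      have h := Forms.ofDiff_mul_ofDiff A ha hb
      rcases Nat.even_or_odd (1 + i.val * j.val) with hs | hs <;>
        simp_all [hs.neg_one_pow, Polynomial.monomial_mul_monomial])
    (fun a ha => by simp [Polynomial.monomial_mul_monomial, Forms.ofDiff_sq A ha])

@[simp]
lemma Forms.weight_ofFun (a : A) :
    Forms.weight A (Forms.ofFun A a) = Polynomial.C (Forms.ofFun A a) := by
  simp [Forms.weight, Polynomial.CAlgHom]

@[simp]
lemma Forms.weight_ofDiff (a : A) :
    Forms.weight A (Forms.ofDiff A a) = Polynomial.monomial 1 (Forms.ofDiff A a) := by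
  simp [Forms.weight]

/-- The component of degree `p` of a form. -/
def Forms.degProj (p : ℕ) : A.Forms →ₗ[k] A.Forms :=
  ((Polynomial.lcoeff A.Forms p).restrictScalars k).comp (Forms.weight A).toLinearMap

lemma Forms.degProj_apply (p : ℕ) (ω : A.Forms) :
    Forms.degProj A p ω = (Forms.weight A ω).coeff p := rfl

@[simp]
lemma Forms.degProj_ofFun_mul (p : ℕ) (a : A) (ω : A.Forms) :
    Forms.degProj A p (Forms.ofFun A a * ω) = Forms.ofFun A a * Forms.degProj A p ω := by
  simp [Forms.degProj_apply]

@[simp]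
lemma Forms.degProj_zero_ofDiff_mul (a : A) (ω : A.Forms) :
    Forms.degProj A 0 (Forms.ofDiff A a * ω) = 0 := by
  simp [Forms.degProj_apply, ← Polynomial.C_mul_X_eq_monomial, Polynomial.mul_coeff_zero]

@[simp]
lemma Forms.degProj_succ_ofDiff_mul (p : ℕ) (a : A) (ω : A.Forms) :
    Forms.degProj A (p + 1) (Forms.ofDiff A a * ω) =
      Forms.ofDiff A a * Forms.degProj A p ω := by
  simp [Forms.degProj_apply, ← Polynomial.C_mul_X_eq_monomial, mul_assoc,
    Polynomial.coeff_X_mul]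

variable {A} in
lemma Forms.ofFun_mul_mem {p : ℕ} (a : A) {ω : A.Forms} (h : ω ∈ A.formsDeg p) :
    Forms.ofFun A a * ω ∈ A.formsDeg p := by
  induction h using Submodule.mul_induction_on' with
  | mem_mul_mem x hx y hy =>
    obtain ⟨b, rfl⟩ := hx
    rw [← mul_assoc]
    exact Submodule.mul_mem_mul ⟨a * b, by simp⟩ hy
  | add x _ y _ hx hy => rw [mul_add]; exact add_mem hx hy

variable {A} in
lemma Forms.ofDiff_mul_mem {p : ℕ} (a : A) {ω : A.Forms} (h : ω ∈ A.formsDeg p) :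
    Forms.ofDiff A a * ω ∈ A.formsDeg (p + 1) := by
  induction h using Submodule.mul_induction_on' with
  | mem_mul_mem x hx y hy =>
    obtain ⟨b, rfl⟩ := hx
    -- the Leibniz rule moves the function `b` to the left of `d a`
    have h1 : Forms.ofDiff A a * ((Forms.ofFun A).toLinearMap b * y) =
        Forms.ofDiff A (a * b) * y - Forms.ofFun A a * (Forms.ofDiff A b * y) := by
      simp [Forms.ofDiff_mul, add_mul, mul_assoc]
    have h2 (c : A) : Forms.ofDiff A c * y ∈ A.formsDeg (p + 1) := by
      refine Forms.range_pow_le A _ ?_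
      rw [pow_succ']
      exact Submodule.mul_mem_mul ⟨c, rfl⟩ hy
    rw [h1]
    exact sub_mem (h2 _) (Forms.ofFun_mul_mem a (h2 b))
  | add x _ y _ hx hy => rw [mul_add]; exact add_mem hx hy

@[simp]
lemma Forms.degProj_zero_one : Forms.degProj A 0 1 = 1 := by simp [Forms.degProj_apply]

@[simp]
lemma Forms.degProj_succ_one (p : ℕ) : Forms.degProj A (p + 1) 1 = 0 := by
  simp [Forms.degProj_apply, Polynomial.coeff_one]

lemma Forms.degProj_mem (p : ℕ) (ω : A.Forms) : Forms.degProj A p ω ∈ A.formsDeg p := by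
  induction ω using Forms.induction_left generalizing p with
  | one =>
    cases p with
    | zero =>
      rw [Forms.degProj_zero_one]
      exact Forms.range_pow_le A 0 (Submodule.one_le.1 (by rw [pow_zero]))
    | succ p => simp
  | add x z hx hz => rw [map_add]; exact add_mem (hx p) (hz p)
  | smul c x hx => rw [map_smul]; exact Submodule.smul_mem _ c (hx p)
  | ofFun_mul a x hx => rw [Forms.degProj_ofFun_mul]; exact Forms.ofFun_mul_mem a (hx p)
  | ofDiff_mul a x hx =>
    cases p with
    | zero => simp
    | succ p => rw [Forms.degProj_succ_ofDiff_mul]; exact Forms.ofDiff_mul_mem a (hx p)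

variable {A} in
lemma Forms.degProj_of_mem {p : ℕ} {ω : A.Forms} (h : ω ∈ A.formsDeg p) :
    Forms.degProj A p ω = ω := by
  have h1 (q : ℕ) (y : A.Forms) (hy : y ∈ LinearMap.range (Forms.ofDiff A) ^ q) :
      Forms.degProj A q y = y := by
    induction q generalizing y with
    | zero =>
      rw [pow_zero, Submodule.mem_one] at hy
      obtain ⟨c, rfl⟩ := hy
      rw [Algebra.algebraMap_eq_smul_one, map_smul, Forms.degProj_zero_one]
    | succ q ih =>
      rw [pow_succ'] at hy
      induction hy using Submodule.mul_induction_on' with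
      | mem_mul_mem x hx y hy =>
        obtain ⟨a, rfl⟩ := hx
        rw [Forms.degProj_succ_ofDiff_mul, ih y hy]
      | add x _ y _ hx hy => rw [map_add, hx, hy]
  induction h using Submodule.mul_induction_on' with
  | mem_mul_mem x hx y hy =>
    obtain ⟨a, rfl⟩ := hx
    rw [AlgHom.toLinearMap_apply, Forms.degProj_ofFun_mul, h1 p y hy]
  | add x _ y _ hx hy => rw [map_add, hx, hy]

@[simp]
lemma Forms.degProj_zero_d (ω : A.Forms) : Forms.degProj A 0 (Forms.d A ω) = 0 := by
  induction ω using Forms.induction_left with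
  | one => simp
  | add x z hx hz => simp only [map_add, hx, hz, add_zero]
  | smul c x hx => simp only [map_smul, hx, smul_zero]
  | ofFun_mul a x hx => simp [Forms.d_ofFun_mul, hx]
  | ofDiff_mul a x hx => simp [Forms.d_ofDiff_mul]

@[simp]
lemma Forms.degProj_succ_d (p : ℕ) (ω : A.Forms) :
    Forms.degProj A (p + 1) (Forms.d A ω) = Forms.d A (Forms.degProj A p ω) := by
  induction ω using Forms.induction_left generalizing p with
  | one => cases p <;> simp
  | add x z hx hz => simp only [map_add, hx, hz]
  | smul c x hx => simp only [map_smul, hx]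
  | ofFun_mul a x hx => simp [Forms.d_ofFun_mul, hx]
  | ofDiff_mul a x hx => cases p <;> simp [Forms.d_ofDiff_mul, hx]

variable {A} in
lemma Forms.map_degProj {B : SuperAlg k} (f : A ⟶ B) (p : ℕ) (ω : A.Forms) :
    Forms.map f (Forms.degProj A p ω) = Forms.degProj B p (Forms.map f ω) := by
  induction ω using Forms.induction_left generalizing p with
  | one => cases p <;> simp
  | add x z hx hz => simp only [map_add, hx, hz]
  | smul c x hx => simp only [map_smul, hx]
  | ofFun_mul a x hx => simp [hx]
  | ofDiff_mul a x hx => cases p <;> simp [hx]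

end

/-! ### The parity automorphism -/

section

variable (A : SuperAlg k)

lemma eq_zero_of_mem_of_mem_add_one {i : ZMod 2} {a : A} (h : a ∈ A.grading i)
    (h' : a ∈ A.grading (i + 1)) : a = 0 := by
  have hi : i ≠ i + 1 := by clear h h'; revert i; decide
  rw [← DirectSum.decompose_of_mem_same A.grading h, DirectSum.decompose_of_mem_ne _ h' hi.symm]

lemma exists_add_of (i : ZMod 2) (a : A) :
    ∃ x ∈ A.grading i, ∃ y ∈ A.grading (i + 1), a = x + y := by
  obtain ⟨x, hx, y, hy, h⟩ := A.exists_add a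
  obtain rfl | rfl : i = 0 ∨ i = 1 := by revert i; decide
  · exact ⟨x, hx, y, hy, h⟩
  · exact ⟨y, hy, x, hx, by rw [h, add_comm]⟩

/-- The linear map `a ↦ (-1) ^ i a` for `a` of parity `i`. -/
def parityLin : A →ₗ[k] A :=
  GradedAlgebra.proj A.grading 0 - GradedAlgebra.proj A.grading 1

variable {A} in
lemma parityLin_of_mem {i : ZMod 2} {a : A} (h : a ∈ A.grading i) :
    A.parityLin a = (-1) ^ i.val * a := by
  obtain rfl | rfl : i = 0 ∨ i = 1 := by clear h; revert i; decide
  · simp [parityLin, GradedAlgebra.proj_apply, DirectSum.decompose_of_mem_same _ h,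
      DirectSum.decompose_of_mem_ne _ h (show (0 : ZMod 2) ≠ 1 by decide)]
  · simp [parityLin, GradedAlgebra.proj_apply, DirectSum.decompose_of_mem_same _ h,
      DirectSum.decompose_of_mem_ne _ h (show (1 : ZMod 2) ≠ 0 by decide), ZMod.val_one]

/-- The parity automorphism `a ↦ (-1) ^ i a` for `a` of parity `i`. -/
def parity : A ⟶ A where
  toAlgHom := AlgHom.ofLinearMap A.parityLin
    (by simpa using parityLin_of_mem (SetLike.one_mem_graded A.grading))
    (by
      intro a b
      obtain ⟨a₀, ha₀, a₁, ha₁, rfl⟩ := A.exists_add a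
      obtain ⟨b₀, hb₀, b₁, hb₁, rfl⟩ := A.exists_add b
      have h00 := SetLike.mul_mem_graded ha₀ hb₀
      have h01 := SetLike.mul_mem_graded ha₀ hb₁
      have h10 := SetLike.mul_mem_graded ha₁ hb₀
      have h11 := SetLike.mul_mem_graded ha₁ hb₁
      have h2 : ((1 + 1 : ZMod 2)).val = 0 := by decide
      simp only [mul_add, add_mul, map_add, parityLin_of_mem ha₀, parityLin_of_mem hb₀,
        parityLin_of_mem ha₁, parityLin_of_mem hb₁, parityLin_of_mem h00, parityLin_of_mem h01,
        parityLin_of_mem h10, parityLin_of_mem h11, h2]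
      simp [ZMod.val_one])
  map_mem i a ha := by
    change A.parityLin a ∈ _
    rw [parityLin_of_mem ha]
    rcases Nat.even_or_odd i.val with h | h <;> simp [h.neg_one_pow, ha]

variable {A} in
lemma parity_of_mem {i : ZMod 2} {a : A} (h : a ∈ A.grading i) :
    A.parity.toAlgHom a = (-1) ^ i.val * a := parityLin_of_mem h

end

end SuperAlg

end

noncomputable section

/-! ### Sign rules -/

/-- Commutation up to the sign `(-1) ^ s`. -/
def SignComm {R : Type*} [Ring R] (s : ZMod 2) (x y : R) : Prop :=
  x * y = (-1) ^ s.val * (y * x)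

namespace SignComm

variable {R : Type*} [Ring R] {s t : ZMod 2} {x y z : R}

lemma zero_iff : SignComm 0 x y ↔ x * y = y * x := by simp [SignComm]

lemma one_iff : SignComm 1 x y ↔ x * y = -(y * x) := by simp [SignComm, ZMod.val_one]

lemma symm (h : SignComm s x y) : SignComm s y x := by
  rcases Nat.even_or_odd s.val with hs | hs <;> simp_all [SignComm, hs.neg_one_pow]

lemma mul_left (h : SignComm s x z) (h' : SignComm t y z) : SignComm (s + t) (x * y) z := by
  have hs : s = 0 ∨ s = 1 := by clear h; revert s; decide
  have ht : t = 0 ∨ t = 1 := by clear h'; revert t; decide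
  have h2 : (1 + 1 : ZMod 2) = 0 := by decide
  rcases hs with rfl | rfl <;> rcases ht with rfl | rfl <;>
    simp only [add_zero, zero_add, h2, zero_iff, one_iff] at h h' ⊢
  all_goals
    rw [mul_assoc, h']
    simp only [← mul_assoc, mul_neg, neg_mul, h, neg_neg]

lemma mul_right (h : SignComm s x y) (h' : SignComm t x z) : SignComm (s + t) x (y * z) :=
  (h.symm.mul_left h'.symm).symm

lemma add_left (h : SignComm s x z) (h' : SignComm s y z) : SignComm s (x + y) z := by
  unfold SignComm at *
  rw [add_mul, h, h', mul_add, mul_add]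

lemma add_right (h : SignComm s x y) (h' : SignComm s x z) : SignComm s x (y + z) :=
  (h.symm.add_left h'.symm).symm

lemma of_eq (h : SignComm s x y) (hst : s = t) : SignComm t x y := hst ▸ h

lemma map {S F : Type*} [Ring S] [FunLike F R S] [RingHomClass F R S] (f : F)
    (h : SignComm s x y) : SignComm s (f x) (f y) := by
  simpa [SignComm] using congrArg f h

lemma mul_self_eq_zero_left (h : SignComm s x y) (hx : x * x = 0) : (x * y) * (x * y) = 0 := by
  have : (x * y) * (x * y) = x * (y * x) * y := by simp only [mul_assoc]
  rw [this, h.symm]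
  rcases Nat.even_or_odd s.val with hs | hs <;> simp [hs.neg_one_pow, ← mul_assoc, hx]

lemma mul_self_eq_zero_right (h : SignComm s x y) (hy : y * y = 0) : (x * y) * (x * y) = 0 := by
  have : (x * y) * (x * y) = x * (y * x) * y := by simp only [mul_assoc]
  rw [this, h.symm]
  rcases Nat.even_or_odd s.val with hs | hs <;> simp [hs.neg_one_pow, mul_assoc, hy]

end SignComm

namespace SuperAlg

variable {k : Type u} [Field k]

lemma zmod_two_eq {i : ZMod 2} : i = 0 ∨ i = 1 := by revert i; decide

lemma neg_one_pow_val_mul {R : Type*} [Ring R] (i j : ZMod 2) :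
    (-1 : R) ^ (i.val * j.val) = (-1) ^ (i * j).val := by
  rcases zmod_two_eq (i := i) with rfl | rfl <;> rcases zmod_two_eq (i := j) with rfl | rfl <;>
    simp [ZMod.val_one]

lemma neg_one_pow_one_add_val_mul {R : Type*} [Ring R] (i j : ZMod 2) :
    (-1 : R) ^ (1 + i.val * j.val) = (-1) ^ (1 + i * j).val := by
  have h2 : (1 + 1 : ZMod 2) = 0 := by decide
  rcases zmod_two_eq (i := i) with rfl | rfl <;> rcases zmod_two_eq (i := j) with rfl | rfl <;>
    simp [ZMod.val_one, h2]

section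

variable {A : SuperAlg k} {i j : ZMod 2} {a b : A}

lemma signComm (ha : a ∈ A.grading i) (hb : b ∈ A.grading j) : SignComm (i * j) a b := by
  rcases zmod_two_eq (i := i) with rfl | rfl
  · simpa [SignComm] using A.even_comm a ha b
  · rcases zmod_two_eq (i := j) with rfl | rfl
    · simpa [SignComm] using (A.even_comm b hb a).symm
    · simpa [SignComm, ZMod.val_one] using A.odd_anticomm a ha b hb

lemma Forms.signComm_fun_fun (ha : a ∈ A.grading i) (hb : b ∈ A.grading j) :
    SignComm (i * j) (Forms.ofFun A a) (Forms.ofFun A b) :=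
  (signComm ha hb).map (Forms.ofFun A)

lemma Forms.signComm_diff_fun (ha : a ∈ A.grading i) (hb : b ∈ A.grading j) :
    SignComm (i * j) (Forms.ofDiff A a) (Forms.ofFun A b) := by
  rw [SignComm, ← neg_one_pow_val_mul]
  exact Forms.ofDiff_mul_ofFun A ha hb

lemma Forms.signComm_diff_diff (ha : a ∈ A.grading i) (hb : b ∈ A.grading j) :
    SignComm (1 + i * j) (Forms.ofDiff A a) (Forms.ofDiff A b) := by
  rw [SignComm, ← neg_one_pow_one_add_val_mul]
  exact Forms.ofDiff_mul_ofDiff A ha hb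

end

lemma Forms.parity_ofFun {A : SuperAlg k} {i : ZMod 2} {a : A} (ha : a ∈ A.grading i) :
    Forms.map A.parity (Forms.ofFun A a) = (-1) ^ i.val * Forms.ofFun A a := by
  simp [parity_of_mem ha]

lemma Forms.parity_ofDiff {A : SuperAlg k} {i : ZMod 2} {a : A} (ha : a ∈ A.grading i) :
    Forms.map A.parity (Forms.ofDiff A a) = (-1) ^ i.val * Forms.ofDiff A a := by
  rw [Forms.map_ofDiff, parity_of_mem ha]
  rcases Nat.even_or_odd i.val with hs | hs <;> simp [hs.neg_one_pow]

@[simp]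
lemma parity_parity {A : SuperAlg k} (a : A) :
    A.parity.toAlgHom (A.parity.toAlgHom a) = a := by
  obtain ⟨x, hx, y, hy, rfl⟩ := A.exists_add a
  simp [parity_of_mem hx, parity_of_mem hy, ZMod.val_one]

@[simp]
lemma Forms.parity_parity {A : SuperAlg k} (ω : A.Forms) :
    Forms.map A.parity (Forms.map A.parity ω) = ω := by
  have h : (Forms.map A.parity).comp (Forms.map A.parity) = AlgHom.id k A.Forms :=
    Forms.hom_ext (by simp) (by simp)
  exact DFunLike.congr_fun h ω

/-! ### Adjoining one odd variable -/

/-- A presentation of `A` as `A'[θ] = A' ⊕ A' θ` with `θ` a free odd variable: `proj` and `coeff`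
are the two coefficients. -/
structure OddExtension (A' A : SuperAlg k) where
  incl : A' ⟶ A
  proj : A ⟶ A'
  coeff : A →ₗ[k] A'
  θ : A
  θ_mem : θ ∈ A.grading 1
  proj_incl : ∀ a, proj.toAlgHom (incl.toAlgHom a) = a
  proj_θ : proj.toAlgHom θ = 0
  coeff_incl : ∀ a, coeff (incl.toAlgHom a) = 0
  coeff_incl_mul : ∀ a, coeff (incl.toAlgHom a * θ) = a
  eq_add : ∀ a, a = incl.toAlgHom (proj.toAlgHom a) + incl.toAlgHom (coeff a) * θ

namespace OddExtension

variable {A' A : SuperAlg k} (E : OddExtension A' A)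

lemma coeff_mem {i : ZMod 2} {a : A} (ha : a ∈ A.grading i) :
    E.coeff a ∈ A'.grading (i + 1) := by
  have h2 : i + 1 + 1 = i := by clear ha; revert i; decide
  obtain ⟨x, hx, y, hy, h⟩ := A'.exists_add_of (i + 1) (E.coeff a)
  rw [h2] at hy
  have hx' := SetLike.mul_mem_graded (E.incl.map_mem _ x hx) E.θ_mem
  rw [h2] at hx'
  have hy' := SetLike.mul_mem_graded (E.incl.map_mem _ y hy) E.θ_mem
  have h0 : E.incl.toAlgHom y * E.θ = 0 := by
    refine A.eq_zero_of_mem_of_mem_add_one (i := i) ?_ hy'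
    have h1 : E.incl.toAlgHom y * E.θ = a - E.incl.toAlgHom (E.proj.toAlgHom a) -
        E.incl.toAlgHom x * E.θ := by
      conv_rhs => rw [E.eq_add a, h]
      simp only [E.proj_incl, map_add, map_mul, E.proj_θ, add_mul]
      simp
    rw [h1]
    exact sub_mem (sub_mem ha (E.incl.map_mem _ _ (E.proj.map_mem _ _ ha))) hx'
  have hy0 : y = 0 := by rw [← E.coeff_incl_mul y, h0, map_zero]
  rw [h, hy0, add_zero]
  exact hx

lemma θ_mul (a : A') :
    E.θ * E.incl.toAlgHom a = E.incl.toAlgHom (A'.parity.toAlgHom a) * E.θ := by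
  obtain ⟨x, hx, y, hy, rfl⟩ := A'.exists_add a
  have h0 := A.even_comm _ (E.incl.map_mem _ x hx) E.θ
  have h1 := A.odd_anticomm _ E.θ_mem _ (E.incl.map_mem _ y hy)
  simp [mul_add, add_mul, parity_of_mem hx, parity_of_mem hy, ZMod.val_one, h0, h1]

lemma θ_sq : E.θ * E.θ = 0 := A.odd_sq _ E.θ_mem

lemma coeff_mul (a b : A) : E.coeff (a * b) = E.proj.toAlgHom a * E.coeff b +
    E.coeff a * A'.parity.toAlgHom (E.proj.toAlgHom b) := by
  have h : a * b = E.incl.toAlgHom (E.proj.toAlgHom a * E.proj.toAlgHom b) +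
      E.incl.toAlgHom (E.proj.toAlgHom a * E.coeff b +
        E.coeff a * A'.parity.toAlgHom (E.proj.toAlgHom b)) * E.θ := by
    conv_lhs => rw [E.eq_add a, E.eq_add b]
    have h1 : ∀ x y : A', E.incl.toAlgHom x * E.θ * E.incl.toAlgHom y =
        E.incl.toAlgHom x * E.incl.toAlgHom (A'.parity.toAlgHom y) * E.θ := fun x y => by
      rw [mul_assoc, θ_mul, mul_assoc]
    have h2 : ∀ x y : A', E.incl.toAlgHom x * E.θ * (E.incl.toAlgHom y * E.θ) = 0 :=
        fun x y => by rw [← mul_assoc, h1, mul_assoc, E.θ_sq, mul_zero]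
    simp only [add_mul, mul_add, h1, h2, map_add, map_mul, add_zero, mul_assoc]
    abel
  conv_lhs => rw [h]
  rw [map_add, E.coeff_incl, E.coeff_incl_mul, zero_add]

end OddExtension

/-- Elements `Θ` and `H` of an algebra which multiply with the image of the forms on `A'` like an
odd variable and its differential. -/
structure IsOddPair {A' : SuperAlg k} {R : Type*} [Ring R] [Algebra k R] (l : A'.Forms →ₐ[k] R)
    (Θ H : R) : Prop where
  Θ_mul : ∀ ω, Θ * l ω = l (Forms.map A'.parity ω) * Θ
  H_mul : ∀ ω, H * l ω = l (Forms.map A'.parity (Forms.degSign A' ω)) * H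
  Θ_sq : Θ * Θ = 0
  H_mul_Θ : H * Θ = -(Θ * H)

namespace OddExtension

section

variable {A' A : SuperAlg k} (E : OddExtension A' A) {R : Type*} [Ring R] [Algebra k R]
  (l : A'.Forms →ₐ[k] R) (Θ H : R)

/-- The value on the functions `a + b θ` of the extension of `l` sending `θ` to `Θ`. -/
def descFun : A →ₗ[k] R :=
  (l.comp ((Forms.ofFun A').comp E.proj.toAlgHom)).toLinearMap +
    (LinearMap.mulRight k Θ) ∘ₗ (l.comp (Forms.ofFun A')).toLinearMap ∘ₗ E.coeff

/-- The value on the differentials of `a + b θ` of the extension of `l` sending `θ` to `Θ` and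
`d θ` to `H`. -/
def descDiff : A →ₗ[k] R :=
  l.toLinearMap ∘ₗ Forms.ofDiff A' ∘ₗ E.proj.toAlgHom.toLinearMap +
    (LinearMap.mulRight k Θ) ∘ₗ l.toLinearMap ∘ₗ Forms.ofDiff A' ∘ₗ E.coeff +
    (LinearMap.mulRight k H) ∘ₗ (l.comp (Forms.ofFun A')).toLinearMap ∘ₗ E.coeff

lemma descFun_apply (a : A) : E.descFun l Θ a = l (Forms.ofFun A' (E.proj.toAlgHom a)) +
    l (Forms.ofFun A' (E.coeff a)) * Θ := rfl

lemma descDiff_apply (a : A) : E.descDiff l Θ H a = l (Forms.ofDiff A' (E.proj.toAlgHom a)) +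
    l (Forms.ofDiff A' (E.coeff a)) * Θ + l (Forms.ofFun A' (E.coeff a)) * H := rfl

variable {l Θ H}

lemma descFun_one : E.descFun l Θ 1 = 1 := by
  have h : E.coeff 1 = 0 := by rw [← map_one E.incl.toAlgHom, E.coeff_incl]
  simp [descFun_apply, h]

lemma descDiff_one : E.descDiff l Θ H 1 = 0 := by
  have h : E.coeff 1 = 0 := by rw [← map_one E.incl.toAlgHom, E.coeff_incl]
  simp [descDiff_apply, h, Forms.ofDiff_one]

lemma descFun_mul (h : IsOddPair l Θ H) (a b : A) :
    E.descFun l Θ (a * b) = E.descFun l Θ a * E.descFun l Θ b := by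
  have h1 (x y : R) (ω : A'.Forms) : x * Θ * (l ω * y) =
      x * (l (Forms.map A'.parity ω) * (Θ * y)) := by
    rw [mul_assoc, ← mul_assoc Θ, h.Θ_mul, mul_assoc]
  have h1' (x : R) (ω : A'.Forms) : x * Θ * l ω = x * (l (Forms.map A'.parity ω) * Θ) := by
    rw [mul_assoc, h.Θ_mul]
  simp only [descFun_apply, E.coeff_mul, map_mul, map_add, add_mul, mul_add, h1, h1', h.Θ_sq,
    mul_zero, add_zero, Forms.map_ofFun, mul_assoc]
  abel

lemma descDiff_mul (h : IsOddPair l Θ H) (a b : A) :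
    E.descDiff l Θ H (a * b) = E.descDiff l Θ H a * E.descFun l Θ b +
      E.descFun l Θ a * E.descDiff l Θ H b := by
  have h1 (x y : R) (ω : A'.Forms) : x * Θ * (l ω * y) =
      x * (l (Forms.map A'.parity ω) * (Θ * y)) := by
    rw [mul_assoc, ← mul_assoc Θ, h.Θ_mul, mul_assoc]
  have h1' (x : R) (ω : A'.Forms) : x * Θ * l ω = x * (l (Forms.map A'.parity ω) * Θ) := by
    rw [mul_assoc, h.Θ_mul]
  have h2 (x y : R) (ω : A'.Forms) : x * H * (l ω * y) =
      x * (l (Forms.map A'.parity (Forms.degSign A' ω)) * (H * y)) := by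
    rw [mul_assoc, ← mul_assoc H, h.H_mul, mul_assoc]
  have h2' (x : R) (ω : A'.Forms) : x * H * l ω =
      x * (l (Forms.map A'.parity (Forms.degSign A' ω)) * H) := by
    rw [mul_assoc, h.H_mul]
  simp only [descFun_apply, descDiff_apply, E.coeff_mul, map_mul, map_add, add_mul, mul_add,
    h1, h1', h2, h2', h.Θ_sq, h.H_mul_Θ, Forms.ofDiff_mul, Forms.degSign_ofFun, mul_neg,
    mul_zero, add_zero, Forms.map_ofFun, Forms.map_ofDiff, mul_assoc]
  abel

end

section

variable {A' A : SuperAlg k} (E : OddExtension A' A) {R : Type*} [Ring R] [Algebra k R]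
  {l : A'.Forms →ₐ[k] R} {Θ H : R} {i j : ZMod 2}

lemma signComm_Θ_fun (h : IsOddPair l Θ H) {a : A'} (ha : a ∈ A'.grading i) :
    SignComm i Θ (l (Forms.ofFun A' a)) := by
  rw [SignComm, h.Θ_mul, Forms.parity_ofFun ha]
  rcases Nat.even_or_odd i.val with hs | hs <;> simp [hs.neg_one_pow]

lemma signComm_Θ_diff (h : IsOddPair l Θ H) {a : A'} (ha : a ∈ A'.grading i) :
    SignComm i Θ (l (Forms.ofDiff A' a)) := by
  rw [SignComm, h.Θ_mul, Forms.parity_ofDiff ha]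
  rcases Nat.even_or_odd i.val with hs | hs <;> simp [hs.neg_one_pow]

lemma signComm_H_fun (h : IsOddPair l Θ H) {a : A'} (ha : a ∈ A'.grading i) :
    SignComm i H (l (Forms.ofFun A' a)) := by
  rw [SignComm, h.H_mul, Forms.degSign_ofFun, Forms.parity_ofFun ha]
  rcases Nat.even_or_odd i.val with hs | hs <;> simp [hs.neg_one_pow]

lemma signComm_H_diff (h : IsOddPair l Θ H) {a : A'} (ha : a ∈ A'.grading i) :
    SignComm (1 + i) H (l (Forms.ofDiff A' a)) := by
  have h2 : (1 + 1 : ZMod 2) = 0 := by decide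
  rw [SignComm, h.H_mul, Forms.degSign_ofDiff, map_neg, Forms.parity_ofDiff ha]
  rcases zmod_two_eq (i := i) with rfl | rfl <;> simp [ZMod.val_one, h2]

lemma signComm_H_Θ (h : IsOddPair l Θ H) : SignComm 1 H Θ :=
  SignComm.one_iff.2 h.H_mul_Θ

lemma signComm_descDiff_descFun (h : IsOddPair l Θ H) {a b : A} (ha : a ∈ A.grading i)
    (hb : b ∈ A.grading j) : SignComm (i * j) (E.descDiff l Θ H a) (E.descFun l Θ b) := by
  have ha1 := E.proj.map_mem i a ha
  have hb1 := E.proj.map_mem j b hb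
  have ha2 := E.coeff_mem ha
  have hb2 := E.coeff_mem hb
  have h2 : (2 : ZMod 2) = 0 := by decide
  have hΘ : SignComm 1 Θ Θ := SignComm.one_iff.2 (by simp [h.Θ_sq])
  refine ((SignComm.add_right ?_ ?_).add_left (SignComm.add_right ?_ ?_)).add_left
    (SignComm.add_right ?_ ?_)
  · exact (Forms.signComm_diff_fun ha1 hb1).map l
  · refine SignComm.of_eq (((Forms.signComm_diff_fun ha1 hb2).map l).mul_right
      (signComm_Θ_diff h ha1).symm) ?_
    linear_combination i * h2
  · refine SignComm.of_eq (((Forms.signComm_diff_fun ha2 hb1).map l).mul_left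
      (signComm_Θ_fun h hb1)) ?_
    linear_combination j * h2
  · refine SignComm.of_eq ((((Forms.signComm_diff_fun ha2 hb2).map l).mul_left
      (signComm_Θ_fun h hb2)).mul_right ((signComm_Θ_diff h ha2).symm.mul_left hΘ)) ?_
    linear_combination (i + j + 2) * h2
  · refine SignComm.of_eq (((Forms.signComm_fun_fun ha2 hb1).map l).mul_left
      (signComm_H_fun h hb1)) ?_
    linear_combination j * h2
  · refine SignComm.of_eq ((((Forms.signComm_fun_fun ha2 hb2).map l).mul_left
      (signComm_H_fun h hb2)).mul_right ((signComm_Θ_fun h ha2).symm.mul_left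
      (signComm_H_Θ h))) ?_
    linear_combination (i + j + 2) * h2

lemma signComm_descDiff_descDiff (h : IsOddPair l Θ H) {a b : A} (ha : a ∈ A.grading i)
    (hb : b ∈ A.grading j) :
    SignComm (1 + i * j) (E.descDiff l Θ H a) (E.descDiff l Θ H b) := by
  have ha1 := E.proj.map_mem i a ha
  have hb1 := E.proj.map_mem j b hb
  have ha2 := E.coeff_mem ha
  have hb2 := E.coeff_mem hb
  have h2 : (2 : ZMod 2) = 0 := by decide
  have hΘ : SignComm 1 Θ Θ := SignComm.one_iff.2 (by simp [h.Θ_sq])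
  have hH : SignComm 0 H H := SignComm.zero_iff.2 rfl
  refine (((SignComm.add_right ?_ ?_).add_right ?_).add_left
    ((SignComm.add_right ?_ ?_).add_right ?_)).add_left ((SignComm.add_right ?_ ?_).add_right ?_)
  · exact (Forms.signComm_diff_diff ha1 hb1).map l
  · refine SignComm.of_eq (((Forms.signComm_diff_diff ha1 hb2).map l).mul_right
      (signComm_Θ_diff h ha1).symm) ?_
    linear_combination i * h2
  · refine SignComm.of_eq (((Forms.signComm_diff_fun ha1 hb2).map l).mul_right
      (signComm_H_diff h ha1).symm) ?_
    linear_combination i * h2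
  · refine SignComm.of_eq (((Forms.signComm_diff_diff ha2 hb1).map l).mul_left
      (signComm_Θ_diff h hb1)) ?_
    linear_combination j * h2
  · refine SignComm.of_eq ((((Forms.signComm_diff_diff ha2 hb2).map l).mul_left
      (signComm_Θ_diff h hb2)).mul_right ((signComm_Θ_diff h ha2).symm.mul_left hΘ)) ?_
    linear_combination (i + j + 2) * h2
  · refine SignComm.of_eq ((((Forms.signComm_diff_fun ha2 hb2).map l).mul_left
      (signComm_Θ_fun h hb2)).mul_right ((signComm_H_diff h ha2).symm.mul_left
      (signComm_H_Θ h).symm)) ?_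
    linear_combination (i + j + 2) * h2
  · refine SignComm.of_eq (((Forms.signComm_diff_fun hb1 ha2).map l).symm.mul_left
      (signComm_H_diff h hb1)) ?_
    linear_combination j * h2
  · refine SignComm.of_eq ((((Forms.signComm_diff_fun hb2 ha2).map l).symm.mul_left
      (signComm_H_diff h hb2)).mul_right ((signComm_Θ_fun h ha2).symm.mul_left
      (signComm_H_Θ h))) ?_
    linear_combination (i + j + 2) * h2
  · refine SignComm.of_eq ((((Forms.signComm_fun_fun ha2 hb2).map l).mul_left
      (signComm_H_fun h hb2)).mul_right ((signComm_H_fun h ha2).symm.mul_left hH)) ?_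
    linear_combination (i + j + 1) * h2

lemma descDiff_sq (h : IsOddPair l Θ H) {a : A} (ha : a ∈ A.grading 0) :
    E.descDiff l Θ H a * E.descDiff l Θ H a = 0 := by
  have ha1 := E.proj.map_mem 0 a ha
  have ha2 := E.coeff_mem ha
  rw [zero_add] at ha2
  have h2 : (1 + 1 : ZMod 2) = 0 := by decide
  have sq (ω : A'.Forms) (hω : ω * ω = 0) : l ω * l ω = 0 := by rw [← map_mul, hω, map_zero]
  -- the three summands of the differential have square zero and anticommute
  have hx := sq _ (Forms.ofDiff_sq A' ha1)
  have hy : (l (Forms.ofDiff A' (E.coeff a)) * Θ) * (l (Forms.ofDiff A' (E.coeff a)) * Θ) = 0 := by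
    have := ((signComm_Θ_diff h ha2).symm).mul_self_eq_zero_right h.Θ_sq
    exact this
  have hz : (l (Forms.ofFun A' (E.coeff a)) * H) * (l (Forms.ofFun A' (E.coeff a)) * H) = 0 := by
    refine (signComm_H_fun h ha2).symm.mul_self_eq_zero_left (sq _ ?_)
    rw [← map_mul, A'.odd_sq _ ha2, map_zero]
  have hxy : SignComm 1 (l (Forms.ofDiff A' (E.proj.toAlgHom a)))
      (l (Forms.ofDiff A' (E.coeff a)) * Θ) :=
    SignComm.of_eq (((Forms.signComm_diff_diff ha1 ha2).map l).mul_right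
      (signComm_Θ_diff h ha1).symm) (by simp)
  have hxz : SignComm 1 (l (Forms.ofDiff A' (E.proj.toAlgHom a)))
      (l (Forms.ofFun A' (E.coeff a)) * H) :=
    SignComm.of_eq (((Forms.signComm_diff_fun ha1 ha2).map l).mul_right
      (signComm_H_diff h ha1).symm) (by simp)
  have hyz : SignComm 1 (l (Forms.ofDiff A' (E.coeff a)) * Θ)
      (l (Forms.ofFun A' (E.coeff a)) * H) :=
    SignComm.of_eq ((((Forms.signComm_diff_fun ha2 ha2).map l).mul_left
      (signComm_Θ_fun h ha2)).mul_right ((signComm_H_diff h ha2).symm.mul_left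
      (signComm_H_Θ h).symm)) (by decide)
  rw [SignComm.one_iff] at hxy hxz hyz
  simp only [descDiff_apply, add_mul, mul_add, hx, hy, hz, hxy, hxz, hyz]
  abel

/-- Forms on `A'[θ]` are freely generated by forms on `A'` and the pair `θ`, `d θ`. -/
def desc (h : IsOddPair l Θ H) : A.Forms →ₐ[k] R :=
  Forms.desc A (AlgHom.ofLinearMap (E.descFun l Θ) E.descFun_one (E.descFun_mul h))
    (E.descDiff l Θ H) E.descDiff_one (E.descDiff_mul h)
    (fun i j a b ha hb => by
      rw [neg_one_pow_val_mul]
      exact E.signComm_descDiff_descFun h ha hb)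
    (fun i j a b ha hb => by
      rw [neg_one_pow_one_add_val_mul]
      exact E.signComm_descDiff_descDiff h ha hb)
    (fun a ha => E.descDiff_sq h ha)

lemma desc_ofFun (h : IsOddPair l Θ H) (a : A) : E.desc h (Forms.ofFun A a) =
    l (Forms.ofFun A' (E.proj.toAlgHom a)) + l (Forms.ofFun A' (E.coeff a)) * Θ := by
  exact Forms.desc_ofFun a

lemma desc_ofDiff (h : IsOddPair l Θ H) (a : A) : E.desc h (Forms.ofDiff A a) =
    l (Forms.ofDiff A' (E.proj.toAlgHom a)) + l (Forms.ofDiff A' (E.coeff a)) * Θ +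
      l (Forms.ofFun A' (E.coeff a)) * H := by
  exact Forms.desc_ofDiff a

lemma desc_incl (h : IsOddPair l Θ H) (ω : A'.Forms) : E.desc h (Forms.map E.incl ω) = l ω := by
  have h1 : (E.desc h).comp (Forms.map E.incl) = l :=
    Forms.hom_ext (fun a => by simp [desc_ofFun, E.proj_incl, E.coeff_incl])
      (fun a => by simp [desc_ofDiff, E.proj_incl, E.coeff_incl])
  exact DFunLike.congr_fun h1 ω

lemma coeff_θ : E.coeff E.θ = 1 := by
  simpa using E.coeff_incl_mul 1

lemma desc_θ (h : IsOddPair l Θ H) : E.desc h (Forms.ofFun A E.θ) = Θ := by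
  simp [desc_ofFun, E.proj_θ, E.coeff_θ]

lemma desc_dθ (h : IsOddPair l Θ H) : E.desc h (Forms.ofDiff A E.θ) = H := by
  simp [desc_ofDiff, E.proj_θ, E.coeff_θ, Forms.ofDiff_one]

/-- The pair `θ`, `d θ` in the forms on `A'[θ]`. -/
lemma isOddPair : IsOddPair (Forms.map E.incl) (Forms.ofFun A E.θ) (Forms.ofDiff A E.θ) where
  Θ_mul ω := by
    induction ω using Forms.induction_left with
    | one => simp
    | add x z hx hz => simp only [map_add, mul_add, add_mul, hx, hz]
    | smul c x hx => simp only [map_smul, mul_smul_comm, smul_mul_assoc, hx]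
    | ofFun_mul a x hx =>
      have h : Forms.ofFun A E.θ * Forms.map E.incl (Forms.ofFun A' a) =
          Forms.map E.incl (Forms.map A'.parity (Forms.ofFun A' a)) * Forms.ofFun A E.θ := by
        simp only [Forms.map_ofFun, ← map_mul, E.θ_mul]
      simp only [map_mul]
      rw [← mul_assoc, h, mul_assoc, hx, mul_assoc]
    | ofDiff_mul a x hx =>
      have h : Forms.ofFun A E.θ * Forms.map E.incl (Forms.ofDiff A' a) =
          Forms.map E.incl (Forms.map A'.parity (Forms.ofDiff A' a)) * Forms.ofFun A E.θ := by
        obtain ⟨y, hy, z, hz, rfl⟩ := A'.exists_add a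
        have h0 := Forms.signComm_diff_fun (E.incl.map_mem _ y hy) E.θ_mem
        have h1 := Forms.signComm_diff_fun (E.incl.map_mem _ z hz) E.θ_mem
        rw [zero_mul, SignComm.zero_iff] at h0
        rw [mul_one, SignComm.one_iff] at h1
        simp [mul_add, add_mul, parity_of_mem hy, parity_of_mem hz, ZMod.val_one, h0, h1]
      simp only [map_mul]
      rw [← mul_assoc, h, mul_assoc, hx, mul_assoc]
  H_mul ω := by
    induction ω using Forms.induction_left with
    | one => simp
    | add x z hx hz => simp only [map_add, mul_add, add_mul, hx, hz]
    | smul c x hx => simp only [map_smul, mul_smul_comm, smul_mul_assoc, hx]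
    | ofFun_mul a x hx =>
      have h : Forms.ofDiff A E.θ * Forms.map E.incl (Forms.ofFun A' a) =
          Forms.map E.incl (Forms.map A'.parity (Forms.ofFun A' a)) * Forms.ofDiff A E.θ := by
        obtain ⟨y, hy, z, hz, rfl⟩ := A'.exists_add a
        have h0 := Forms.signComm_diff_fun E.θ_mem (E.incl.map_mem _ y hy)
        have h1 := Forms.signComm_diff_fun E.θ_mem (E.incl.map_mem _ z hz)
        rw [mul_zero, SignComm.zero_iff] at h0
        rw [mul_one, SignComm.one_iff] at h1
        simp [mul_add, add_mul, parity_of_mem hy, parity_of_mem hz, ZMod.val_one, h0, h1]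
      simp only [map_mul, Forms.degSign_ofFun]
      rw [← mul_assoc, h, mul_assoc, hx, mul_assoc]
    | ofDiff_mul a x hx =>
      have h : Forms.ofDiff A E.θ * Forms.map E.incl (Forms.ofDiff A' a) =
          Forms.map E.incl (Forms.map A'.parity (-Forms.ofDiff A' a)) * Forms.ofDiff A E.θ := by
        obtain ⟨y, hy, z, hz, rfl⟩ := A'.exists_add a
        have h0 := Forms.signComm_diff_diff E.θ_mem (E.incl.map_mem _ y hy)
        have h1 := Forms.signComm_diff_diff E.θ_mem (E.incl.map_mem _ z hz)
        rw [mul_zero, add_zero, SignComm.one_iff] at h0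
        rw [mul_one, show (1 + 1 : ZMod 2) = 0 by decide, SignComm.zero_iff] at h1
        simp [mul_add, add_mul, parity_of_mem hy, parity_of_mem hz, ZMod.val_one, h0, h1,
          add_comm]
      simp only [map_mul, Forms.degSign_ofDiff]
      rw [← mul_assoc, h, mul_assoc, hx, mul_assoc]
  Θ_sq := by rw [← map_mul, E.θ_sq, map_zero]
  H_mul_Θ := by
    have h := Forms.signComm_diff_fun E.θ_mem E.θ_mem
    rwa [mul_one, SignComm.one_iff] at h

end

end OddExtension

end SuperAlg

end

noncomputable section

namespace SuperAlg

variable {k : Type u} [Field k]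

namespace OddExtension

/-! ### Forms on `A'[θ]` and their contracting homotopy -/

section

variable (A' : SuperAlg k)

/-- Polynomials in `η` with coefficients in the forms on `A'`, written on the left; here `η`
stands for `d θ`. -/
abbrev Coeffs : Type u := ℕ →₀ A'.Forms

/-- The space of expressions `∑ αₘ ηᵐ + ∑ βₘ θ ηᵐ`, where `αₘ` and `βₘ` are forms on `A'`. -/
abbrev Model : Type u := Coeffs A' × Coeffs A'

/-- Apply a linear map to all coefficients. -/
def onCoeffs (f : A'.Forms →ₗ[k] A'.Forms) : Coeffs A' →ₗ[k] Coeffs A' :=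
  Finsupp.mapRange.linearMap f

@[simp] lemma onCoeffs_single (f : A'.Forms →ₗ[k] A'.Forms) (m : ℕ) (α : A'.Forms) :
    onCoeffs A' f (Finsupp.single m α) = Finsupp.single m (f α) := by
  simp [onCoeffs]

/-- Multiplication by `η` from the right. -/
def shift : Coeffs A' →ₗ[k] Coeffs A' :=
  Finsupp.lmapDomain A'.Forms k Nat.succ

/-- Division by `η`, discarding the constant term. -/
def unshift : Coeffs A' →ₗ[k] Coeffs A' :=
  Finsupp.lsum k fun m => Nat.casesOn m 0 fun n => Finsupp.lsingle n

@[simp] lemma shift_single (m : ℕ) (α : A'.Forms) :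
    shift A' (Finsupp.single m α) = Finsupp.single (m + 1) α := by
  simp [shift]

@[simp] lemma unshift_single_zero (α : A'.Forms) :
    unshift A' (Finsupp.single 0 α) = 0 := by
  simp [unshift]

@[simp] lemma unshift_single_succ (m : ℕ) (α : A'.Forms) :
    unshift A' (Finsupp.single (m + 1) α) = Finsupp.single m α := by
  simp [unshift]

variable {A'} in
lemma model_ext {V : Type*} [AddCommGroup V] [Module k V] {f g : Model A' →ₗ[k] V}
    (hl : ∀ m α, f (Finsupp.single m α, 0) = g (Finsupp.single m α, 0))
    (hr : ∀ m α, f (0, Finsupp.single m α) = g (0, Finsupp.single m α)) : f = g :=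
  LinearMap.prod_ext (Finsupp.lhom_ext hl) (Finsupp.lhom_ext hr)

/-- Left multiplication by forms on `A'`. -/
def modelMul : A'.Forms →ₐ[k] Module.End k (Model A') :=
  AlgHom.ofLinearMap
    { toFun := fun ω => LinearMap.prodMap (onCoeffs A' (LinearMap.mulLeft k ω))
        (onCoeffs A' (LinearMap.mulLeft k ω))
      map_add' := fun x y => model_ext (by simp [add_mul]) (by simp [add_mul])
      map_smul' := fun c x => model_ext (by simp [-Finsupp.single_mul])
        (by simp [-Finsupp.single_mul]) }
    (model_ext (by simp) (by simp))
    (fun x y => model_ext (by simp [-Finsupp.single_mul]) (by simp [-Finsupp.single_mul]))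

lemma modelMul_apply (ω : A'.Forms) (x : Model A') : modelMul A' ω x =
    (onCoeffs A' (LinearMap.mulLeft k ω) x.1, onCoeffs A' (LinearMap.mulLeft k ω) x.2) := rfl

/-- The parity automorphism of forms, as a linear map. -/
abbrev paritySign : A'.Forms →ₗ[k] A'.Forms := (Forms.map A'.parity).toLinearMap

/-- The degree sign of forms, as a linear map. -/
abbrev degreeSign : A'.Forms →ₗ[k] A'.Forms := (Forms.degSign A').toLinearMap

/-- Left multiplication by `θ`. -/
def modelΘ : Module.End k (Model A') :=
  LinearMap.inr k _ _ ∘ₗ onCoeffs A' (paritySign A') ∘ₗ LinearMap.fst k _ _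

/-- Left multiplication by `η`. -/
def modelH : Module.End k (Model A') :=
  LinearMap.prodMap (shift A' ∘ₗ onCoeffs A' (paritySign A' ∘ₗ degreeSign A'))
    (-(shift A' ∘ₗ onCoeffs A' (paritySign A' ∘ₗ degreeSign A')))

lemma modelΘ_apply (x : Model A') : modelΘ A' x = (0, onCoeffs A' (paritySign A') x.1) := rfl

lemma modelH_apply (x : Model A') : modelH A' x =
    (shift A' (onCoeffs A' (paritySign A' ∘ₗ degreeSign A') x.1),
      -shift A' (onCoeffs A' (paritySign A' ∘ₗ degreeSign A') x.2)) := rfl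

lemma model_isOddPair : IsOddPair (modelMul A') (modelΘ A') (modelH A') where
  Θ_mul ω := by
    refine model_ext (fun m α => ?_) (fun m α => ?_) <;>
    simp [modelΘ_apply, modelMul_apply, -Finsupp.single_mul]
  H_mul ω := by
    refine model_ext (fun m α => ?_) (fun m α => ?_) <;>
    simp [modelH_apply, modelMul_apply, -Finsupp.single_mul]
  Θ_sq := by
    refine model_ext (fun m α => ?_) (fun m α => ?_) <;>
    simp [modelΘ_apply]
  H_mul_Θ := by
    refine model_ext (fun m α => ?_) (fun m α => ?_) <;>
    simp [modelH_apply, modelΘ_apply, Forms.map_degSign]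

/-- The differential `d (α + β θ) = dα + dβ θ + (-1) ^ p β η`, for `β` of degree `p`. -/
def modelD : Model A' →ₗ[k] Model A' :=
  LinearMap.prod
    ((onCoeffs A' (Forms.d A')).coprod (shift A' ∘ₗ onCoeffs A' (degreeSign A')))
    (onCoeffs A' (Forms.d A') ∘ₗ LinearMap.snd k _ _)

/-- The contracting homotopy, replacing `α ηᵐ⁺¹` by `± α θ ηᵐ`. -/
def modelHomotopy : Model A' →ₗ[k] Model A' :=
  LinearMap.inr k _ _ ∘ₗ onCoeffs A' (degreeSign A') ∘ₗ unshift A' ∘ₗ LinearMap.fst k _ _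

lemma modelD_apply (x : Model A') : modelD A' x =
    (onCoeffs A' (Forms.d A') x.1 + shift A' (onCoeffs A' (degreeSign A') x.2),
      onCoeffs A' (Forms.d A') x.2) := rfl

lemma modelHomotopy_apply (x : Model A') : modelHomotopy A' x =
    (0, onCoeffs A' (degreeSign A') (unshift A' x.1)) := rfl

/-- The homotopy formula. It holds in every characteristic because `d (θ ηᵐ) = ηᵐ⁺¹`
without a factor `m + 1`. -/
lemma modelD_homotopy (x : Model A') :
    modelD A' (modelHomotopy A' x) + modelHomotopy A' (modelD A' x) +
      (Finsupp.single 0 (x.1 0), 0) = x := by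
  have h : modelD A' ∘ₗ modelHomotopy A' + modelHomotopy A' ∘ₗ modelD A' +
      LinearMap.inl k _ _ ∘ₗ Finsupp.lsingle 0 ∘ₗ Finsupp.lapply 0 ∘ₗ LinearMap.fst k _ _ =
      LinearMap.id := by
    refine model_ext (fun m α => ?_) (fun m α => ?_)
    · cases m <;> simp [modelD_apply, modelHomotopy_apply, Forms.d_degSign]
    · simp [modelD_apply, modelHomotopy_apply]
  exact DFunLike.congr_fun h x

end

section

variable {A' A : SuperAlg k} (E : OddExtension A' A)

/-- The coefficients of a form on `A'[θ]`. -/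
def toModel : A.Forms →ₗ[k] Model A' :=
  LinearMap.applyₗ (Finsupp.single 0 1, 0) ∘ₗ (E.desc (model_isOddPair A')).toLinearMap

/-- The form on `A'[θ]` with given coefficients. -/
def ofModel : Model A' →ₗ[k] A.Forms :=
  LinearMap.coprod
    (Finsupp.lsum k fun m => LinearMap.mulRight k (Forms.ofDiff A E.θ ^ m) ∘ₗ
      (Forms.map E.incl).toLinearMap)
    (Finsupp.lsum k fun m => LinearMap.mulRight k (Forms.ofFun A E.θ * Forms.ofDiff A E.θ ^ m) ∘ₗ
      (Forms.map E.incl).toLinearMap)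

lemma toModel_apply (ω : A.Forms) :
    E.toModel ω = E.desc (model_isOddPair A') ω (Finsupp.single 0 1, 0) := rfl

@[simp]
lemma ofModel_single_left (m : ℕ) (α : A'.Forms) : E.ofModel (Finsupp.single m α, 0) =
    Forms.map E.incl α * Forms.ofDiff A E.θ ^ m := by
  simp [ofModel]

@[simp]
lemma ofModel_single_right (m : ℕ) (α : A'.Forms) : E.ofModel (0, Finsupp.single m α) =
    Forms.map E.incl α * (Forms.ofFun A E.θ * Forms.ofDiff A E.θ ^ m) := by
  simp [ofModel, -LinearMap.mulRight_mul]

@[simp]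
lemma ofModel_zero : E.ofModel (0, 0) = 0 := map_zero E.ofModel

lemma ofModel_mul (ω : A'.Forms) (x : Model A') :
    E.ofModel (modelMul A' ω x) = Forms.map E.incl ω * E.ofModel x := by
  have h : E.ofModel ∘ₗ modelMul A' ω = LinearMap.mulLeft k (Forms.map E.incl ω) ∘ₗ E.ofModel := by
    refine model_ext (fun m α => ?_) (fun m α => ?_) <;>
    simp [modelMul_apply, mul_assoc, -Finsupp.single_mul]
  exact DFunLike.congr_fun h x

lemma ofModel_Θ (x : Model A') :
    E.ofModel (modelΘ A' x) = Forms.ofFun A E.θ * E.ofModel x := by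
  have h : E.ofModel ∘ₗ modelΘ A' = LinearMap.mulLeft k (Forms.ofFun A E.θ) ∘ₗ E.ofModel := by
    refine model_ext (fun m α => ?_) (fun m α => ?_)
    · have := E.isOddPair.Θ_mul α
      simp [modelΘ_apply, ← mul_assoc, this]
    · have := E.isOddPair.Θ_mul α
      rw [LinearMap.comp_apply, LinearMap.comp_apply, LinearMap.mulLeft_apply, modelΘ_apply,
        ofModel_single_right, ← mul_assoc, this, mul_assoc, ← mul_assoc (Forms.ofFun A E.θ),
        E.isOddPair.Θ_sq]
      simp
  exact DFunLike.congr_fun h x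

lemma ofModel_H (x : Model A') :
    E.ofModel (modelH A' x) = Forms.ofDiff A E.θ * E.ofModel x := by
  have h : E.ofModel ∘ₗ modelH A' = LinearMap.mulLeft k (Forms.ofDiff A E.θ) ∘ₗ E.ofModel := by
    refine model_ext (fun m α => ?_) (fun m α => ?_)
    · have := E.isOddPair.H_mul α
      simp [modelH_apply, ← mul_assoc, this]
      simp [pow_succ', mul_assoc]
    · have := E.isOddPair.H_mul α
      have hneg (f : Coeffs A') : E.ofModel (0, -f) = -E.ofModel (0, f) := by
        rw [← map_neg]; simp
      simp only [LinearMap.comp_apply, LinearMap.mulLeft_apply, modelH_apply, map_zero,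
        onCoeffs_single, shift_single, hneg, ofModel_single_right, pow_succ']
      rw [← mul_assoc (Forms.ofDiff A E.θ), this, mul_assoc, ← mul_assoc (Forms.ofDiff A E.θ),
        E.isOddPair.H_mul_Θ]
      simp [mul_assoc]
  exact DFunLike.congr_fun h x

/-- The action of forms on the model corresponds to multiplication of forms. -/
lemma ofModel_desc (ω : A.Forms) (x : Model A') :
    E.ofModel (E.desc (model_isOddPair A') ω x) = ω * E.ofModel x := by
  induction ω using Forms.induction_left generalizing x with
  | one => simp
  | add y z hy hz => simp only [map_add, LinearMap.add_apply, add_mul, hy, hz]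
  | smul c y hy => simp only [map_smul, LinearMap.smul_apply, smul_mul_assoc, hy]
  | ofFun_mul a y hy =>
    rw [map_mul, Module.End.mul_apply, desc_ofFun, LinearMap.add_apply, map_add,
      Module.End.mul_apply, ofModel_mul, ofModel_mul, ofModel_Θ, hy, mul_assoc]
    conv_rhs => rw [E.eq_add a]
    simp [add_mul, mul_assoc]
  | ofDiff_mul a y hy =>
    rw [map_mul, Module.End.mul_apply, desc_ofDiff, LinearMap.add_apply, LinearMap.add_apply,
      map_add, map_add, Module.End.mul_apply, Module.End.mul_apply, ofModel_mul, ofModel_mul,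
      ofModel_mul, ofModel_Θ, ofModel_H, hy, mul_assoc]
    conv_rhs => rw [E.eq_add a]
    simp [add_mul, mul_assoc, Forms.ofDiff_mul, add_assoc]

lemma ofModel_toModel (ω : A.Forms) : E.ofModel (E.toModel ω) = ω := by
  simp [toModel_apply, ofModel_desc]

lemma modelH_pow (m : ℕ) : (modelH A' ^ m) (Finsupp.single 0 1, 0) = (Finsupp.single m 1, 0) := by
  induction m with
  | zero => simp
  | succ m ih => rw [pow_succ', Module.End.mul_apply, ih]; simp [modelH_apply]

/-- Forms on `A'[θ]` have unique coefficients. -/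
lemma toModel_ofModel (x : Model A') : E.toModel (E.ofModel x) = x := by
  have h : E.toModel ∘ₗ E.ofModel = LinearMap.id := by
    refine model_ext (fun m α => ?_) (fun m α => ?_) <;>
    simp [toModel_apply, desc_incl, desc_θ, desc_dθ, modelH_pow, modelMul_apply, modelΘ_apply]
  exact DFunLike.congr_fun h x

lemma d_ofModel (x : Model A') : Forms.d A (E.ofModel x) = E.ofModel (modelD A' x) := by
  have hpow (m : ℕ) : Forms.d A (Forms.ofDiff A E.θ ^ m) = 0 :=
    Forms.d_eq_zero_of_mem A
      (Submodule.pow_mem_pow _ (LinearMap.mem_range_self (Forms.ofDiff A) E.θ) m)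
  have h : Forms.d A ∘ₗ E.ofModel = E.ofModel ∘ₗ modelD A' := by
    refine model_ext (fun m α => ?_) (fun m α => ?_)
    · simp [modelD_apply, Forms.d_mul, hpow, Forms.map_d_apply]
    · have h1 (f g : Coeffs A') : E.ofModel (f, g) = E.ofModel (f, 0) + E.ofModel (0, g) := by
        rw [← map_add]; simp
      rw [LinearMap.comp_apply, LinearMap.comp_apply, modelD_apply, h1 (_ + _)]
      simp [Forms.d_mul, hpow, Forms.map_d_apply, Forms.map_degSign, pow_succ', add_comm]
  exact DFunLike.congr_fun h x

lemma toModel_d (ω : A.Forms) : E.toModel (Forms.d A ω) = modelD A' (E.toModel ω) := by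
  conv_lhs => rw [← E.ofModel_toModel ω, d_ofModel, toModel_ofModel]

lemma proj_ofModel (x : Model A') : Forms.map E.proj (E.ofModel x) = x.1 0 := by
  have hi (α : A'.Forms) : Forms.map E.proj (Forms.map E.incl α) = α := by
    have h1 : (Forms.map E.proj).comp (Forms.map E.incl) = AlgHom.id k A'.Forms :=
      Forms.hom_ext (by simp [E.proj_incl]) (by simp [E.proj_incl])
    exact DFunLike.congr_fun h1 α
  have h : (Forms.map E.proj).toLinearMap ∘ₗ E.ofModel =
      Finsupp.lapply 0 ∘ₗ LinearMap.fst k _ _ := by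
    refine model_ext (fun m α => ?_) (fun m α => ?_)
    · cases m <;> simp [hi, E.proj_θ]
    · simp [E.proj_θ]
  exact DFunLike.congr_fun h x

/-- The homotopy between the identity of the forms on `A'[θ]` and the retraction to forms on
`A'`. -/
def homotopy : A.Forms →ₗ[k] A.Forms := E.ofModel ∘ₗ modelHomotopy A' ∘ₗ E.toModel

/-- The forms on `A'` are a deformation retract of the forms on `A'[θ]`. -/
lemma d_homotopy (ω : A.Forms) : Forms.d A (E.homotopy ω) + E.homotopy (Forms.d A ω) +
    Forms.map E.incl (Forms.map E.proj ω) = ω := by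
  have h : Forms.map E.incl (Forms.map E.proj ω) =
      E.ofModel (Finsupp.single 0 ((E.toModel ω).1 0), 0) := by
    conv_lhs => rw [← E.ofModel_toModel ω, proj_ofModel]
    simp
  rw [h, homotopy, LinearMap.comp_apply, LinearMap.comp_apply, LinearMap.comp_apply,
    LinearMap.comp_apply, d_ofModel, toModel_d, ← map_add, ← map_add, modelD_homotopy,
    ofModel_toModel]

lemma proj_homotopy (ω : A.Forms) : Forms.map E.proj (E.homotopy ω) = 0 := by
  rw [homotopy, LinearMap.comp_apply, LinearMap.comp_apply, proj_ofModel, modelHomotopy_apply]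
  rfl

end

end OddExtension

end SuperAlg

end

noncomputable section

namespace SuperAlg

variable {k : Type u} [Field k]

/-! ### The Poincaré lemma relative to the quotient by the odd ideal -/

section

/-- The quotient of a superalgebra by the ideal generated by odd elements, as a purely even
superalgebra. -/
def quot (A : SuperAlg k) : SuperAlg k := ofComm k (A ⧸ A.oddIdeal)

/-- The projection of a superalgebra to its purely even quotient. -/
def toQuot (A : SuperAlg k) : A ⟶ A.quot :=
  homOfComm (Ideal.Quotient.mkₐ k A.oddIdeal) fun _ ha => toModOdd_eq_zero ha

/-- The map induced on purely even quotients. -/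
def quotMap {A B : SuperAlg k} (f : A ⟶ B) : A.quot ⟶ B.quot :=
  ofCommMap (Ideal.quotientMapₐ B.oddIdeal f.toAlgHom (oddIdeal_le_comap f))

lemma toQuot_quotMap {A B : SuperAlg k} (f : A ⟶ B) : A.toQuot ≫ quotMap f = f ≫ B.toQuot := rfl

lemma toQuot_surjective (A : SuperAlg k) : Function.Surjective A.toQuot.toAlgHom :=
  Ideal.Quotient.mk_surjective

lemma toQuot_eq_zero_iff {A : SuperAlg k} {a : A} : A.toQuot.toAlgHom a = 0 ↔ a ∈ A.oddIdeal :=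
  Ideal.Quotient.eq_zero_iff_mem

/-- The relative Poincaré lemma: the kernel of the restriction of forms from `A` to the quotient by
odd elements is acyclic (without regard to degrees). -/
def IsPoincare (A : SuperAlg k) : Prop :=
  ∀ ω : A.Forms, Forms.d A ω = 0 → Forms.map A.toQuot ω = 0 →
    ∃ η, Forms.d A η = ω ∧ Forms.map A.toQuot η = 0

/-- The relative Poincaré lemma, degree by degree. -/
lemma IsPoincare.exists_mem {A : SuperAlg k} (hA : A.IsPoincare) {p : ℕ} {ω : A.Forms}
    (hω : ω ∈ A.formsDeg (p + 1)) (hd : Forms.d A ω = 0) (h0 : Forms.map A.toQuot ω = 0) :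
    ∃ η ∈ A.formsDeg p, Forms.d A η = ω ∧ Forms.map A.toQuot η = 0 := by
  obtain ⟨η, h1, h2⟩ := hA ω hd h0
  refine ⟨Forms.degProj A p η, Forms.degProj_mem A p η, ?_, ?_⟩
  · rw [← Forms.degProj_succ_d, h1, Forms.degProj_of_mem hω]
  · rw [Forms.map_degProj, h2, map_zero]

/-- There are no forms of degree `-1`, so a closed function in the kernel vanishes. -/
lemma IsPoincare.eq_zero {A : SuperAlg k} (hA : A.IsPoincare) {ω : A.Forms}
    (hω : ω ∈ A.formsDeg 0) (hd : Forms.d A ω = 0) (h0 : Forms.map A.toQuot ω = 0) : ω = 0 := by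
  obtain ⟨η, h1, h2⟩ := hA ω hd h0
  rw [← Forms.degProj_of_mem hω, ← h1, Forms.degProj_zero_d]

lemma IsPoincare.of_iso {A B : SuperAlg k} (e : A ≅ B) (hA : A.IsPoincare) : B.IsPoincare := by
  intro ω hd h0
  have hq : Forms.map A.toQuot (Forms.map e.inv ω) = 0 := by
    rw [Forms.map_map, ← toQuot_quotMap, ← Forms.map_map, h0, map_zero]
  obtain ⟨η, h1, h2⟩ := hA (Forms.map e.inv ω) (by rw [← Forms.map_d_apply, hd, map_zero]) hq
  refine ⟨Forms.map e.hom η, ?_, ?_⟩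
  · rw [← Forms.map_d_apply, h1, Forms.map_map, e.inv_hom_id, Forms.map_id]
    rfl
  · rw [Forms.map_map, ← toQuot_quotMap, ← Forms.map_map, h2, map_zero]

lemma isPoincare_of_retraction {A : SuperAlg k} (r : A.quot ⟶ A) (hr : A.toQuot ≫ r = 𝟙 A) :
    A.IsPoincare := by
  intro ω _ h0
  refine ⟨0, ?_, map_zero _⟩
  rw [map_zero, ← AlgHom.id_apply (R := k) ω, ← Forms.map_id, ← hr, ← Forms.map_map, h0, map_zero]

/-- The Poincaré lemma passes from `A'` to `A'[θ]`. -/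
lemma OddExtension.isPoincare {A' A : SuperAlg k} (E : OddExtension A' A)
    (hA : A'.IsPoincare) : A.IsPoincare := by
  intro ω hd h0
  have hQ : E.proj ≫ E.incl ≫ A.toQuot = A.toQuot := by
    ext a
    have h : A.toQuot.toAlgHom E.θ = 0 :=
      toQuot_eq_zero_iff.2 (Ideal.subset_span E.θ_mem)
    change A.toQuot.toAlgHom (E.incl.toAlgHom (E.proj.toAlgHom a)) = _
    conv_rhs => rw [E.eq_add a, map_add, map_mul, h, mul_zero, add_zero]
  have h1 : Forms.d A' (Forms.map E.proj ω) = 0 := by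
    rw [← Forms.map_d_apply, hd, map_zero]
  have h2 : Forms.map A'.toQuot (Forms.map E.proj ω) = 0 := by
    rw [Forms.map_map, ← toQuot_quotMap, ← Forms.map_map, h0, map_zero]
  obtain ⟨η, h3, h4⟩ := hA _ h1 h2
  refine ⟨E.homotopy ω + Forms.map E.incl η, ?_, ?_⟩
  · rw [map_add, ← Forms.map_d_apply, h3]
    have h := E.d_homotopy ω
    rwa [hd, map_zero, add_zero] at h
  · have h5 : Forms.map A.toQuot (E.homotopy ω) = 0 := by
      rw [← hQ, ← Forms.map_map, E.proj_homotopy, map_zero]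
    rw [map_add, h5, zero_add, Forms.map_map, ← toQuot_quotMap, ← Forms.map_map, h4, map_zero]

end

/-! ### Exterior algebras -/

section

variable (k) (C : Type u) [CommRing C] [Algebra k C]

lemma ι_mul_ι_comm {M : Type*} [AddCommGroup M] [Module C M] (m m' : M) (x : ExteriorAlgebra C M) :
    Commute (ExteriorAlgebra.ι C m * ExteriorAlgebra.ι C m') x := by
  have hs (a b : M) : ExteriorAlgebra.ι C a * ExteriorAlgebra.ι C b =
      -(ExteriorAlgebra.ι C b * ExteriorAlgebra.ι C a) :=
    eq_neg_of_add_eq_zero_left (ExteriorAlgebra.ι_add_mul_swap a b)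
  induction x using ExteriorAlgebra.induction with
  | algebraMap r => exact (Algebra.commutes r _).symm
  | ι y =>
    change _ * _ * _ = _ * (_ * _)
    rw [mul_assoc, hs m' y, mul_neg, ← mul_assoc, hs m y, neg_mul, neg_neg, mul_assoc]
  | mul a b ha hb => exact ha.mul_right hb
  | add a b ha hb => exact ha.add_right hb

lemma commute_of_mem_even {M : Type*} [AddCommGroup M] [Module C M] {a : ExteriorAlgebra C M}
    (ha : a ∈ CliffordAlgebra.evenOdd (0 : QuadraticForm C M) 0) (b : ExteriorAlgebra C M) :
    Commute a b := by
  induction a, ha using CliffordAlgebra.even_induction with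
  | algebraMap r => exact Algebra.commutes r b
  | add x y hx hy h h' => exact h.add_left h'
  | ι_mul_ι_mul m m' x hx h => exact (ι_mul_ι_comm C m m' b).mul_left h

open CliffordAlgebra in
/-- The exterior algebra `⋀_C (Cⁿ)` as a superalgebra over `k`. -/
def exterior (n : ℕ) : SuperAlg k where
  carrier := ExteriorAlgebra C (Fin n → C)
  grading i := (evenOdd (0 : QuadraticForm C (Fin n → C)) i).restrictScalars k
  graded :=
    letI h := CliffordAlgebra.gradedAlgebra (0 : QuadraticForm C (Fin n → C))
    { one_mem := h.one_mem
      mul_mem := h.mul_mem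
      decompose' := h.decompose'
      left_inv := h.left_inv
      right_inv := h.right_inv }
  even_comm a ha b := commute_of_mem_even C ha b
  odd_anticomm a ha b hb := by
    induction a, ha using odd_induction with
    | ι m =>
      induction b, hb using odd_induction with
      | ι m' => exact eq_neg_of_add_eq_zero_left (ExteriorAlgebra.ι_add_mul_swap m m')
      | add x y hx hy h h' => rw [mul_add, add_mul, h, h', neg_add]
      | ι_mul_ι_mul m₁ m₂ x hx h =>
        rw [← mul_assoc, ← (ι_mul_ι_comm C m₁ m₂ _).eq, mul_assoc, h, mul_neg, ← mul_assoc]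
    | add x y hx hy h h' => rw [mul_add, add_mul, h, h', neg_add]
    | ι_mul_ι_mul m₁ m₂ x hx h =>
      rw [mul_assoc, h, mul_neg, ← mul_assoc, (ι_mul_ι_comm C m₁ m₂ _).eq, mul_assoc]
  odd_sq a ha := by
    have anti : ∀ x ∈ evenOdd (0 : QuadraticForm C (Fin n → C)) 1,
        ∀ y ∈ evenOdd (0 : QuadraticForm C (Fin n → C)) 1, x * y + y * x = 0 := by
      intro a ha b hb
      induction a, ha using odd_induction with
      | ι m =>
        induction b, hb using odd_induction with
        | ι m' => exact ExteriorAlgebra.ι_add_mul_swap m m'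
        | add x y hx hy h h' =>
          rw [mul_add, add_mul, add_add_add_comm, h, h', add_zero]
        | ι_mul_ι_mul m₁ m₂ x hx h =>
          rw [← mul_assoc, ← (ι_mul_ι_comm C m₁ m₂ _).eq, mul_assoc, mul_assoc _ x, ← mul_add, h,
            mul_zero]
      | add x y hx hy h h' => rw [mul_add, add_mul, add_add_add_comm, h, h', add_zero]
      | ι_mul_ι_mul m₁ m₂ x hx h =>
        rw [← mul_assoc b, ← (ι_mul_ι_comm C m₁ m₂ b).eq, mul_assoc, mul_assoc _ b, ← mul_add, h,
          mul_zero]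
    induction a, ha using odd_induction with
    | ι m => exact ExteriorAlgebra.ι_sq_zero m
    | add x y hx hy h h' =>
      rw [mul_add, add_mul, add_mul, h, h', zero_add, add_zero, anti y hy x hx]
    | ι_mul_ι_mul m₁ m₂ x hx h =>
      rw [mul_assoc, ← mul_assoc x, ← (ι_mul_ι_comm C m₁ m₂ x).eq, mul_assoc _ x, h, mul_zero,
        mul_zero]

variable {k C}

/-- The inclusion of vectors in the exterior algebra. -/
def exteriorι (n : ℕ) (m : Fin n → C) : exterior k C n := ExteriorAlgebra.ι C m

lemma exteriorι_mem (n : ℕ) (m : Fin n → C) :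
    exteriorι n m ∈ (exterior k C n).grading 1 := CliffordAlgebra.ι_mem_evenOdd_one _ m

open CliffordAlgebra in
lemma map_mem_of_mem_evenOdd {n : ℕ} {B : SuperAlg k} (f : ExteriorAlgebra C (Fin n → C) →ₐ[k] B)
    (h₀ : ∀ c, f (algebraMap C _ c) ∈ B.grading 0)
    (h₁ : ∀ m, f (ExteriorAlgebra.ι C m) ∈ B.grading 1) (i : ZMod 2)
    (a : ExteriorAlgebra C (Fin n → C)) (ha : a ∈ evenOdd (0 : QuadraticForm C (Fin n → C)) i) :
    f a ∈ B.grading i := by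
  have hpair (m m' : Fin n → C) :
      f (ExteriorAlgebra.ι C m * ExteriorAlgebra.ι C m') ∈ B.grading 0 := by
    rw [map_mul]
    exact SetLike.mul_mem_graded (h₁ m) (h₁ m')
  have hmul (i : ZMod 2) (m m' : Fin n → C) (x : ExteriorAlgebra C (Fin n → C))
      (hx : f x ∈ B.grading i) :
      f (ExteriorAlgebra.ι C m * ExteriorAlgebra.ι C m' * x) ∈ B.grading i := by
    rw [map_mul]
    simpa using SetLike.mul_mem_graded (hpair m m') hx
  rcases zmod_two_eq (i := i) with rfl | rfl
  · induction a, ha using even_induction with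
    | algebraMap r => exact h₀ r
    | add x y hx hy h h' => rw [map_add]; exact add_mem h h'
    | ι_mul_ι_mul m m' x hx h => exact hmul 0 m m' x h
  · induction a, ha using odd_induction with
    | ι m => exact h₁ m
    | add x y hx hy h h' => rw [map_add]; exact add_mem h h'
    | ι_mul_ι_mul m m' x hx h => exact hmul 1 m m' x h

/-- A homomorphism from an exterior algebra respects parity if it does so on generators. -/
def exteriorHom {n : ℕ} {B : SuperAlg k} (f : ExteriorAlgebra C (Fin n → C) →ₐ[k] B)
    (h₀ : ∀ c, f (algebraMap C _ c) ∈ B.grading 0)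
    (h₁ : ∀ m, f (ExteriorAlgebra.ι C m) ∈ B.grading 1) : exterior k C n ⟶ B where
  toAlgHom := f
  map_mem := map_mem_of_mem_evenOdd f h₀ h₁

/-- The map of exterior algebras induced by a linear map. -/
def exteriorMap {m n : ℕ} (f : (Fin m → C) →ₗ[C] (Fin n → C)) : exterior k C m ⟶ exterior k C n :=
  exteriorHom (B := exterior k C n) ((ExteriorAlgebra.map f).restrictScalars k)
    (fun c => by
      have h : ExteriorAlgebra.map f (algebraMap C _ c) ∈
          CliffordAlgebra.evenOdd (0 : QuadraticForm C (Fin n → C)) 0 := by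
        rw [AlgHom.commutes]
        exact SetLike.algebraMap_mem_graded (CliffordAlgebra.evenOdd _) c
      exact h)
    (fun v => by
      have h : ExteriorAlgebra.map f (ExteriorAlgebra.ι C v) ∈
          CliffordAlgebra.evenOdd (0 : QuadraticForm C (Fin n → C)) 1 := by
        rw [ExteriorAlgebra.map_apply_ι]
        exact exteriorι_mem (k := k) n _
      exact h)

variable (C) in
/-- The inclusion of the hyperplane of vectors with vanishing first coordinate. -/
def consZero (n : ℕ) : (Fin n → C) →ₗ[C] (Fin (n + 1) → C) where
  toFun v := Fin.cons 0 v
  map_add' v w := by ext i; cases i using Fin.cases <;> simp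
  map_smul' c v := by ext i; cases i using Fin.cases <;> simp

section

open CliffordAlgebra

variable {n : ℕ}

lemma eq_consZero_add (v : Fin (n + 1) → C) :
    v = consZero C n (LinearMap.funLeft C C Fin.succ v) + v 0 • Pi.single 0 1 := by
  ext i
  cases i using Fin.cases <;> simp [consZero, LinearMap.funLeft]

lemma contractRight_map_consZero (a : ExteriorAlgebra C (Fin n → C)) :
    contractRight (ExteriorAlgebra.map (consZero C n) a) (LinearMap.proj 0) = 0 := by
  induction a using CliffordAlgebra.right_induction with
  | algebraMap r => rw [AlgHom.commutes]; exact contractRight_algebraMap _ _ r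
  | add x y hx hy => rw [map_add, map_add, LinearMap.add_apply, hx, hy, add_zero]
  | mul_ι m x hx =>
    have h : ExteriorAlgebra.map (consZero C n) (CliffordAlgebra.ι 0 m) =
      CliffordAlgebra.ι 0 (consZero C n m) := ExteriorAlgebra.map_apply_ι _ m
    rw [map_mul, h, contractRight_mul_ι, hx]
    simp [consZero]

lemma contractRight_map_consZero_mul (a : ExteriorAlgebra C (Fin n → C)) :
    contractRight (ExteriorAlgebra.map (consZero C n) a * ExteriorAlgebra.ι C (Pi.single 0 1))
      (LinearMap.proj (R := C) (φ := fun _ => C) 0) = ExteriorAlgebra.map (consZero C n) a := by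
  refine (contractRight_mul_ι _ _ _).trans ?_
  rw [contractRight_map_consZero]
  simp

lemma map_succ_map_consZero (a : ExteriorAlgebra C (Fin n → C)) :
    ExteriorAlgebra.map (LinearMap.funLeft C C Fin.succ)
      (ExteriorAlgebra.map (consZero C n) a) = a := by
  have h : LinearMap.funLeft C C Fin.succ ∘ₗ consZero C n = LinearMap.id := by
    ext i j
    simp [consZero, LinearMap.funLeft]
  rw [← AlgHom.comp_apply, ExteriorAlgebra.map_comp_map, h, ExteriorAlgebra.map_id,
    AlgHom.id_apply]

lemma eq_map_consZero_add (a : ExteriorAlgebra C (Fin (n + 1) → C)) :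
    a = ExteriorAlgebra.map (consZero C n)
        (ExteriorAlgebra.map (LinearMap.funLeft C C Fin.succ) a) +
      ExteriorAlgebra.map (consZero C n) (ExteriorAlgebra.map (LinearMap.funLeft C C Fin.succ)
        (contractRight a (LinearMap.proj 0))) * ExteriorAlgebra.ι C (Pi.single 0 1) := by
  induction a using CliffordAlgebra.right_induction with
  | algebraMap r => simp [contractRight_algebraMap]
  | add x y hx hy =>
    simp only [map_add, LinearMap.add_apply, add_mul]
    conv_lhs => rw [hx, hy]
    abel
  | mul_ι m x hx =>
    change x * ExteriorAlgebra.ι C m = _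
    have h1 : contractRight (x * ExteriorAlgebra.ι C m) (LinearMap.proj (R := C) (φ := fun _ => C) 0)
        = m 0 • x - contractRight x (LinearMap.proj 0) * ExteriorAlgebra.ι C m :=
      contractRight_mul_ι _ _ _
    change x * ExteriorAlgebra.ι C m = ExteriorAlgebra.map _ (ExteriorAlgebra.map _
      (x * ExteriorAlgebra.ι C m)) + ExteriorAlgebra.map _ (ExteriorAlgebra.map _
        (contractRight (x * ExteriorAlgebra.ι C m) _)) * _
    rw [h1]
    set θ : ExteriorAlgebra C (Fin (n + 1) → C) := ExteriorAlgebra.ι C (Pi.single 0 1)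
    set F := ExteriorAlgebra.map (consZero C n)
    set G := ExteriorAlgebra.map (LinearMap.funLeft C C (Fin.succ : Fin n → Fin (n + 1)))
    set y := contractRight x (LinearMap.proj (R := C) (φ := fun _ => C) 0)
    have h2 : ExteriorAlgebra.ι C m = F (G (ExteriorAlgebra.ι C m)) + m 0 • θ := by
      conv_lhs => rw [eq_consZero_add m]
      simp [F, G, θ, ExteriorAlgebra.map_apply_ι]
    have h3 : θ * F (G (ExteriorAlgebra.ι C m)) = -(F (G (ExteriorAlgebra.ι C m)) * θ) := by
      simp only [F, G, θ, ExteriorAlgebra.map_apply_ι]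
      exact eq_neg_of_add_eq_zero_left (ExteriorAlgebra.ι_add_mul_swap _ _)
    have h4 : θ * θ = 0 := ExteriorAlgebra.ι_sq_zero _
    have h5 : x * ExteriorAlgebra.ι C m =
        (F (G x) + F (G y) * θ) * (F (G (ExteriorAlgebra.ι C m)) + m 0 • θ) := by
      rw [← h2, ← hx]
    conv_lhs => rw [h5]
    simp only [map_sub, map_mul, map_smul, sub_mul, mul_add, add_mul, smul_mul_assoc,
      mul_smul_comm, mul_assoc, h3, h4, mul_zero, add_zero, mul_neg]
    abel

variable (k C n) in
/-- The exterior algebra in `n + 1` variables arises from the exterior algebra in `n` variables by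
adjoining one odd variable; the coefficient of this variable is extracted by contraction. -/
def exteriorSucc : OddExtension (exterior k C n) (exterior k C (n + 1)) where
  incl := exteriorMap (consZero C n)
  proj := exteriorMap (LinearMap.funLeft C C Fin.succ)
  coeff := ((ExteriorAlgebra.map (LinearMap.funLeft C C Fin.succ)).toLinearMap ∘ₗ
    (contractRight (Q := (0 : QuadraticForm C (Fin (n + 1) → C)))).flip
      (LinearMap.proj 0)).restrictScalars k
  θ := exteriorι (n + 1) (Pi.single 0 1)
  θ_mem := exteriorι_mem _ _
  proj_incl a := map_succ_map_consZero a
  proj_θ := by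
    refine (ExteriorAlgebra.map_apply_ι _ _).trans ?_
    have : LinearMap.funLeft C C Fin.succ (Pi.single 0 1 : Fin (n + 1) → C) = 0 := by
      ext i
      simp [LinearMap.funLeft]
    rw [this, map_zero]
    rfl
  coeff_incl a :=
    (congrArg (ExteriorAlgebra.map _) (contractRight_map_consZero a)).trans (map_zero _)
  coeff_incl_mul a :=
    (congrArg (ExteriorAlgebra.map _) (contractRight_map_consZero_mul a)).trans
      (map_succ_map_consZero a)
  eq_add a := eq_map_consZero_add a

end

lemma oddIdeal_exterior_zero : (exterior k C 0).oddIdeal = ⊥ := by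
  refine Ideal.span_eq_bot.2 fun a ha => ?_
  change a ∈ CliffordAlgebra.evenOdd _ 1 at ha
  induction a, ha using CliffordAlgebra.odd_induction with
  | ι m => rw [Subsingleton.elim m 0]; exact map_zero _
  | add x y hx hy h h' => rw [h, h']; exact add_zero _
  | ι_mul_ι_mul m m' x hx h => rw [h]; exact mul_zero _

/-- Without odd variables there is nothing to prove; the variables are adjoined one by one. -/
lemma isPoincare_exterior (n : ℕ) : (exterior k C n).IsPoincare := by
  induction n with
  | zero =>
    have h0 := oddIdeal_exterior_zero (k := k) (C := C)
    let A := exterior k C 0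
    have hodd : ∀ a ∈ A.grading 1, a = 0 := fun a ha => by
      have h : a ∈ A.oddIdeal := Ideal.subset_span ha
      rw [h0] at h
      exact h
    have heven : ∀ a : A, a ∈ A.grading 0 := fun a => by
      obtain ⟨x, hx, y, hy, rfl⟩ := A.exists_add a
      rw [hodd y hy, add_zero]
      exact hx
    refine isPoincare_of_retraction
      { toAlgHom := Ideal.Quotient.liftₐ A.oddIdeal (AlgHom.id k A) fun a ha => by
          rw [h0] at ha
          exact ha
        map_mem := fun i a ha => ?_ } ?_
    · rcases zmod_two_eq (i := i) with rfl | rfl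
      · exact heven _
      · rw [eq_zero_of_mem_trivialGrading (B := A ⧸ A.oddIdeal) ha]
        exact (congrArg (· ∈ A.grading 1) (map_zero _)).mpr (Submodule.zero_mem _)
    · ext a
      rfl
  | succ n ih => exact (exteriorSucc k C n).isPoincare ih

end

end SuperAlg

end

noncomputable section

namespace SuperAlg

variable {k : Type u} [Field k]

/-! ### Localization of exterior algebras -/

section

lemma Hom.eq_of_map_mem {A B : SuperAlg k} (f : A ⟶ B) (hf : Function.Injective f.toAlgHom)
    {i : ZMod 2} {a : A} (ha : f.toAlgHom a ∈ B.grading i) : a ∈ A.grading i := by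
  obtain ⟨x, hx, y, hy, rfl⟩ := A.exists_add_of i a
  have h : f.toAlgHom y = 0 := by
    refine B.eq_zero_of_mem_of_mem_add_one (i := i) ?_ (f.map_mem _ y hy)
    rw [map_add] at ha
    simpa using sub_mem ha (f.map_mem _ x hx)
  rw [← map_zero f.toAlgHom] at h
  rw [hf h, add_zero]
  exact hx

/-- A bijective morphism of superalgebras is an isomorphism. -/
def isoOfBijective {A B : SuperAlg k} (f : A ⟶ B) (hf : Function.Bijective f.toAlgHom) :
    A ≅ B where
  hom := f
  inv :=
    { toAlgHom := (AlgEquiv.ofBijective f.toAlgHom hf).symm.toAlgHom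
      map_mem := fun i b hb => by
        refine f.eq_of_map_mem hf.1 ?_
        have h : f.toAlgHom ((AlgEquiv.ofBijective f.toAlgHom hf).symm b) = b :=
          (AlgEquiv.ofBijective f.toAlgHom hf).apply_symm_apply b
        exact h.symm ▸ hb }
  hom_inv_id := by
    ext a
    exact (AlgEquiv.ofBijective f.toAlgHom hf).symm_apply_apply a
  inv_hom_id := by
    ext b
    exact (AlgEquiv.ofBijective f.toAlgHom hf).apply_symm_apply b

variable {B : Type u} [CommRing B]

lemma isNilpotent_sub_of_mem_even {n : ℕ} (x : ExteriorAlgebra B (Fin n → B))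
    (hx : x ∈ CliffordAlgebra.evenOdd (0 : QuadraticForm B (Fin n → B)) 0) :
    IsNilpotent (x - algebraMap B _ (ExteriorAlgebra.algebraMapInv x)) := by
  induction x, hx using CliffordAlgebra.even_induction with
  | algebraMap r =>
    have h : ExteriorAlgebra.algebraMapInv
        (algebraMap B (ExteriorAlgebra B (Fin n → B)) r) = r :=
      ExteriorAlgebra.algebraMap_leftInverse (M := Fin n → B) r
    change IsNilpotent (algebraMap B (ExteriorAlgebra B (Fin n → B)) r - algebraMap B _ _)
    rw [h, sub_self]
    exact IsNilpotent.zero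
  | add x y hx hy h h' =>
    rw [map_add, map_add, add_sub_add_comm]
    refine Commute.isNilpotent_add ?_ h h'
    have hc : Commute x y := commute_of_mem_even B hx y
    exact (hc.sub_right (Algebra.commutes _ _).symm).sub_left (Algebra.commutes _ _)
  | ι_mul_ι_mul m m' x hx h =>
    change IsNilpotent (ExteriorAlgebra.ι B m * ExteriorAlgebra.ι B m' * x - _)
    have h0 : ExteriorAlgebra.algebraMapInv
        (ExteriorAlgebra.ι B m * ExteriorAlgebra.ι B m' * x) = 0 := by
      simp [ExteriorAlgebra.algebraMapInv]
    change IsNilpotent (ExteriorAlgebra.ι B m * ExteriorAlgebra.ι B m' * x -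
      algebraMap B _ (ExteriorAlgebra.algebraMapInv
        (ExteriorAlgebra.ι B m * ExteriorAlgebra.ι B m' * x)))
    rw [h0, map_zero, sub_zero]
    refine (ι_mul_ι_comm B m m' x).isNilpotent_mul_right ⟨2, ?_⟩
    rw [pow_two, ← mul_assoc, (ι_mul_ι_comm B m m' _).eq, ← mul_assoc, ExteriorAlgebra.ι_sq_zero]
    simp

variable [Algebra k B] {n : ℕ} (f : B)

/-- The localization map between exterior algebras. -/
def exteriorLoc (n : ℕ) : ExteriorAlgebra B (Fin n → B) →ₐ[B]
    ExteriorAlgebra (Localization.Away f) (Fin n → Localization.Away f) :=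
  ExteriorAlgebra.lift B
    ⟨(ExteriorAlgebra.ι (Localization.Away f)).restrictScalars B ∘ₗ
      (Algebra.linearMap B (Localization.Away f)).compLeft (Fin n),
      fun _ => ExteriorAlgebra.ι_sq_zero _⟩

lemma exteriorLoc_ι (m : Fin n → B) : exteriorLoc f n (ExteriorAlgebra.ι B m) =
    ExteriorAlgebra.ι (Localization.Away f) fun i => algebraMap B (Localization.Away f) (m i) :=
  ExteriorAlgebra.lift_ι_apply B _ _ m

lemma exists_exteriorLoc_eq
    (z : ExteriorAlgebra (Localization.Away f) (Fin n → Localization.Away f)) :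
    ∃ (N : ℕ) (x : ExteriorAlgebra B (Fin n → B)), exteriorLoc f n x = f ^ N • z := by
  induction z using ExteriorAlgebra.induction with
  | algebraMap c =>
    obtain ⟨⟨b, _, N, rfl⟩, h⟩ := IsLocalization.surj (Submonoid.powers f) c
    have h' : c * algebraMap B _ (f ^ N) = algebraMap B _ b := h
    refine ⟨N, algebraMap B _ b, ?_⟩
    rw [AlgHom.commutes, IsScalarTower.algebraMap_apply B (Localization.Away f), ← h', mul_comm,
      map_mul, ← IsScalarTower.algebraMap_apply, ← Algebra.smul_def]
  | ι m =>
    obtain ⟨⟨_, N, rfl⟩, h⟩ :=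
      IsLocalization.exist_integer_multiples_of_finite (Submonoid.powers f) m
    choose b hb using h
    refine ⟨N, ExteriorAlgebra.ι B b, ?_⟩
    rw [exteriorLoc_ι]
    have : (fun i => algebraMap B (Localization.Away f) (b i)) = f ^ N • m := funext hb
    rw [this]
    exact ((ExteriorAlgebra.ι (Localization.Away f)).restrictScalars B).map_smul _ _
  | mul x y hx hy =>
    obtain ⟨N, a, ha⟩ := hx
    obtain ⟨M, b, hb⟩ := hy
    exact ⟨N + M, a * b, by rw [map_mul, ha, hb, smul_mul_smul_comm, pow_add]⟩
  | add x y hx hy =>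
    obtain ⟨N, a, ha⟩ := hx
    obtain ⟨M, b, hb⟩ := hy
    refine ⟨N + M, f ^ M • a + f ^ N • b, ?_⟩
    rw [map_add, map_smul, map_smul, ha, hb, smul_smul, smul_smul, ← pow_add, ← pow_add, smul_add,
      add_comm M N]

/-- If `D` is obtained from an exterior algebra over `B` by inverting `f ∈ B`, then it is an
exterior algebra over the localization of `B`; hence it satisfies the Poincaré lemma. -/
lemma isPoincare_of_localization {A D : SuperAlg k} (r : A ⟶ D)
    (e : A ≃ₐ[k] ExteriorAlgebra B (Fin n → B))
    (he : ∀ (i : ZMod 2) (a : A), a ∈ A.grading i ↔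
      e a ∈ CliffordAlgebra.evenOdd (0 : QuadraticForm B (Fin n → B)) i)
    (unit : ∃ u ∈ D.grading 0, r.toAlgHom (e.symm (algebraMap B _ f)) * u = 1)
    (surj : ∀ y : D, ∃ (N : ℕ) (a : A),
      r.toAlgHom a = r.toAlgHom (e.symm (algebraMap B _ f)) ^ N * y)
    (inj : ∀ a : A, r.toAlgHom a = 0 → ∃ N : ℕ, e.symm (algebraMap B _ f) ^ N * a = 0) :
    D.IsPoincare := by
  have heven (b : B) : r.toAlgHom (e.symm (algebraMap B _ b)) ∈ D.grading 0 := by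
    refine r.map_mem 0 _ ((he 0 _).2 ?_)
    rw [AlgEquiv.apply_symm_apply]
    exact SetLike.algebraMap_mem_graded (CliffordAlgebra.evenOdd _) b
  have hodd (m : Fin n → B) : r.toAlgHom (e.symm (ExteriorAlgebra.ι B m)) ∈ D.grading 1 := by
    refine r.map_mem 1 _ ((he 1 _).2 ?_)
    rw [AlgEquiv.apply_symm_apply]
    exact CliffordAlgebra.ι_mem_evenOdd_one _ m
  -- the structure of an algebra over the localization on `D`
  let s : B →+* D.evenSubalgebra :=
    ((r.toAlgHom.toRingHom.comp e.symm.toAlgHom.toRingHom).comp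
      (algebraMap B (ExteriorAlgebra B (Fin n → B)))).codRestrict D.evenSubalgebra.toSubring heven
  have hs : IsUnit (s f) := by
    obtain ⟨u, hu, h⟩ := unit
    exact IsUnit.of_mul_eq_one ⟨u, hu⟩ (Subtype.ext h)
  let t : Localization.Away f →+* D.evenSubalgebra := IsLocalization.Away.lift f hs
  have ht (b : B) : (t (algebraMap B _ b) : D) = r.toAlgHom (e.symm (algebraMap B _ b)) :=
    congrArg Subtype.val (IsLocalization.Away.lift_eq f hs b)
  let : Algebra (Localization.Away f) D :=
    (D.evenSubalgebra.val.toRingHom.comp t).toAlgebra' fun c x => D.even_comm _ (t c).2 x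
  have hsmul (c : Localization.Away f) (x : D) : c • x = (t c : D) * x := rfl
  have htower : IsScalarTower k (Localization.Away f) D := by
    refine IsScalarTower.of_algebraMap_eq fun c => ?_
    change _ = (t (algebraMap k _ c) : D)
    rw [IsScalarTower.algebraMap_apply k B (Localization.Away f), ht,
      ← IsScalarTower.algebraMap_apply]
    simp
  let θ (j : Fin n) : D := r.toAlgHom (e.symm (ExteriorAlgebra.ι B (Pi.single j 1)))
  let lin : (Fin n → Localization.Away f) →ₗ[Localization.Away f] D :=
    Fintype.linearCombination (Localization.Away f) θ
  have hlin (v : Fin n → Localization.Away f) : lin v ∈ D.grading 1 := by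
    have h : lin v = ∑ j, v j • θ j := Fintype.linearCombination_apply _ _ _
    rw [h]
    refine sum_mem fun j _ => ?_
    rw [hsmul]
    simpa using SetLike.mul_mem_graded (t (v j)).2 (hodd (Pi.single j 1))
  let ψ₀ : ExteriorAlgebra (Localization.Away f) (Fin n → Localization.Away f)
      →ₐ[Localization.Away f] D :=
    ExteriorAlgebra.lift (Localization.Away f) ⟨lin, fun v => D.odd_sq _ (hlin v)⟩
  have hψι (v) : ψ₀ (ExteriorAlgebra.ι _ v) = lin v := ExteriorAlgebra.lift_ι_apply _ _ _ _
  have hψ₀ (c) : ψ₀ (algebraMap _ _ c) = t c := AlgHom.commutes ψ₀ c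
  let ψ : exterior k (Localization.Away f) n ⟶ D :=
    exteriorHom (ψ₀.restrictScalars k)
      (fun c => by rw [AlgHom.restrictScalars_apply, hψ₀]; exact (t c).2)
      (fun v => by rw [AlgHom.restrictScalars_apply, hψι]; exact hlin v)
  have comm (x : ExteriorAlgebra B (Fin n → B)) :
      ψ₀ (exteriorLoc f n x) = r.toAlgHom (e.symm x) := by
    induction x using ExteriorAlgebra.induction with
    | algebraMap b =>
      rw [AlgHom.commutes, IsScalarTower.algebraMap_apply B (Localization.Away f), hψ₀, ht]
    | ι m =>
      rw [exteriorLoc_ι, hψι]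
      conv_rhs => rw [pi_eq_sum_univ' m]
      simp only [lin, Fintype.linearCombination_apply, map_sum, map_smul, hsmul, ht]
      refine Finset.sum_congr rfl fun j _ => ?_
      rw [Algebra.smul_def, map_mul, map_mul]
    | mul x y hx hy => simp only [map_mul, hx, hy]
    | add x y hx hy => simp only [map_add, hx, hy]
  have hunit (N : ℕ) : IsUnit (r.toAlgHom (e.symm (algebraMap B _ f)) ^ N) := by
    obtain ⟨u, hu, h⟩ := unit
    refine IsUnit.pow N ⟨⟨_, u, h, ?_⟩, rfl⟩
    rw [← D.even_comm _ (heven f), h]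
  refine (isPoincare_exterior (k := k) (C := Localization.Away f) n).of_iso
    (isoOfBijective ψ ⟨?_, ?_⟩)
  · refine (injective_iff_map_eq_zero ψ₀).2 fun z hz => ?_
    obtain ⟨N, x, hx⟩ := exists_exteriorLoc_eq f z
    have h1 : r.toAlgHom (e.symm x) = 0 := by
      rw [← comm, hx, algebra_compatible_smul (Localization.Away f), map_smul, hz, smul_zero]
    obtain ⟨M, hM⟩ := inj _ h1
    have h2 : f ^ M • x = 0 := by
      have := congrArg e hM
      rw [map_mul, map_pow, AlgEquiv.apply_symm_apply, AlgEquiv.apply_symm_apply, map_zero,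
        ← map_pow, ← Algebra.smul_def] at this
      exact this
    have h3 : f ^ (M + N) • z = 0 := by
      rw [pow_add, mul_smul, ← hx, ← map_smul, h2, map_zero]
    rw [algebra_compatible_smul (Localization.Away f), map_pow] at h3
    exact (((IsLocalization.Away.algebraMap_isUnit f).pow _).smul_eq_zero).1 h3
  · intro y
    obtain ⟨N, a, ha⟩ := surj y
    have hN : IsUnit (algebraMap B (Localization.Away f) f ^ N) :=
      (IsLocalization.Away.algebraMap_isUnit f).pow N
    obtain ⟨v, hv⟩ := hN
    refine ⟨(↑v⁻¹ : Localization.Away f) • exteriorLoc f n (e a), ?_⟩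
    have h1 : ψ₀ ((↑v⁻¹ : Localization.Away f) • exteriorLoc f n (e a)) = y := by
      rw [map_smul, comm, AlgEquiv.symm_apply_apply, ha, ← ht, hsmul, ← mul_assoc]
      have : (t (↑v⁻¹ : Localization.Away f) : D) * (t (algebraMap B _ f) : D) ^ N = 1 := by
        have h := congrArg (fun c => (t c : D)) (v.inv_mul)
        simpa [hv] using h
      rw [this, one_mul]
    exact h1

end

end SuperAlg

end

noncomputable section

variable {k : Type u} [Field k]

/-! ### The Poincaré lemma on small open subsets -/

lemma AlgebraicGeometry.Scheme.basicOpen_eq_of_isNilpotent_sub {X : Scheme.{u}} {U : X.Opens}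
    {f g : Γ(X, U)} (h : IsNilpotent (f - g)) : X.basicOpen f = X.basicOpen g := by
  have key {f g : Γ(X, U)} (h : IsNilpotent (f - g)) : X.basicOpen g ≤ X.basicOpen f := by
    intro x hx
    obtain ⟨hxU, hu⟩ := (Scheme.mem_basicOpen'' _ _ _).1 hx
    refine (Scheme.mem_basicOpen'' _ _ _).2 ⟨hxU, ?_⟩
    have h' := h.map (X.presheaf.germ U x hxU).hom
    have := h'.isUnit_add_left_of_commute hu (Commute.all _ _)
    rw [map_sub] at this
    simpa using this
  exact le_antisymm (key (by simpa using h.neg)) (key h)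

namespace Superscheme

variable (X : Superscheme k)

/-- Even functions on a superscheme are functions on the underlying scheme. -/
def evenFun (U : X.evenScheme.Opens) :
    (X.sheaf.sections U).evenSubalgebra ≃+* Γ(X.evenScheme, U) :=
  (X.evenIso.app (op U)).commRingCatIsoToRingEquiv

/-- Restriction of even functions. -/
def evenRes {U V : X.evenScheme.Opens} (h : V ≤ U) :
    (X.sheaf.sections U).evenSubalgebra →+* (X.sheaf.sections V).evenSubalgebra :=
  ((SuperAlg.evenPart k).map (X.sheaf.presheaf.map (homOfLE h).op)).hom

lemma evenFun_res {U V : X.evenScheme.Opens} (h : V ≤ U)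
    (a : (X.sheaf.sections U).evenSubalgebra) :
    X.evenFun V (X.evenRes h a) = X.evenScheme.presheaf.map (homOfLE h).op (X.evenFun U a) :=
  congrArg (fun g => g.hom a) (X.evenIso.hom.naturality (homOfLE h).op)

variable {X} {U : X.evenScheme.Opens}

lemma exists_mul_eq_one_basicOpen (f : (X.sheaf.sections U).evenSubalgebra) :
    ∃ u ∈ (X.sheaf.sections (X.evenScheme.basicOpen (X.evenFun U f))).grading 0,
      X.sheaf.res (X.evenScheme.basicOpen_le (X.evenFun U f)) f * u = 1 := by
  have h : IsUnit (X.evenFun _ (X.evenRes (X.evenScheme.basicOpen_le (X.evenFun U f)) f)) := by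
    rw [evenFun_res]
    exact X.evenScheme.toRingedSpace.isUnit_res_basicOpen (X.evenFun U f)
  rw [MulEquiv.isUnit_map] at h
  obtain ⟨u, hu⟩ := h.exists_right_inv
  exact ⟨u, u.2, congrArg Subtype.val hu⟩

lemma exists_evenRes_eq (hU : IsAffineOpen U) (f : (X.sheaf.sections U).evenSubalgebra)
    (y : (X.sheaf.sections (X.evenScheme.basicOpen (X.evenFun U f))).evenSubalgebra) :
    ∃ (N : ℕ) (a : (X.sheaf.sections U).evenSubalgebra),
      X.evenRes (X.evenScheme.basicOpen_le (X.evenFun U f)) a =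
        y * X.evenRes (X.evenScheme.basicOpen_le (X.evenFun U f)) f ^ N := by
  have := hU.isLocalization_basicOpen (X.evenFun U f)
  obtain ⟨N, c, hc⟩ := IsLocalization.Away.surj (X.evenFun U f) (X.evenFun _ y)
  obtain ⟨b, rfl⟩ := (X.evenFun U).surjective c
  refine ⟨N, b, (X.evenFun _).injective ?_⟩
  refine (X.evenFun_res _ b).trans (hc.symm.trans ?_)
  refine Eq.trans ?_ (map_mul (X.evenFun (X.evenScheme.basicOpen (X.evenFun U f))) y _).symm
  refine congrArg (X.evenFun _ y * ·) ?_
  refine Eq.trans ?_ (map_pow (X.evenFun (X.evenScheme.basicOpen (X.evenFun U f))) _ N).symm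
  exact congrArg (· ^ N) (X.evenFun_res _ f).symm

lemma exists_res_eq (hU : IsAffineOpen U) (f : (X.sheaf.sections U).evenSubalgebra)
    (y : X.sheaf.sections (X.evenScheme.basicOpen (X.evenFun U f))) :
    ∃ (N : ℕ) (a : X.sheaf.sections U),
      X.sheaf.res (X.evenScheme.basicOpen_le (X.evenFun U f)) a =
        X.sheaf.res (X.evenScheme.basicOpen_le (X.evenFun U f)) f ^ N * y := by
  obtain ⟨y₀, hy₀, y₁, hy₁, rfl⟩ := SuperAlg.exists_add _ y
  obtain ⟨N, t, ht, h⟩ := X.odd_surj U hU f y₁ hy₁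
  obtain ⟨M, b, hb⟩ := exists_evenRes_eq hU f ⟨y₀, hy₀⟩
  have h₀ : X.sheaf.res (X.evenScheme.basicOpen_le (X.evenFun U f)) b =
      y₀ * X.sheaf.res (X.evenScheme.basicOpen_le (X.evenFun U f)) f ^ M :=
    congrArg Subtype.val hb
  have h₁ : X.sheaf.res (X.evenScheme.basicOpen_le (X.evenFun U f)) t =
      X.sheaf.res (X.evenScheme.basicOpen_le (X.evenFun U f)) f ^ N * y₁ := h
  refine ⟨M + N, (f : X.sheaf.sections U) ^ N * b + (f : X.sheaf.sections U) ^ M * t, ?_⟩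
  rw [map_add, map_mul, map_mul, map_pow, map_pow, h₀, h₁, SuperAlg.even_comm _ y₀ hy₀,
    ← mul_assoc, ← mul_assoc, ← pow_add, ← pow_add, mul_add, add_comm N M]

lemma exists_pow_mul_eq_zero (hU : IsAffineOpen U) (f : (X.sheaf.sections U).evenSubalgebra)
    (a : X.sheaf.sections U)
    (ha : X.sheaf.res (X.evenScheme.basicOpen_le (X.evenFun U f)) a = 0) :
    ∃ N : ℕ, (f : X.sheaf.sections U) ^ N * a = 0 := by
  obtain ⟨a₀, ha₀, a₁, ha₁, rfl⟩ := SuperAlg.exists_add _ a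
  set r := X.sheaf.presheaf.map (homOfLE (X.evenScheme.basicOpen_le (X.evenFun U f))).op
  have h : r.toAlgHom a₀ = -r.toAlgHom a₁ := by
    rw [map_add] at ha
    exact eq_neg_of_add_eq_zero_left ha
  have h₀ : r.toAlgHom a₀ = 0 :=
    SuperAlg.eq_zero_of_mem_of_mem_add_one _ (r.map_mem 0 _ ha₀)
      (h ▸ neg_mem (r.map_mem 1 _ ha₁))
  have h₁ : r.toAlgHom a₁ = 0 := by rwa [h₀, eq_comm, neg_eq_zero] at h
  obtain ⟨N, hN⟩ := X.odd_inj U hU f a₁ ha₁ h₁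
  have := hU.isLocalization_basicOpen (X.evenFun U f)
  have h₂ : algebraMap Γ(X.evenScheme, U) Γ(X.evenScheme, X.evenScheme.basicOpen (X.evenFun U f))
      (X.evenFun U ⟨a₀, ha₀⟩) = 0 := by
    have h₃ := X.evenFun_res (X.evenScheme.basicOpen_le (X.evenFun U f)) ⟨a₀, ha₀⟩
    have h₄ : X.evenRes (X.evenScheme.basicOpen_le (X.evenFun U f)) ⟨a₀, ha₀⟩ = 0 :=
      Subtype.ext h₀
    rw [h₄, map_zero] at h₃
    exact h₃.symm
  obtain ⟨⟨_, M, rfl⟩, hM⟩ :=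
    (IsLocalization.map_eq_zero_iff (Submonoid.powers (X.evenFun U f)) _ _).1 h₂
  have h₅ : (f : X.sheaf.sections U) ^ M * a₀ = 0 := by
    have : X.evenFun U (f ^ M * ⟨a₀, ha₀⟩) = X.evenFun U 0 := by
      rw [map_mul, map_pow, map_zero]
      exact hM
    exact congrArg Subtype.val ((X.evenFun U).injective this)
  refine ⟨N + M, ?_⟩
  rw [mul_add, pow_add, mul_assoc, h₅, mul_zero, zero_add, (Commute.pow_pow_self _ N M).eq,
    mul_assoc, hN, mul_zero]

/-- On a smooth superscheme, every point has arbitrarily small open neighbourhoods whose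
functions satisfy the relative Poincaré lemma. -/
lemma IsSmooth.exists_isPoincare (hX : X.IsSmooth) {V : X.evenScheme.Opens} {x : X.evenScheme}
    (hx : x ∈ V) : ∃ D : X.evenScheme.Opens, x ∈ D ∧ D ≤ V ∧ (X.sheaf.sections D).IsPoincare := by
  obtain ⟨U, hxU, hU, B, _, _, n, e, _, he⟩ := hX x
  obtain ⟨g, hgV, hxg⟩ := hU.exists_basicOpen_le ⟨x, hx⟩ hxU
  obtain ⟨a, rfl⟩ := (X.evenFun U).surjective g
  -- the part of `a` without nilpotents has the same non-vanishing locus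
  set f : B := ExteriorAlgebra.algebraMapInv (e a)
  have hmem : e.symm (algebraMap B _ f) ∈ (X.sheaf.sections U).grading 0 := by
    rw [he, AlgEquiv.apply_symm_apply]
    exact SetLike.algebraMap_mem_graded (CliffordAlgebra.evenOdd _) f
  let b : (X.sheaf.sections U).evenSubalgebra := ⟨e.symm (algebraMap B _ f), hmem⟩
  have hnil : IsNilpotent (X.evenFun U a - X.evenFun U b) := by
    rw [← map_sub]
    refine IsNilpotent.map ?_ (X.evenFun U)
    obtain ⟨N, hN⟩ := SuperAlg.isNilpotent_sub_of_mem_even (e a) ((he 0 _).1 a.2)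
    refine ⟨N, Subtype.ext (e.injective ?_)⟩
    have h : e ((a : X.sheaf.sections U) - e.symm (algebraMap B _ f)) ^ N = 0 := by
      rw [map_sub, AlgEquiv.apply_symm_apply]
      exact hN
    rw [← map_pow] at h
    exact h.trans (map_zero e).symm
  rw [Scheme.basicOpen_eq_of_isNilpotent_sub hnil] at hgV hxg
  exact ⟨X.evenScheme.basicOpen (X.evenFun U b), hxg, hgV,
    SuperAlg.isPoincare_of_localization f
      (X.sheaf.presheaf.map (homOfLE (X.evenScheme.basicOpen_le (X.evenFun U b))).op) e he
      (exists_mul_eq_one_basicOpen b) (exists_res_eq hU b) (exists_pow_mul_eq_zero hU b)⟩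

end Superscheme

end

noncomputable section

variable {k : Type u} [Field k] {X : TopCat.{u}}

/-! ### Forms and locally bijective maps of sheaves of superalgebras -/

namespace SuperAlg

section

variable (P : (Opens X)ᵒᵖ ⥤ SuperAlg k)

/-- Restriction of sections. -/
abbrev restrict {U V : Opens X} (h : V ≤ U) : P.obj (op U) ⟶ P.obj (op V) := P.map (homOfLE h).op

lemma restrict_comp {U V W : Opens X} (h : V ≤ U) (h' : W ≤ V) :
    restrict P h ≫ restrict P h' = restrict P (h'.trans h) :=
  (P.map_comp _ _).symm

lemma restrict_restrict {U V W : Opens X} (h : V ≤ U) (h' : W ≤ V) (a : P.obj (op U)) :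
    (restrict P h').toAlgHom ((restrict P h).toAlgHom a) =
      (restrict P (h'.trans h)).toAlgHom a :=
  congrArg (fun f => Hom.toAlgHom f a) (restrict_comp P h h')

lemma restrict_naturality {P Q : (Opens X)ᵒᵖ ⥤ SuperAlg k} (φ : P ⟶ Q) {U V : Opens X}
    (h : V ≤ U) (a : P.obj (op U)) :
    (φ.app (op V)).toAlgHom ((restrict P h).toAlgHom a) =
      (restrict Q h).toAlgHom ((φ.app (op U)).toAlgHom a) :=
  congrArg (fun f => Hom.toAlgHom f a) (φ.naturality (homOfLE h).op)

/-- The presheaf of rings of differential forms. -/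
def formsPresheaf : TopCat.Presheaf RingCat.{u} X where
  obj U := RingCat.of (P.obj U).Forms
  map f := RingCat.ofHom (Forms.map (P.map f)).toRingHom
  map_id U := by
    rw [P.map_id, Forms.map_id]
    rfl
  map_comp f g := by
    rw [P.map_comp, Forms.map_comp]
    rfl

/-- Germs of differential forms at a point. -/
abbrev FormsStalk (x : X) : Type u := (formsPresheaf P).stalk x

/-- The germ of a form, as a ring homomorphism. -/
def formsGermRingHom {x : X} (U : Opens X) (hx : x ∈ U) : (P.obj (op U)).Forms →+* FormsStalk P x :=
  ((formsPresheaf P).germ U x hx).hom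

lemma formsGermRingHom_restrict {x : X} {U V : Opens X} (h : V ≤ U) (hx : x ∈ V)
    (ω : (P.obj (op U)).Forms) :
    formsGermRingHom P V hx (Forms.map (restrict P h) ω) = formsGermRingHom P U (h hx) ω :=
  (formsPresheaf P).germ_res_apply (homOfLE h) x hx ω

lemma exists_formsGermRingHom_eq {x : X} (y : FormsStalk P x) :
    ∃ (U : Opens X) (hx : x ∈ U) (ω : (P.obj (op U)).Forms), formsGermRingHom P U hx ω = y :=
  (formsPresheaf P).exists_germ_eq y

instance (x : X) : Algebra k (FormsStalk P x) :=
  ((formsGermRingHom P ⊤ (Opens.mem_top x)).comp (algebraMap k _)).toAlgebra' fun c y => by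
    obtain ⟨U, hx, ω, rfl⟩ := exists_formsGermRingHom_eq P y
    change formsGermRingHom P ⊤ _ (algebraMap k _ c) * formsGermRingHom P U hx ω =
      formsGermRingHom P U hx ω * formsGermRingHom P ⊤ _ (algebraMap k _ c)
    rw [← formsGermRingHom_restrict P le_top hx, AlgHom.commutes, ← map_mul, ← map_mul,
      Algebra.commutes]

/-- The germ of a form, as a homomorphism of algebras. -/
def formsGerm {x : X} (U : Opens X) (hx : x ∈ U) : (P.obj (op U)).Forms →ₐ[k] FormsStalk P x :=
  { formsGermRingHom P U hx with
    commutes' := fun c => by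
      refine Eq.trans ?_ (formsGermRingHom_restrict P le_top hx (algebraMap k _ c))
      rw [AlgHom.commutes]
      rfl }

lemma formsGerm_restrict {x : X} {U V : Opens X} (h : V ≤ U) (hx : x ∈ V)
    (ω : (P.obj (op U)).Forms) :
    formsGerm P V hx (Forms.map (restrict P h) ω) = formsGerm P U (h hx) ω :=
  formsGermRingHom_restrict P h hx ω

lemma exists_restrict_eq_zero_of_formsGerm {x : X} {U : Opens X} (hx : x ∈ U)
    {ω : (P.obj (op U)).Forms} (h : formsGerm P U hx ω = 0) :
    ∃ (V : Opens X) (hV : V ≤ U), x ∈ V ∧ Forms.map (restrict P hV) ω = 0 := by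
  have h' : (formsPresheaf P).germ U x hx ω = (formsPresheaf P).germ U x hx 0 :=
    h.trans (map_zero (formsGermRingHom P U hx)).symm
  obtain ⟨V, hxV, i, j, hij⟩ := (formsPresheaf P).germ_eq x hx hx _ _ h'
  exact ⟨V, leOfHom i, hxV, hij.trans (map_zero (Forms.map (P.map j.op)))⟩

end

/-- A morphism of presheaves of superalgebras is locally bijective if sections lift locally and
sections of the kernel vanish locally. -/
structure IsLocallyBijective {P Q : (Opens X)ᵒᵖ ⥤ SuperAlg k} (φ : P ⟶ Q) : Prop where
  inj : ∀ (U : Opens X) (a : P.obj (op U)), (φ.app (op U)).toAlgHom a = 0 → ∀ x ∈ U,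
    ∃ (V : Opens X) (hV : V ≤ U), x ∈ V ∧ (restrict P hV).toAlgHom a = 0
  surj : ∀ (U : Opens X) (b : Q.obj (op U)), ∀ x ∈ U,
    ∃ (V : Opens X) (hV : V ≤ U) (a : P.obj (op V)), x ∈ V ∧
      (φ.app (op V)).toAlgHom a = (restrict Q hV).toAlgHom b

namespace IsLocallyBijective

variable {P Q : (Opens X)ᵒᵖ ⥤ SuperAlg k} {φ : P ⟶ Q} (hφ : IsLocallyBijective φ)
include hφ

lemma exists_mem {i : ZMod 2} {U : Opens X} {b : Q.obj (op U)} (hb : b ∈ (Q.obj (op U)).grading i)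
    {x : X} (hx : x ∈ U) : ∃ (V : Opens X) (hV : V ≤ U), x ∈ V ∧
      ∃ a ∈ (P.obj (op V)).grading i, (φ.app (op V)).toAlgHom a = (restrict Q hV).toAlgHom b := by
  obtain ⟨V, hV, a, hxV, ha⟩ := hφ.surj U b x hx
  obtain ⟨y, hy, z, hz, rfl⟩ := SuperAlg.exists_add_of _ i a
  refine ⟨V, hV, hxV, y, hy, ?_⟩
  have hz' : (φ.app (op V)).toAlgHom z = 0 := by
    refine SuperAlg.eq_zero_of_mem_of_mem_add_one _ (i := i) ?_ ((φ.app (op V)).map_mem _ z hz)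
    have h : (φ.app (op V)).toAlgHom z =
        (restrict Q hV).toAlgHom b - (φ.app (op V)).toAlgHom y := by
      rw [← ha, map_add, add_sub_cancel_left]
    rw [h]
    exact sub_mem ((restrict Q hV).map_mem _ b hb) ((φ.app (op V)).map_mem _ y hy)
  rw [← ha, map_add, hz', add_zero]

lemma germ_eq {F : ∀ A : SuperAlg k, A →ₗ[k] A.Forms}
    (hF : ∀ {A B : SuperAlg k} (f : A ⟶ B) (a : A), Forms.map f (F A a) = F B (f.toAlgHom a))
    {x : X} {U V W : Opens X} (hV : V ≤ U) (hW : W ≤ U) (hxV : x ∈ V) (hxW : x ∈ W)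
    {b : Q.obj (op U)} {a : P.obj (op V)} {a' : P.obj (op W)}
    (ha : (φ.app (op V)).toAlgHom a = (restrict Q hV).toAlgHom b)
    (ha' : (φ.app (op W)).toAlgHom a' = (restrict Q hW).toAlgHom b) :
    formsGerm P V hxV (F _ a) = formsGerm P W hxW (F _ a') := by
  have h : (φ.app (op (V ⊓ W))).toAlgHom ((restrict P inf_le_left).toAlgHom a -
      (restrict P inf_le_right).toAlgHom a') = 0 := by
    rw [map_sub, restrict_naturality, restrict_naturality, ha, ha', restrict_restrict,
      restrict_restrict, sub_self]
  obtain ⟨T, hT, hxT, h⟩ := hφ.inj _ _ h x ⟨hxV, hxW⟩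
  rw [map_sub, restrict_restrict, restrict_restrict, sub_eq_zero] at h
  rw [← formsGerm_restrict P (hT.trans inf_le_left) hxT,
    ← formsGerm_restrict P (hT.trans inf_le_right) hxT, hF, hF, h]

/-- The germ of the form obtained by lifting a section to the source of a locally bijective
morphism and applying `F`, which will be `Forms.ofFun` or `Forms.ofDiff`. -/
def liftGerm (F : ∀ A : SuperAlg k, A →ₗ[k] A.Forms) {x : X} {U : Opens X} (hx : x ∈ U)
    (b : Q.obj (op U)) : FormsStalk P x :=
  formsGerm P (hφ.surj U b x hx).choose (hφ.surj U b x hx).choose_spec.choose_spec.choose_spec.1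
    (F _ (hφ.surj U b x hx).choose_spec.choose_spec.choose)

lemma liftGerm_eq {F : ∀ A : SuperAlg k, A →ₗ[k] A.Forms}
    (hF : ∀ {A B : SuperAlg k} (f : A ⟶ B) (a : A), Forms.map f (F A a) = F B (f.toAlgHom a))
    {x : X} {U V : Opens X} (hV : V ≤ U) (hxV : x ∈ V) {b : Q.obj (op U)} {a : P.obj (op V)}
    (ha : (φ.app (op V)).toAlgHom a = (restrict Q hV).toAlgHom b) :
    hφ.liftGerm F (hV hxV) b = formsGerm P V hxV (F _ a) :=
  hφ.germ_eq hF (hφ.surj U b x (hV hxV)).choose_spec.choose hV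
    (hφ.surj U b x (hV hxV)).choose_spec.choose_spec.choose_spec.1 hxV
    (hφ.surj U b x (hV hxV)).choose_spec.choose_spec.choose_spec.2 ha

lemma liftGerm_ofFun {x : X} {U V : Opens X} (hV : V ≤ U) (hxV : x ∈ V) {b : Q.obj (op U)}
    {a : P.obj (op V)} (ha : (φ.app (op V)).toAlgHom a = (restrict Q hV).toAlgHom b) :
    hφ.liftGerm (fun A => (Forms.ofFun A).toLinearMap) (hV hxV) b =
      formsGerm P V hxV (Forms.ofFun _ a) :=
  hφ.liftGerm_eq (fun f a => Forms.map_ofFun f a) hV hxV ha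

lemma liftGerm_ofDiff {x : X} {U V : Opens X} (hV : V ≤ U) (hxV : x ∈ V) {b : Q.obj (op U)}
    {a : P.obj (op V)} (ha : (φ.app (op V)).toAlgHom a = (restrict Q hV).toAlgHom b) :
    hφ.liftGerm Forms.ofDiff (hV hxV) b = formsGerm P V hxV (Forms.ofDiff _ a) :=
  hφ.liftGerm_eq (fun f a => Forms.map_ofDiff f a) hV hxV ha

lemma exists_pair {i j : ZMod 2} {U : Opens X} {b c : Q.obj (op U)}
    (hb : b ∈ (Q.obj (op U)).grading i) (hc : c ∈ (Q.obj (op U)).grading j)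
    {x : X} (hx : x ∈ U) : ∃ (V : Opens X) (hV : V ≤ U), x ∈ V ∧
      (∃ a ∈ (P.obj (op V)).grading i, (φ.app (op V)).toAlgHom a = (restrict Q hV).toAlgHom b) ∧
      ∃ a ∈ (P.obj (op V)).grading j, (φ.app (op V)).toAlgHom a = (restrict Q hV).toAlgHom c := by
  obtain ⟨V, hV, hxV, a, ha, hab⟩ := hφ.exists_mem hb hx
  obtain ⟨W, hW, hxW, a', ha', hab'⟩ := hφ.exists_mem hc hx
  refine ⟨V ⊓ W, inf_le_left.trans hV, ⟨hxV, hxW⟩,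
    ⟨(restrict P inf_le_left).toAlgHom a, Hom.map_mem _ _ _ ha, ?_⟩,
    ⟨(restrict P inf_le_right).toAlgHom a', Hom.map_mem _ _ _ ha', ?_⟩⟩
  · rw [restrict_naturality, hab, restrict_restrict]
  · rw [restrict_naturality, hab', restrict_restrict]

lemma exists_pair' {U : Opens X} (b c : Q.obj (op U)) {x : X} (hx : x ∈ U) :
    ∃ (V : Opens X) (hV : V ≤ U), x ∈ V ∧
      (∃ a, (φ.app (op V)).toAlgHom a = (restrict Q hV).toAlgHom b) ∧
      ∃ a, (φ.app (op V)).toAlgHom a = (restrict Q hV).toAlgHom c := by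
  obtain ⟨V, hV, a, hxV, hab⟩ := hφ.surj U b x hx
  obtain ⟨W, hW, a', hxW, hab'⟩ := hφ.surj U c x hx
  refine ⟨V ⊓ W, inf_le_left.trans hV, ⟨hxV, hxW⟩,
    ⟨(restrict P inf_le_left).toAlgHom a, ?_⟩,
    ⟨(restrict P inf_le_right).toAlgHom a', ?_⟩⟩
  · rw [restrict_naturality, hab, restrict_restrict]
  · rw [restrict_naturality, hab', restrict_restrict]

/-- The homomorphism sending a function to the germ of a local lift. -/
def funGerm {x : X} {U : Opens X} (hx : x ∈ U) : Q.obj (op U) →ₐ[k] FormsStalk P x where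
  toFun := hφ.liftGerm (fun A => (Forms.ofFun A).toLinearMap) hx
  map_one' := by
    rw [hφ.liftGerm_ofFun le_rfl hx (a := 1) (by simp), map_one, map_one]
  map_mul' b c := by
    obtain ⟨V, hV, hxV, ⟨a, ha⟩, ⟨a', ha'⟩⟩ := hφ.exists_pair' b c hx
    rw [hφ.liftGerm_ofFun hV hxV ha, hφ.liftGerm_ofFun hV hxV ha',
      hφ.liftGerm_ofFun hV hxV (a := a * a') (by rw [map_mul, map_mul, ha, ha']),
      map_mul, map_mul]
  map_zero' := by
    rw [hφ.liftGerm_ofFun le_rfl hx (a := 0) (by simp), map_zero, map_zero]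
  map_add' b c := by
    obtain ⟨V, hV, hxV, ⟨a, ha⟩, ⟨a', ha'⟩⟩ := hφ.exists_pair' b c hx
    rw [hφ.liftGerm_ofFun hV hxV ha, hφ.liftGerm_ofFun hV hxV ha',
      hφ.liftGerm_ofFun hV hxV (a := a + a') (by rw [map_add, map_add, ha, ha']),
      map_add, map_add]
  commutes' c := by
    rw [hφ.liftGerm_ofFun le_rfl hx (a := algebraMap k _ c) (by simp), AlgHom.commutes,
      AlgHom.commutes]

/-- The derivation sending a function to the germ of the differential of a local lift. -/
def diffGerm {x : X} {U : Opens X} (hx : x ∈ U) : Q.obj (op U) →ₗ[k] FormsStalk P x where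
  toFun := hφ.liftGerm Forms.ofDiff hx
  map_add' b c := by
    obtain ⟨V, hV, hxV, ⟨a, ha⟩, ⟨a', ha'⟩⟩ := hφ.exists_pair' b c hx
    rw [hφ.liftGerm_ofDiff hV hxV ha, hφ.liftGerm_ofDiff hV hxV ha',
      hφ.liftGerm_ofDiff hV hxV (a := a + a') (by rw [map_add, map_add, ha, ha']),
      map_add, map_add]
  map_smul' c b := by
    obtain ⟨V, hV, a, hxV, ha⟩ := hφ.surj U b x hx
    rw [hφ.liftGerm_ofDiff hV hxV ha,
      hφ.liftGerm_ofDiff hV hxV (a := c • a) (by rw [map_smul, map_smul, ha]),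
      map_smul, map_smul, RingHom.id_apply]

lemma funGerm_eq {x : X} {U V : Opens X} (hV : V ≤ U) (hxV : x ∈ V) {b : Q.obj (op U)}
    {a : P.obj (op V)} (ha : (φ.app (op V)).toAlgHom a = (restrict Q hV).toAlgHom b) :
    hφ.funGerm (hV hxV) b = formsGerm P V hxV (Forms.ofFun _ a) :=
  hφ.liftGerm_ofFun hV hxV ha

lemma diffGerm_eq {x : X} {U V : Opens X} (hV : V ≤ U) (hxV : x ∈ V) {b : Q.obj (op U)}
    {a : P.obj (op V)} (ha : (φ.app (op V)).toAlgHom a = (restrict Q hV).toAlgHom b) :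
    hφ.diffGerm (hV hxV) b = formsGerm P V hxV (Forms.ofDiff _ a) :=
  hφ.liftGerm_ofDiff hV hxV ha

/-- Forms on the target of a locally bijective morphism have germs on the source. -/
def formsToStalk {x : X} {U : Opens X} (hx : x ∈ U) :
    (Q.obj (op U)).Forms →ₐ[k] FormsStalk P x :=
  Forms.desc _ (hφ.funGerm hx) (hφ.diffGerm hx)
    (by
      rw [hφ.diffGerm_eq le_rfl hx (a := 1) (by simp), Forms.ofDiff_one, map_zero])
    (fun b c => by
      obtain ⟨V, hV, hxV, ⟨a, ha⟩, ⟨a', ha'⟩⟩ := hφ.exists_pair' b c hx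
      rw [hφ.funGerm_eq hV hxV ha, hφ.funGerm_eq hV hxV ha', hφ.diffGerm_eq hV hxV ha,
        hφ.diffGerm_eq hV hxV ha',
        hφ.diffGerm_eq hV hxV (a := a * a') (by rw [map_mul, map_mul, ha, ha']),
        Forms.ofDiff_mul, map_add, map_mul, map_mul])
    (fun i j b c hb hc => by
      obtain ⟨V, hV, hxV, ⟨a, ha, hab⟩, ⟨a', ha', hac⟩⟩ := hφ.exists_pair hb hc hx
      rw [hφ.funGerm_eq hV hxV hac, hφ.diffGerm_eq hV hxV hab, ← map_mul,
        Forms.ofDiff_mul_ofFun _ ha ha']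
      simp)
    (fun i j b c hb hc => by
      obtain ⟨V, hV, hxV, ⟨a, ha, hab⟩, ⟨a', ha', hac⟩⟩ := hφ.exists_pair hb hc hx
      rw [hφ.diffGerm_eq hV hxV hab, hφ.diffGerm_eq hV hxV hac, ← map_mul,
        Forms.ofDiff_mul_ofDiff _ ha ha']
      simp)
    (fun b hb => by
      obtain ⟨V, hV, hxV, a, ha, hab⟩ := hφ.exists_mem hb hx
      rw [hφ.diffGerm_eq hV hxV hab, ← map_mul, Forms.ofDiff_sq _ ha, map_zero])

lemma formsToStalk_map {x : X} {U : Opens X} (hx : x ∈ U) (ω : (P.obj (op U)).Forms) :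
    hφ.formsToStalk hx (Forms.map (φ.app (op U)) ω) = formsGerm P U hx ω := by
  have hr (a : P.obj (op U)) : (φ.app (op U)).toAlgHom a =
      (restrict Q (le_refl U)).toAlgHom ((φ.app (op U)).toAlgHom a) :=
    (congrArg (fun f => Hom.toAlgHom f _) (Q.map_id (op U))).symm
  have h : (hφ.formsToStalk hx).comp (Forms.map (φ.app (op U))) = formsGerm P U hx := by
    refine Forms.hom_ext (fun a => ?_) (fun a => ?_)
    · rw [AlgHom.comp_apply, Forms.map_ofFun, formsToStalk, Forms.desc_ofFun]
      exact hφ.funGerm_eq le_rfl hx (hr a)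
    · rw [AlgHom.comp_apply, Forms.map_ofDiff, formsToStalk, Forms.desc_ofDiff]
      exact hφ.diffGerm_eq le_rfl hx (hr a)
  exact DFunLike.congr_fun h ω

/-- A locally bijective morphism induces a locally injective map on forms. -/
lemma exists_restrict_eq_zero {x : X} {U : Opens X} (hx : x ∈ U) {ω : (P.obj (op U)).Forms}
    (hω : Forms.map (φ.app (op U)) ω = 0) :
    ∃ (V : Opens X) (hV : V ≤ U), x ∈ V ∧ Forms.map (restrict P hV) ω = 0 := by
  refine exists_restrict_eq_zero_of_formsGerm P hx ?_
  rw [← hφ.formsToStalk_map hx ω, hω, map_zero]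

end IsLocallyBijective

/-- The purely even quotient, as a functor. -/
def quotFunctor (k : Type u) [Field k] : SuperAlg k ⥤ SuperAlg k where
  obj := quot
  map := quotMap
  map_id A := by
    ext a
    obtain ⟨a, rfl⟩ := toQuot_surjective A a
    rfl
  map_comp f g := by
    ext a
    obtain ⟨a, rfl⟩ := toQuot_surjective _ a
    rfl

end SuperAlg

namespace SuperSheaf

variable (O : SuperSheaf k X)

/-- The sheafification map from the purely even quotients to the bosonization. -/
def quotToBoson : O.presheaf ⋙ SuperAlg.quotFunctor k ⟶ O.boson.presheaf where
  app U := SuperAlg.ofCommMap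
    { (O.toBosonSheaf.app U).hom with commutes' := fun _ => rfl }
  naturality U V f := by
    ext a
    exact congrArg (fun g => g.hom a) (O.toBosonSheaf.naturality f)

lemma quotToBoson_isLocallyBijective : SuperAlg.IsLocallyBijective O.quotToBoson where
  inj U a ha x hx := by
    have : Presheaf.IsLocallyInjective (Opens.grothendieckTopology X) O.toBosonSheaf :=
      inferInstanceAs (Presheaf.IsLocallyInjective (Opens.grothendieckTopology X)
        (toSheafify (Opens.grothendieckTopology X) (O.presheaf ⋙ SuperAlg.modOdd k)))
    have h := Presheaf.equalizerSieve_mem (Opens.grothendieckTopology X) O.toBosonSheaf a 0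
      (ha.trans (map_zero (O.toBosonSheaf.app (op U)).hom).symm)
    obtain ⟨V, f, hf, hxV⟩ := h x hx
    exact ⟨V, leOfHom f, hxV, hf.trans (map_zero _)⟩
  surj U b x hx := by
    have : Presheaf.IsLocallySurjective (Opens.grothendieckTopology X) O.toBosonSheaf :=
      inferInstanceAs (Presheaf.IsLocallySurjective (Opens.grothendieckTopology X)
        (toSheafify (Opens.grothendieckTopology X) (O.presheaf ⋙ SuperAlg.modOdd k)))
    have h := Presheaf.imageSieve_mem (Opens.grothendieckTopology X) O.toBosonSheaf (U := op U) b
    obtain ⟨V, f, ⟨a, ha⟩, hxV⟩ := h x hx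
    exact ⟨V, leOfHom f, a, hxV, ha⟩

/-- A form on a superspace whose restriction to the bosonization vanishes is locally zero modulo
odd functions. -/
lemma exists_map_toQuot_eq_zero {U : Opens X} {x : X} (hx : x ∈ U) {ω : (O.sections U).Forms}
    (hω : SuperAlg.Forms.map (O.toBoson.app (op U)) ω = 0) :
    ∃ (V : Opens X) (hV : V ≤ U), x ∈ V ∧ SuperAlg.Forms.map (O.sections V).toQuot
      (SuperAlg.Forms.map (SuperAlg.restrict O.presheaf hV) ω) = 0 := by
  have hω' : SuperAlg.Forms.map (O.quotToBoson.app (op U))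
      (SuperAlg.Forms.map (O.sections U).toQuot ω) = 0 :=
    (SuperAlg.Forms.map_map _ _ ω).trans hω
  obtain ⟨V, hV, hxV, h⟩ := O.quotToBoson_isLocallyBijective.exists_restrict_eq_zero hx hω'
  refine ⟨V, hV, hxV, ?_⟩
  rw [SuperAlg.Forms.map_map, ← SuperAlg.toQuot_quotMap, ← SuperAlg.Forms.map_map]
  exact h

/-- Functions on the bosonization lift locally to functions on the superspace. -/
lemma exists_toBoson_eq {U : Opens X} (b : O.boson.sections U) {x : X} (hx : x ∈ U) :
    ∃ (V : Opens X) (hV : V ≤ U) (a : O.sections V), x ∈ V ∧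
      (O.toBoson.app (op V)).toAlgHom a =
        (SuperAlg.restrict O.boson.presheaf hV).toAlgHom b := by
  obtain ⟨V, hV, a, hxV, ha⟩ := O.quotToBoson_isLocallyBijective.surj U b x hx
  obtain ⟨a, rfl⟩ := SuperAlg.toQuot_surjective (O.sections V) a
  exact ⟨V, hV, a, hxV, ha⟩

/-- Forms on the bosonization lift locally to forms on the superspace. -/
lemma exists_map_toBoson_eq {U : Opens X} (p : ℕ) {ω : (O.boson.sections U).Forms}
    (hω : ω ∈ (O.boson.sections U).formsDeg p) {x : X} (hx : x ∈ U) :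
    ∃ (V : Opens X) (hV : V ≤ U), x ∈ V ∧ ∃ η ∈ (O.sections V).formsDeg p,
      SuperAlg.Forms.map (O.toBoson.app (op V)) η =
        SuperAlg.Forms.map (SuperAlg.restrict O.boson.presheaf hV) ω := by
  -- it suffices to lift forms without regard to degrees
  suffices h : ∀ ω : (O.boson.sections U).Forms, ∃ (V : Opens X) (hV : V ≤ U), x ∈ V ∧
      ∃ η, SuperAlg.Forms.map (O.toBoson.app (op V)) η =
        SuperAlg.Forms.map (SuperAlg.restrict O.boson.presheaf hV) ω by
    obtain ⟨V, hV, hxV, η, hη⟩ := h ω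
    refine ⟨V, hV, hxV, SuperAlg.Forms.degProj _ p η, SuperAlg.Forms.degProj_mem _ p η, ?_⟩
    rw [SuperAlg.Forms.map_degProj, hη, ← SuperAlg.Forms.map_degProj,
      SuperAlg.Forms.degProj_of_mem hω]
  -- lifts over different neighbourhoods restrict to their intersection
  have hres {V W : Opens X} (hV : V ≤ U) (hW : W ≤ V) {ω : (O.boson.sections U).Forms}
      {η : (O.sections V).Forms} (h : SuperAlg.Forms.map (O.toBoson.app (op V)) η =
        SuperAlg.Forms.map (SuperAlg.restrict O.boson.presheaf hV) ω) :
      SuperAlg.Forms.map (O.toBoson.app (op W))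
        (SuperAlg.Forms.map (SuperAlg.restrict O.presheaf hW) η) =
        SuperAlg.Forms.map (SuperAlg.restrict O.boson.presheaf (hW.trans hV)) ω := by
    rw [SuperAlg.Forms.map_map, O.toBoson.naturality, ← SuperAlg.Forms.map_map, h,
      SuperAlg.Forms.map_map]
    exact congrArg (fun f => SuperAlg.Forms.map f ω)
      (SuperAlg.restrict_comp O.boson.presheaf hV hW)
  intro ω
  induction ω using SuperAlg.Forms.induction_left with
  | one => exact ⟨U, le_rfl, hx, 1, by simp⟩
  | add y z hy hz =>
    obtain ⟨V, hV, hxV, η, hη⟩ := hy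
    obtain ⟨W, hW, hxW, θ, hθ⟩ := hz
    refine ⟨V ⊓ W, inf_le_left.trans hV, ⟨hxV, hxW⟩,
      SuperAlg.Forms.map (SuperAlg.restrict O.presheaf inf_le_left) η +
        SuperAlg.Forms.map (SuperAlg.restrict O.presheaf inf_le_right) θ, ?_⟩
    rw [map_add, map_add, hres hV inf_le_left hη, hres hW inf_le_right hθ]
  | smul c y hy =>
    obtain ⟨V, hV, hxV, η, hη⟩ := hy
    exact ⟨V, hV, hxV, c • η, by rw [map_smul, map_smul, hη]⟩
  | ofFun_mul b y hy =>
    obtain ⟨V, hV, hxV, η, hη⟩ := hy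
    obtain ⟨W, hW, a, hxW, ha⟩ := O.exists_toBoson_eq b hx
    have ha' : SuperAlg.Forms.map (O.toBoson.app (op W)) (SuperAlg.Forms.ofFun _ a) =
        SuperAlg.Forms.map (SuperAlg.restrict O.boson.presheaf hW)
          (SuperAlg.Forms.ofFun _ b) := by
      rw [SuperAlg.Forms.map_ofFun, SuperAlg.Forms.map_ofFun, ha]
    refine ⟨V ⊓ W, inf_le_left.trans hV, ⟨hxV, hxW⟩,
      SuperAlg.Forms.map (SuperAlg.restrict O.presheaf inf_le_right) (SuperAlg.Forms.ofFun _ a) *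
        SuperAlg.Forms.map (SuperAlg.restrict O.presheaf inf_le_left) η, ?_⟩
    rw [map_mul, map_mul, hres hW inf_le_right ha', hres hV inf_le_left hη]
  | ofDiff_mul b y hy =>
    obtain ⟨V, hV, hxV, η, hη⟩ := hy
    obtain ⟨W, hW, a, hxW, ha⟩ := O.exists_toBoson_eq b hx
    have ha' : SuperAlg.Forms.map (O.toBoson.app (op W)) (SuperAlg.Forms.ofDiff _ a) =
        SuperAlg.Forms.map (SuperAlg.restrict O.boson.presheaf hW)
          (SuperAlg.Forms.ofDiff _ b) := by
      rw [SuperAlg.Forms.map_ofDiff, SuperAlg.Forms.map_ofDiff, ha]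
    refine ⟨V ⊓ W, inf_le_left.trans hV, ⟨hxV, hxW⟩,
      SuperAlg.Forms.map (SuperAlg.restrict O.presheaf inf_le_right) (SuperAlg.Forms.ofDiff _ a) *
        SuperAlg.Forms.map (SuperAlg.restrict O.presheaf inf_le_left) η, ?_⟩
    rw [map_mul, map_mul, hres hW inf_le_right ha', hres hV inf_le_left hη]

end SuperSheaf

end

noncomputable section

/-! ### Local exactness and sheafification -/

section

variable {k : Type u} [Field k] {X : TopCat.{u}}

/-- Local surjectivity of a map of presheaves, tested at points. -/
lemma isLocallySurjective_of_forall {F G : (Opens X)ᵒᵖ ⥤ ModuleCat.{u} k} (f : F ⟶ G)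
    (h : ∀ (U : Opens X) (s : G.obj (op U)), ∀ x ∈ U, ∃ (V : Opens X) (hV : V ≤ U), x ∈ V ∧
      ∃ t : F.obj (op V), (f.app (op V)).hom t = (G.map (homOfLE hV).op).hom s) :
    Presheaf.IsLocallySurjective (Opens.grothendieckTopology X) f where
  imageSieve_mem {U} s x hx := by
    obtain ⟨V, hV, hxV, t, ht⟩ := h U s x hx
    exact ⟨V, homOfLE hV, ⟨t, ht⟩, hxV⟩

lemma epi_presheafToSheaf_map {F G : (Opens X)ᵒᵖ ⥤ ModuleCat.{u} k} (f : F ⟶ G)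
    (h : ∀ (U : Opens X) (s : G.obj (op U)), ∀ x ∈ U, ∃ (V : Opens X) (hV : V ≤ U), x ∈ V ∧
      ∃ t : F.obj (op V), (f.app (op V)).hom t = (G.map (homOfLE hV).op).hom s) :
    Epi ((presheafToSheaf (Opens.grothendieckTopology X) (ModuleCat.{u} k)).map f) := by
  have := isLocallySurjective_of_forall f h
  have := (Presheaf.isLocallySurjective_presheafToSheaf_map_iff
    (Opens.grothendieckTopology X) f).2 this
  exact Sheaf.epi_of_isLocallySurjective _

/-- A short complex of presheaves in which cycles are locally boundaries has an exact
sheafification. -/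
lemma exact_map_presheafToSheaf (S : ShortComplex ((Opens X)ᵒᵖ ⥤ ModuleCat.{u} k))
    (h : ∀ (U : Opens X) (s : S.X₂.obj (op U)), (S.g.app (op U)).hom s = 0 → ∀ x ∈ U,
      ∃ (V : Opens X) (hV : V ≤ U), x ∈ V ∧
        ∃ t : S.X₁.obj (op V), (S.f.app (op V)).hom t = (S.X₂.map (homOfLE hV).op).hom s) :
    (S.map (presheafToSheaf (Opens.grothendieckTopology X) (ModuleCat.{u} k))).Exact := by
  let a := presheafToSheaf (Opens.grothendieckTopology X) (ModuleCat.{u} k)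
  let d := S.leftHomologyData
  -- sheafification preserves cycles, so it suffices to lift cycles locally
  rw [(d.map a).exact_iff_epi_f', d.map_f']
  refine epi_presheafToSheaf_map _ fun U s x hx => ?_
  have hs : (S.g.app (op U)).hom ((d.i.app (op U)).hom s) = 0 := by
    have := congrArg (fun f => (f.app (op U)).hom s) d.wi
    exact this
  obtain ⟨V, hV, hxV, t, ht⟩ := h U _ hs x hx
  refine ⟨V, hV, hxV, t, ?_⟩
  have hi : Function.Injective (d.i.app (op V)).hom :=
    (ModuleCat.mono_iff_injective _).1 inferInstance
  apply hi
  have h₁ : (d.i.app (op V)).hom ((d.f'.app (op V)).hom t) = (S.f.app (op V)).hom t :=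
    congrArg (fun f => (f.app (op V)).hom t) d.f'_i
  have h₂ : (d.i.app (op V)).hom ((d.K.map (homOfLE hV).op).hom s) =
      (S.X₂.map (homOfLE hV).op).hom ((d.i.app (op U)).hom s) :=
    congrArg (fun f => f.hom s) (d.i.naturality (homOfLE hV).op)
  rw [h₁, h₂, ht]

/-- A complex of presheaves in which cycles are locally boundaries has an acyclic
sheafification. -/
lemma acyclic_mapHomologicalComplex_presheafToSheaf
    (K : CochainComplex ((Opens X)ᵒᵖ ⥤ ModuleCat.{u} k) ℕ)
    (h₀ : ∀ (U : Opens X) (s : (K.X 0).obj (op U)), ((K.d 0 1).app (op U)).hom s = 0 → ∀ x ∈ U,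
      ∃ (V : Opens X) (hV : V ≤ U), x ∈ V ∧ ((K.X 0).map (homOfLE hV).op).hom s = 0)
    (h : ∀ (p : ℕ) (U : Opens X) (s : (K.X (p + 1)).obj (op U)),
      ((K.d (p + 1) (p + 2)).app (op U)).hom s = 0 → ∀ x ∈ U,
      ∃ (V : Opens X) (hV : V ≤ U), x ∈ V ∧ ∃ t : (K.X p).obj (op V),
        ((K.d p (p + 1)).app (op V)).hom t = ((K.X (p + 1)).map (homOfLE hV).op).hom s) :
    (((presheafToSheaf (Opens.grothendieckTopology X) (ModuleCat.{u} k)).mapHomologicalComplex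
      _).obj K).Acyclic := by
  intro p
  obtain _ | p := p
  · rw [HomologicalComplex.exactAt_iff' _ 0 0 1 (by simp) (by simp)]
    refine exact_map_presheafToSheaf (K.sc' 0 0 1) fun U s hs x hx => ?_
    obtain ⟨V, hV, hxV, e⟩ := h₀ U s hs x hx
    exact ⟨V, hV, hxV, 0, (map_zero _).trans e.symm⟩
  · rw [HomologicalComplex.exactAt_iff' _ p (p + 1) (p + 2) (by simp) (by simp)]
    exact exact_map_presheafToSheaf (K.sc' p (p + 1) (p + 2)) (h p)

end

/-! ### Kernels, quasi-isomorphisms and hypercohomology -/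

/-- An epimorphism of complexes with acyclic kernel is a quasi-isomorphism. -/
lemma quasiIso_of_epi_of_acyclic_kernel {C ι : Type*} [Category* C] [Abelian C]
    {c : ComplexShape ι} {K L : HomologicalComplex C c} (f : K ⟶ L) [Epi f]
    (h : (Limits.kernel f).Acyclic) : QuasiIso f where
  quasiIsoAt i := by
    have hS : (ShortComplex.mk (Limits.kernel.ι f) f (Limits.kernel.condition f)).ShortExact :=
      { exact := ShortComplex.exact_kernel f }
    rw [quasiIsoAt_iff_isIso_homologyMap]
    have : Mono (HomologicalComplex.homologyMap f i) :=
      (hS.homology_exact₂ i).mono_g (((h i).isZero_homology).eq_of_src _ _)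
    have : Epi (HomologicalComplex.homologyMap f i) := by
      by_cases hi : ∃ j, c.Rel i j
      · obtain ⟨j, hij⟩ := hi
        exact (hS.homology_exact₃ i j hij).epi_f (((h j).isZero_homology).eq_of_tgt _ _)
      · exact HomologicalComplex.epi_homologyMap_of_epi_of_not_rel f i (by simpa using hi)
    exact isIso_of_mono_of_epi _

section

attribute [local instance] HasDerivedCategory.standard

/-- Hypercohomology inverts quasi-isomorphisms. -/
lemma isIso_hypercohomology_map {k : Type u} [Field k] {X : TopCat.{u}}
    {K L : CochainComplex (VectSheaf k X) ℕ} (f : K ⟶ L) [QuasiIso f] (n : ℤ) :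
    IsIso ((hypercohomology k X n).map f) := by
  have h : HomologicalComplex.quasiIso (VectSheaf k X) _
      (HomologicalComplex.extendMap f ComplexShape.embeddingUpNat) :=
    (HomologicalComplex.quasiIso_extendMap_iff f _).2 inferInstance
  let F : CochainComplex (VectSheaf k X) ℕ ⥤ CochainComplex.Plus (VectSheaf k X) :=
    (CochainComplex.plus (VectSheaf k X)).lift
      (ComplexShape.embeddingUpNat.extendFunctor (VectSheaf k X)) (fun K => ⟨0, by
        refine CochainComplex.isStrictlyGE_iff _ _ |>.2 fun i hi => ?_
        exact K.isZero_extend_X _ _ fun j hj => by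
          simp only [ComplexShape.embeddingUpNat_f] at hj
          lia⟩)
  have h' : HomotopyCategory.Plus.quasiIso (VectSheaf k X)
      ((HomotopyCategory.Plus.quotient _).map (F.map f)) :=
    (HomotopyCategory.quotient_map_mem_quasiIso_iff _).2 h
  have h'' : IsIso (DerivedCategory.Plus.Qh.map
      ((HomotopyCategory.Plus.quotient _).map (F.map f))) :=
    Localization.inverts DerivedCategory.Plus.Qh
      (HomotopyCategory.Plus.quasiIso (VectSheaf k X)) _ h'
  exact inferInstanceAs (IsIso ((DerivedCategory.Plus.homologyFunctor _ n).map
    ((globalSections k X).rightDerivedFunctorPlus.map (DerivedCategory.Plus.Qh.map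
      ((HomotopyCategory.Plus.quotient _).map (F.map f))))))

end

/-! ### The kernel of the restriction to the bosonization -/

namespace Superscheme

variable {k : Type u} [Field k] {X : Superscheme k}

open SuperAlg in
/-- Near a point of a smooth superscheme, a form killed by restriction to the bosonization is
killed by restriction to the quotient by the odd functions of an open set with the Poincaré
property. -/
lemma IsSmooth.exists_isPoincare_map_toQuot_eq_zero (hX : X.IsSmooth) {U : X.evenScheme.Opens}
    {x : X.evenScheme} (hx : x ∈ U) {ω : (X.sheaf.sections U).Forms}
    (hω : Forms.map (X.sheaf.toBoson.app (op U)) ω = 0) :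
    ∃ (V : X.evenScheme.Opens) (hV : V ≤ U), x ∈ V ∧ (X.sheaf.sections V).IsPoincare ∧
      Forms.map (X.sheaf.sections V).toQuot
        (Forms.map (restrict X.sheaf.presheaf hV) ω) = 0 := by
  obtain ⟨W, hW, hxW, h⟩ := X.sheaf.exists_map_toQuot_eq_zero hx hω
  obtain ⟨V, hxV, hV, hP⟩ := hX.exists_isPoincare hxW
  refine ⟨V, hV.trans hW, hxV, hP, ?_⟩
  rw [← restrict_comp X.sheaf.presheaf hW hV, ← Forms.map_map, Forms.map_map _ (toQuot _),
    ← toQuot_quotMap, ← Forms.map_map, h, map_zero]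

open SuperAlg in
/-- A function killed by restriction to the bosonization and by `d` is locally zero. -/
lemma IsSmooth.exists_map_restrict_eq_zero (hX : X.IsSmooth) {U : X.evenScheme.Opens}
    {x : X.evenScheme} (hx : x ∈ U) {ω : (X.sheaf.sections U).Forms}
    (hω : ω ∈ (X.sheaf.sections U).formsDeg 0) (hd : Forms.d _ ω = 0)
    (h : Forms.map (X.sheaf.toBoson.app (op U)) ω = 0) :
    ∃ (V : X.evenScheme.Opens) (hV : V ≤ U), x ∈ V ∧
      Forms.map (restrict X.sheaf.presheaf hV) ω = 0 := by
  obtain ⟨V, hV, hxV, hP, h'⟩ := hX.exists_isPoincare_map_toQuot_eq_zero hx h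
  refine ⟨V, hV, hxV, hP.eq_zero (Forms.map_mem _ hω) ?_ h'⟩
  rw [← Forms.map_d _ hω, hd, map_zero]

open SuperAlg in
/-- The Poincaré lemma for forms killed by restriction to the bosonization. -/
lemma IsSmooth.exists_d_eq (hX : X.IsSmooth) {U : X.evenScheme.Opens}
    {x : X.evenScheme} (hx : x ∈ U) {p : ℕ} {ω : (X.sheaf.sections U).Forms}
    (hω : ω ∈ (X.sheaf.sections U).formsDeg (p + 1)) (hd : Forms.d _ ω = 0)
    (h : Forms.map (X.sheaf.toBoson.app (op U)) ω = 0) :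
    ∃ (V : X.evenScheme.Opens) (hV : V ≤ U), x ∈ V ∧
      ∃ η ∈ (X.sheaf.sections V).formsDeg p,
        Forms.d _ η = Forms.map (restrict X.sheaf.presheaf hV) ω ∧
        Forms.map (X.sheaf.toBoson.app (op V)) η = 0 := by
  obtain ⟨V, hV, hxV, hP, h'⟩ := hX.exists_isPoincare_map_toQuot_eq_zero hx h
  obtain ⟨η, hη, hdη, hη'⟩ := hP.exists_mem (Forms.map_mem _ hω)
    (by rw [← Forms.map_d _ hω, hd, map_zero]) h'
  refine ⟨V, hV, hxV, η, hη, hdη, ?_⟩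
  exact (Forms.map_map (X.sheaf.sections V).toQuot (X.sheaf.quotToBoson.app (op V)) η).symm.trans
    ((congrArg _ hη').trans (map_zero _))

variable (X)

/-- The restriction of forms to the bosonization, as a map of complexes of presheaves. -/
def presheafToBoson :=
  (complexOfFunctor (ComplexShape.up ℕ)).map
    (Functor.whiskerRight X.sheaf.toBoson (SuperAlg.deRham k))

lemma epi_deRhamToBoson : Epi X.deRhamToBoson := by
  have (p : ℕ) : Epi (X.deRhamToBoson.f p) := by
    refine epi_presheafToSheaf_map (X.presheafToBoson.f p) fun U s x hx => ?_
    obtain ⟨V, hV, hxV, η, hη, h⟩ := X.sheaf.exists_map_toBoson_eq p s.2 hx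
    exact ⟨V, hV, hxV, ⟨η, hη⟩, Subtype.ext h⟩
  exact HomologicalComplex.epi_of_epi_f _ this

variable {X}

/-- The form underlying a section of the kernel of the restriction to the bosonization. -/
def kernelForm {p : ℕ} {V : X.evenScheme.Opens}
    (t : ((Limits.kernel X.presheafToBoson).X p).obj (op V)) : (X.sheaf.sections V).formsDeg p :=
  (((Limits.kernel.ι X.presheafToBoson).f p).app (op V)).hom t

lemma kernelForm_injective (p : ℕ) (V : X.evenScheme.Opens) :
    Function.Injective (kernelForm (X := X) (p := p) (V := V)) :=
  (ModuleCat.mono_iff_injective _).1 (inferInstanceAs (Mono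
    ((HomologicalComplex.eval _ _ p ⋙ (evaluation _ _).obj (op V)).map
      (Limits.kernel.ι X.presheafToBoson))))

lemma kernelForm_zero (p : ℕ) (V : X.evenScheme.Opens) :
    kernelForm (X := X) (p := p) (V := V) 0 = 0 :=
  map_zero (((Limits.kernel.ι X.presheafToBoson).f p).app (op V)).hom

lemma map_toBoson_kernelForm {p : ℕ} {V : X.evenScheme.Opens}
    (t : ((Limits.kernel X.presheafToBoson).X p).obj (op V)) :
    SuperAlg.Forms.map (X.sheaf.toBoson.app (op V)) (kernelForm t).1 = 0 := by
  have h := congrArg (fun f => ((f.f p).app (op V)).hom t)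
    (Limits.kernel.condition X.presheafToBoson)
  exact congrArg Subtype.val h

/-- The kernel consists of all forms killed by restriction to the bosonization. -/
lemma exists_kernelForm_eq {p : ℕ} {V : X.evenScheme.Opens}
    {η : (X.sheaf.sections V).Forms} (hη : η ∈ (X.sheaf.sections V).formsDeg p)
    (h : SuperAlg.Forms.map (X.sheaf.toBoson.app (op V)) η = 0) :
    ∃ t : ((Limits.kernel X.presheafToBoson).X p).obj (op V), (kernelForm t).1 = η := by
  have hS := (ShortComplex.exact_kernel X.presheafToBoson).map_of_mono_of_preservesKernel
    (HomologicalComplex.eval _ _ p ⋙ (evaluation _ _).obj (op V)) inferInstance inferInstance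
  rw [ShortComplex.moduleCat_exact_iff] at hS
  obtain ⟨t, ht⟩ := hS (⟨η, hη⟩ : (X.sheaf.sections V).formsDeg p) (Subtype.ext h)
  exact ⟨t, congrArg Subtype.val ht⟩

lemma kernelForm_map {p : ℕ} {U V : X.evenScheme.Opens} (hV : V ≤ U)
    (t : ((Limits.kernel X.presheafToBoson).X p).obj (op U)) :
    (kernelForm ((((Limits.kernel X.presheafToBoson).X p).map (homOfLE hV).op).hom t)).1 =
      SuperAlg.Forms.map (SuperAlg.restrict X.sheaf.presheaf hV) (kernelForm t).1 := by
  have h := congrArg (fun f => f.hom t)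
    (((Limits.kernel.ι X.presheafToBoson).f p).naturality (homOfLE hV).op)
  exact congrArg Subtype.val h

lemma kernelForm_d {p : ℕ} {V : X.evenScheme.Opens}
    (t : ((Limits.kernel X.presheafToBoson).X p).obj (op V)) :
    (kernelForm ((((Limits.kernel X.presheafToBoson).d p (p + 1)).app (op V)).hom t)).1 =
      SuperAlg.Forms.d _ (kernelForm t).1 := by
  have h := congrArg (fun f => (f.app (op V)).hom t)
    ((Limits.kernel.ι X.presheafToBoson).comm p (p + 1))
  have h' := congrArg (fun f => f.hom (kernelForm t))
    (SuperAlg.deRhamObj_d (X.sheaf.sections V) p)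
  exact congrArg Subtype.val (h.symm.trans h')

lemma IsSmooth.acyclic_kernel_presheafToBoson (hX : X.IsSmooth) :
    (((presheafToSheaf (Opens.grothendieckTopology X.evenScheme.carrier)
      (ModuleCat.{u} k)).mapHomologicalComplex _).obj
        (Limits.kernel X.presheafToBoson)).Acyclic := by
  refine acyclic_mapHomologicalComplex_presheafToSheaf _ (fun U s hs x hx => ?_)
    (fun p U s hs x hx => ?_)
  · obtain ⟨V, hV, hxV, h⟩ := hX.exists_map_restrict_eq_zero hx (kernelForm s).2
      ((kernelForm_d s).symm.trans (congrArg Subtype.val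
        ((congrArg kernelForm hs).trans (kernelForm_zero _ _)))) (map_toBoson_kernelForm s)
    exact ⟨V, hV, hxV, kernelForm_injective _ _ ((Subtype.ext ((kernelForm_map hV s).trans h)).trans
      (kernelForm_zero _ _).symm)⟩
  · obtain ⟨V, hV, hxV, η, hη, hd, h⟩ := hX.exists_d_eq hx (kernelForm s).2
      ((kernelForm_d s).symm.trans (congrArg Subtype.val
        ((congrArg kernelForm hs).trans (kernelForm_zero _ _)))) (map_toBoson_kernelForm s)
    have ht := exists_kernelForm_eq (X := X) (p := p) (V := V) (η := η) hη h
    refine ⟨V, hV, hxV, ht.imp fun t ht => ?_⟩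
    have e := (kernelForm_d t).trans ((congrArg _ ht).trans (hd.trans (kernelForm_map hV s).symm))
    exact kernelForm_injective _ _ (Subtype.ext e)

/-- Sheafification is exact, so the kernel may be computed on presheaves. -/
lemma IsSmooth.acyclic_kernel_deRhamToBoson (hX : X.IsSmooth) :
    (Limits.kernel X.deRhamToBoson).Acyclic := by
  let G := (presheafToSheaf (Opens.grothendieckTopology X.evenScheme.carrier)
    (ModuleCat.{u} k)).mapHomologicalComplex (ComplexShape.up ℕ)
  have hK : (G.obj (Limits.kernel X.presheafToBoson)).Acyclic := hX.acyclic_kernel_presheafToBoson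
  have hp : Limits.PreservesLimit (Limits.parallelPair X.presheafToBoson 0) G := inferInstance
  have e : G.obj (Limits.kernel X.presheafToBoson) ≅ Limits.kernel (G.map X.presheafToBoson) :=
    Limits.PreservesKernel.iso G X.presheafToBoson
  have h : (Limits.kernel (G.map X.presheafToBoson)).Acyclic := fun p => (hK p).of_iso e
  exact h

end Superscheme

end

theorem theorem1p1 {k : Type u} [Field k] (X : Superscheme k) (hX : X.IsSmooth) :
    Epi X.deRhamToBoson ∧
    (Limits.kernel X.deRhamToBoson).Acyclic ∧
    ∀ n : ℤ, IsIso (X.deRhamCohomologyToBoson n) := by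
  have := X.epi_deRhamToBoson
  have h := hX.acyclic_kernel_deRhamToBoson
  have := quasiIso_of_epi_of_acyclic_kernel X.deRhamToBoson h
  exact ⟨inferInstance, h, fun n => isIso_hypercohomology_map X.deRhamToBoson n⟩
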